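/- A genus 2 curve over $\overline{\mathbb Q}$ is a curve $C : y^2=f(x)$ with $f=\sum_{i=0}^{6}a_ix^i\in\overline{\mathbb Q}[x]$ separable of degree $5$ or $6$. Its automorphism group $\operatorname{Aut}(C)$ is the group of $\overline{\mathbb Q}$-automorphisms of its function field $\overline{\mathbb Q}(x)[y]/(y^2-f)$. Let $J_2,J_4,J_6,J_{10}$ be the integral invariants of the binary sextic $\sum a_i x^i z^{6-i}$, normalised so that, for $f=a_6\prod_{i=1}^6(x-x_i)$ and with $(ij)=x_i-x_j$, $$J_2=a_6^2\sum_{15}(12)^2(34)^2(56)^2,\qquad J_4=a_6^4\sum_{10}(12)^2(23)^2(31)^2(45)^2(56)^2(64)^2,$$ $$J_6=a_6^6\sum_{60}(12)^2(23)^2(31)^2(45)^2(56)^2(64)^2(14)^2(25)^2(36)^2,\qquad J_{10}=a_6^{10}\prod_{i<j}(ij)^2,$$ where the sums run over the distinct terms obtained by permuting the roots (equivalently, they are given by their polynomial expressions in $a_0,\dots,a_6$, which also define them in degree $5$). The moduli point of $C$ is the point $[C]=[J_2:J_4:J_6:J_{10}]$ of the weighted projective space $\mathbb{WP}^3_{(2,4,6,10)}$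 over $\overline{\mathbb Q}$, and $\mathcal M_2(\mathbb Q)$ denotes the set of those moduli points of genus 2 curves over $\overline{\mathbb Q}$ that have rational coordinates. The moduli height of $\mathfrak p=[J_2:J_4:J_6:J_{10}]\in\mathcal M_2(\mathbb Q)$ is the usual (multiplicative) height of the point $[J_2^5:J_4J_2^3:J_6J_2^2:J_{10}]$ of $\mathbb P^3(\mathbb Q)$. Say that $\mathfrak p$ has extra automorphisms if $\mathfrak p=[C]$ for some genus 2 curve $C$ over $\overline{\mathbb Q}$ with $|\operatorname{Aut}(C)|>2$. **Lemma.** (a) For all sufficiently large integers $h$ the set of points of $\mathcal M_2(\mathbb Q)$ of moduli height exactly $h$ is finite and non-empty, and the proportion of those points that have extra automorphisms tends to $0$ as $h\to\infty$. (b) The same holds for the set of points $\mathfrak p\in\mathcal M_2(\mathbb Q)$ with $J_2\neq0$ and moduli height at most $h$. In particular, for large enough moduli height $h$, the majority of genus 2 curves with moduli height $h$ do not have extra automorphisms. -/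

import Mathlib

open Polynomial Filter Topology

noncomputable section

namespace GenusTwo

/-- The field of algebraic numbers. -/
abbrev QBar : Type := AlgebraicClosure ℚ

/-! ### Genus 2 curves and their automorphisms -/

/-- A genus 2 curve `y ^ 2 = f x` over a field `k` (of characteristic zero): `f` is a separable
polynomial of degree 5 or 6, i.e. the binary sextic `z ^ 6 f (x / z)` has nonzero discriminant. -/
structure Curve (k : Type) [Field k] where
  /-- the defining polynomial -/
  f : k[X]
  natDegree_f : f.natDegree = 5 ∨ f.natDegree = 6
  separable_f : f.Separable

/-- The function field `k(x)[y] / (y ^ 2 - f x)` of the curve. -/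
abbrev Curve.FunctionField {k : Type} [Field k] (C : Curve k) : Type :=
  AdjoinRoot (X ^ 2 - Polynomial.C (algebraMap k[X] (RatFunc k) C.f) : (RatFunc k)[X])

/-- The automorphism group of a curve: the `k`-automorphisms of its function field. -/
abbrev Curve.Aut {k : Type} [Field k] (C : Curve k) : Type :=
  C.FunctionField ≃ₐ[k] C.FunctionField

/-- The curve has extra automorphisms: its automorphism group is larger than the group of
order two generated by the hyperelliptic involution. -/
def Curve.HasExtraAutomorphism {k : Type} [Field k] (C : Curve k) : Prop :=
  2 < ENat.card C.Aut

/-! ### Invariants of binary sextics -/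

/-- The invariant `J₂` of the binary sextic `∑ aᵢ xⁱ z⁶⁻ⁱ`. -/
def J2 {k : Type} [Field k] (a : ℕ → k) : k :=
  6 * a 3 ^ 2 - 240 * a 0 * a 6 + 40 * a 1 * a 5 - 16 * a 2 * a 4

/-- The invariant `J₄` of the binary sextic `∑ aᵢ xⁱ z⁶⁻ⁱ`. -/
def J4 {k : Type} [Field k] (a : ℕ → k) : k :=
  48 * a 0 * a 4 ^ 3 + 48 * a 2 ^ 3 * a 6 + 4 * a 2 ^ 2 * a 4 ^ 2 + 1620 * a 0 ^ 2 * a 6 ^ 2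
    + 36 * a 1 * a 3 ^ 2 * a 5 - 12 * a 1 * a 3 * a 4 ^ 2 - 12 * a 2 ^ 2 * a 3 * a 5
    + 300 * a 1 ^ 2 * a 4 * a 6 + 300 * a 0 * a 5 ^ 2 * a 2 + 324 * a 0 * a 6 * a 3 ^ 2
    - 504 * a 0 * a 4 * a 2 * a 6 - 180 * a 0 * a 4 * a 3 * a 5 - 180 * a 1 * a 3 * a 2 * a 6
    + 4 * a 1 * a 4 * a 2 * a 5 - 540 * a 0 * a 5 * a 1 * a 6 - 80 * a 1 ^ 2 * a 5 ^ 2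

/-- The invariant `J₆` of the binary sextic `∑ aᵢ xⁱ z⁶⁻ⁱ`. -/
def J6 {k : Type} [Field k] (a : ℕ → k) : k :=
  176 * a 1 ^ 2 * a 5 ^ 2 * a 3 ^ 2 + 64 * a 1 ^ 2 * a 5 ^ 2 * a 4 * a 2
    + 1600 * a 1 ^ 3 * a 5 * a 4 * a 6 + 1600 * a 1 * a 5 ^ 3 * a 0 * a 2
    - 160 * a 0 * a 4 ^ 4 * a 2 - 96 * a 0 ^ 2 * a 4 ^ 3 * a 6 + 60 * a 0 * a 4 ^ 3 * a 3 ^ 2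
    + 72 * a 1 * a 3 ^ 4 * a 5 - 24 * a 1 * a 3 ^ 3 * a 4 ^ 2 - 119880 * a 0 ^ 3 * a 6 ^ 3
    - 320 * a 1 ^ 3 * a 5 ^ 3 - 160 * a 2 ^ 4 * a 4 * a 6 - 96 * a 2 ^ 3 * a 0 * a 6 ^ 2
    + 60 * a 2 ^ 3 * a 3 ^ 2 * a 6 - 24 * a 2 ^ 2 * a 3 ^ 3 * a 5
    + 8 * a 2 ^ 2 * a 3 ^ 2 * a 4 ^ 2 - 900 * a 2 ^ 2 * a 1 ^ 2 * a 6 ^ 2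
    - 24 * a 2 ^ 3 * a 4 ^ 3 - 36 * a 2 ^ 4 * a 5 ^ 2 - 36 * a 1 ^ 2 * a 4 ^ 4
    + 424 * a 0 * a 4 ^ 2 * a 2 ^ 2 * a 6 - 2240 * a 1 ^ 2 * a 5 ^ 2 * a 0 * a 6
    + 2250 * a 1 ^ 3 * a 3 * a 6 ^ 2 + 492 * a 0 * a 4 ^ 2 * a 2 * a 3 * a 5
    + 20664 * a 0 ^ 2 * a 4 * a 6 ^ 2 * a 2 + 3060 * a 0 ^ 2 * a 4 * a 6 * a 3 * a 5
    - 468 * a 0 * a 4 * a 3 ^ 2 * a 2 * a 6 - 198 * a 0 * a 4 * a 3 ^ 3 * a 5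
    - 640 * a 0 * a 4 * a 2 ^ 2 * a 5 ^ 2 + 3472 * a 0 * a 4 * a 2 * a 5 * a 1 * a 6
    - 18600 * a 0 * a 4 * a 1 ^ 2 * a 6 ^ 2 - 876 * a 0 * a 4 ^ 2 * a 1 * a 6 * a 3
    + 492 * a 1 * a 3 * a 2 ^ 2 * a 4 * a 6 - 238 * a 1 * a 3 ^ 2 * a 2 * a 4 * a 5
    + 76 * a 1 * a 3 * a 2 * a 4 ^ 3 + 3060 * a 1 * a 3 * a 0 * a 6 ^ 2 * a 2
    + 1818 * a 1 * a 3 ^ 2 * a 0 * a 6 * a 5 + 26 * a 1 * a 3 * a 2 ^ 2 * a 5 ^ 2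
    - 1860 * a 1 ^ 2 * a 3 * a 2 * a 5 * a 6 + 330 * a 1 ^ 2 * a 3 ^ 2 * a 6 * a 4
    + 76 * a 2 ^ 3 * a 4 * a 3 * a 5 - 876 * a 2 ^ 2 * a 0 * a 6 * a 3 * a 5
    + 616 * a 2 ^ 3 * a 5 * a 1 * a 6 + 2250 * a 0 ^ 2 * a 5 ^ 3 * a 3
    - 10044 * a 0 ^ 2 * a 6 ^ 2 * a 3 ^ 2 + 28 * a 1 * a 4 ^ 2 * a 2 ^ 2 * a 5
    - 640 * a 1 ^ 2 * a 4 ^ 2 * a 2 * a 6 + 26 * a 1 ^ 2 * a 4 ^ 2 * a 3 * a 5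
    - 1860 * a 1 * a 4 * a 0 * a 5 ^ 2 * a 3 + 616 * a 1 * a 4 ^ 3 * a 0 * a 5
    - 18600 * a 0 ^ 2 * a 5 ^ 2 * a 6 * a 2 + 59940 * a 0 ^ 2 * a 5 * a 6 ^ 2 * a 1
    + 330 * a 0 * a 5 ^ 2 * a 3 ^ 2 * a 2 + 162 * a 0 * a 6 * a 3 ^ 4
    - 900 * a 0 ^ 2 * a 5 ^ 2 * a 4 ^ 2 - 198 * a 1 * a 3 ^ 3 * a 2 * a 6

/-- The invariant `J₁₀` of a curve: the discriminant of the binary sextic `z ^ 6 f (x / z)`. If `f`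
has degree 5, the sextic has a root at infinity, and its discriminant is the square of the leading
coefficient of `f` times the discriminant of the quintic `f`. -/
def Curve.J10 {k : Type} [Field k] (C : Curve k) : k :=
  if C.f.natDegree = 6 then C.f.discr else C.f.leadingCoeff ^ 2 * C.f.discr

/-- The vector `(J₂, J₄, J₆, J₁₀)` of a curve. -/
def Curve.invariants {k : Type} [Field k] (C : Curve k) : Fin 4 → k :=
  ![J2 C.f.coeff, J4 C.f.coeff, J6 C.f.coeff, C.J10]

/-! ### The weighted projective space with weights 2, 4, 6, 10 -/

/-- The weights of `J₂, J₄, J₆, J₁₀`. -/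
def weight : Fin 4 → ℕ := ![2, 4, 6, 10]

/-- Two vectors define the same point of the weighted projective space over `k`. -/
def WeightedEquiv {k : Type} [Field k] (x y : Fin 4 → k) : Prop :=
  ∃ r : kˣ, ∀ i, x i = (r : k) ^ weight i * y i

theorem WeightedEquiv.refl {k : Type} [Field k] (x : Fin 4 → k) : WeightedEquiv x x :=
  ⟨1, fun i => by simp⟩

theorem WeightedEquiv.symm {k : Type} [Field k] {x y : Fin 4 → k} (h : WeightedEquiv x y) :
    WeightedEquiv y x := by
  obtain ⟨r, hr⟩ := h
  refine ⟨r⁻¹, fun i => ?_⟩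
  rw [hr i, ← mul_assoc, ← mul_pow]
  simp

theorem WeightedEquiv.trans {k : Type} [Field k] {x y z : Fin 4 → k} (h : WeightedEquiv x y)
    (h' : WeightedEquiv y z) : WeightedEquiv x z := by
  obtain ⟨r, hr⟩ := h
  obtain ⟨s, hs⟩ := h'
  refine ⟨r * s, fun i => ?_⟩
  rw [hr i, hs i, Units.val_mul, mul_pow, mul_assoc]

/-- A rational vector, regarded as a vector of algebraic numbers. -/
def toQBar (q : Fin 4 → ℚ) : Fin 4 → QBar := fun i => algebraMap ℚ QBar (q i)

/-- Nonzero rational vectors, identified when they define the same geometric point, i.e. the same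
point of the weighted projective space over the algebraic numbers. -/
instance weightedSetoid : Setoid {q : Fin 4 → ℚ // q ≠ 0} where
  r p q := WeightedEquiv (toQBar p.1) (toQBar q.1)
  iseqv := ⟨fun _ => .refl _, .symm, .trans⟩

/-- The rational points of the weighted projective space with weights 2, 4, 6, 10. -/
def WPQ : Type := Quotient weightedSetoid

/-- The coordinates `[J₂⁵ : J₄ J₂³ : J₆ J₂² : J₁₀]` in three-dimensional projective space. -/
def projCoords (q : Fin 4 → ℚ) : Fin 4 → ℚ :=
  ![q 0 ^ 5, q 1 * q 0 ^ 3, q 2 * q 0 ^ 2, q 3]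

theorem mulHeight_projCoords_congr (p q : {q : Fin 4 → ℚ // q ≠ 0}) (h : p ≈ q) :
    Height.mulHeight (projCoords p.1) = Height.mulHeight (projCoords q.1) := by
  obtain ⟨r, hr⟩ := h
  have key : ∀ i, algebraMap ℚ QBar (projCoords p.1 i) =
      (r : QBar) ^ 10 * algebraMap ℚ QBar (projCoords q.1 i) := by
    have h0 := hr 0
    have h1 := hr 1
    have h2 := hr 2
    have h3 := hr 3
    simp only [toQBar, weight] at h0 h1 h2 h3
    intro i
    fin_cases i
    · simp [projCoords] at h0 ⊢
      rw [h0]; ring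
    · simp [projCoords] at h0 h1 ⊢
      rw [h0, h1]; ring
    · simp [projCoords] at h0 h2 ⊢
      rw [h0, h2]; ring
    · simpa [projCoords] using h3
  by_cases hz : projCoords q.1 = 0
  · have hz' : projCoords p.1 = 0 := by
      funext i
      have := key i
      rw [hz] at this
      simpa using this
    rw [hz, hz']
  · obtain ⟨j, hj⟩ := Function.ne_iff.mp hz
    have hj' : projCoords q.1 j ≠ 0 := hj
    set c : ℚ := projCoords p.1 j / projCoords q.1 j with hc
    have hjq : algebraMap ℚ QBar (projCoords q.1 j) ≠ 0 := by
      simpa using hj'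
    have hcr : algebraMap ℚ QBar c = (r : QBar) ^ 10 := by
      rw [hc, map_div₀, key j, mul_div_assoc, div_self hjq, mul_one]
    have hc0 : c ≠ 0 := by
      intro h0
      rw [h0, map_zero] at hcr
      exact pow_ne_zero 10 r.ne_zero hcr.symm
    have hsm : projCoords p.1 = c • projCoords q.1 := by
      funext i
      apply (algebraMap ℚ QBar).injective
      rw [key i, Pi.smul_apply, smul_eq_mul, map_mul, hcr]
    rw [hsm, Height.mulHeight_smul_eq_mulHeight _ hc0]

/-- The moduli height of a rational point `[J₂ : J₄ : J₆ : J₁₀]`: the usual height of the point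
`[J₂⁵ : J₄ J₂³ : J₆ J₂² : J₁₀]` of projective space. -/
def moduliHeight (p : WPQ) : ℝ :=
  Quotient.lift (fun q : {q : Fin 4 → ℚ // q ≠ 0} => Height.mulHeight (projCoords q.1))
    mulHeight_projCoords_congr p

/-- The coordinate `J₂` does not vanish at the point. -/
def J2NeZero (p : WPQ) : Prop :=
  ∃ q : {q : Fin 4 → ℚ // q ≠ 0}, (Quotient.mk _ q : WPQ) = p ∧ q.1 0 ≠ 0

/-! ### Rational points of the moduli space of genus 2 curves -/

/-- `p = [C]`, the moduli point of the curve `C` over the algebraic numbers. -/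
def Curve.HasModuliPoint (C : Curve QBar) (p : WPQ) : Prop :=
  ∃ q : {q : Fin 4 → ℚ // q ≠ 0},
    (Quotient.mk _ q : WPQ) = p ∧ WeightedEquiv C.invariants (toQBar q.1)

/-- The rational points of the moduli space of genus 2 curves. -/
def M2Q : Set WPQ := {p | ∃ C : Curve QBar, C.HasModuliPoint p}

/-- The rational points whose curve has extra automorphisms. -/
def M2QExtra : Set WPQ :=
  {p | ∃ C : Curve QBar, C.HasModuliPoint p ∧ C.HasExtraAutomorphism}

end GenusTwo

end

noncomputable section

namespace GenusTwo

/-! ### Regularity of `du / v` -/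

section Regularity

variable {k K : Type*} [Field k] [Field K] [Algebra k K]

/-! The proof is a dimension count. Away from `J₂ = 0`, a rational point corresponds to a primitive
integer vector `n` with `n 0 ≠ 0`, up to sign, and its moduli height is the maximum norm of `n`.
Points of height `h > 1` automatically have `J₂ ≠ 0`, because `J₂ = 0` collapses the projective
coordinates to `[0 : 0 : 0 : J₁₀]`.

Upper bound. An automorphism `σ` carries the regular differentials `dx/y` and `x dx/y` to regular
differentials, which are `dx/y` times a polynomial of degree at most 1 in `x`. Hence `σ x` is a
quotient of linear polynomials, and the matrix `g` obtained preserves the binary sextic up to a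
scalar. If there are more than two automorphisms, some `g` is not scalar. It can be conjugated to a
diagonal matrix, since a nontrivial Jordan block would translate the finite root set to itself. A
sextic with a diagonal symmetry is, up to rescaling, in one of five families with at most two
parameters (`Curve.exists_normalForm`). With one further parameter for the projective scaling, the
coordinates `(J₂⁵, J₄J₂³, J₆J₂², J₁₀)` are four polynomials in three variables, so they satisfy a
nonzero relation `G = 0` (`exists_relation_of_hasExtraAutomorphism`). By Schwartz–Zippel on the
faces of the cube, only `O(h²)` integer vectors of norm `h` lie on this hypersurface
(`exists_extra_bound`).

Lower bound. The four-parameter family `w₀ x (x - 1) (x - w₁) (x - w₂) (x - w₃)` has algebraically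
independent coordinates, by the Jacobian criterion at one point. The coordinate map is therefore
dominant, and every rational vector off a hypersurface comes from a curve over the algebraic numbers
(`exists_curve_of_eval_ne_zero`). The vectors `(h, a, b, c)` with `a` coprime to `h` already give at
least `φ(h) h² - O(h²)` distinct points of height `h` (`exists_lower_bound`).

Since `φ(h) → ∞`, the ratio of the two counts tends to 0. The statement for height at most `h`
follows by summation, because the total number of points diverges. -/

theorem aeval_mem_valuationSubring (O : ValuationSubring K) (hk : ∀ c : k, algebraMap k K c ∈ O)
    {u : K} (hu : u ∈ O) (p : k[X]) : aeval u p ∈ O := by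
  rw [aeval_eq_sum_range]
  refine sum_mem fun i _ => ?_
  rw [Algebra.smul_def]
  exact mul_mem (hk _) (pow_mem hu i)

theorem mem_valuationSubring_of_sq_mem (O : ValuationSubring K) {v : K} (hv : v ^ 2 ∈ O) :
    v ∈ O := by
  rcases O.mem_or_inv_mem v with h | h
  · exact h
  · by_cases h0 : v = 0
    · rw [h0]; exact zero_mem O
    · have : v = v ^ 2 * v⁻¹ := by field_simp
      rw [this]; exact mul_mem hv h

/-- Separability gives `a f + b f' = 1`, and differentiating `v² = f(u)` gives `f'(u) Du = 2 v Dv`.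
Together they yield `Du / v = a(u) v Du + 2 b(u) Dv`, in which no denominator is left. When `D = y
d/dx`, the element `Du / v` is the quotient of the differentials `du/v` and `dx/y`. -/
theorem derivation_div_mem_of_mem (O : ValuationSubring K) (hk : ∀ c : k, algebraMap k K c ∈ O)
    (D : Derivation k K K) (hD : ∀ a ∈ O, D a ∈ O) {f : k[X]} (hf : f.Separable) {u v : K}
    (hv : v ^ 2 = aeval u f) (hu : u ∈ O) : D u / v ∈ O := by
  by_cases h0 : v = 0
  · rw [h0, div_zero]; exact zero_mem O
  obtain ⟨a, b, hab⟩ := hf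
  have hvO : v ∈ O := mem_valuationSubring_of_sq_mem O
    (hv ▸ aeval_mem_valuationSubring O hk hu f)
  have h1 : aeval u a * v ^ 2 + aeval u b * aeval u (derivative f) = 1 := by
    rw [hv, ← map_mul, ← map_mul, ← map_add, hab, map_one]
  have h2 : aeval u (derivative f) * D u = 2 * v * D v := by
    have := congrArg D hv
    rw [D.leibniz_pow, D.map_aeval] at this
    simp only [smul_eq_mul, nsmul_eq_mul] at this
    rw [← this]; push_cast; ring
  have h3 : D u / v = aeval u a * v * D u + aeval u b * (2 * D v) := by
    field_simp
    linear_combination (-D u) * h1 + aeval u b * h2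
  rw [h3]
  have hDv := hD v hvO
  exact add_mem (mul_mem (mul_mem (aeval_mem_valuationSubring O hk hu a) hvO) (hD u hu))
    (mul_mem (aeval_mem_valuationSubring O hk hu b) (two_mul (D v) ▸ add_mem hDv hDv))

/-- If `u` has a pole, the pair `(1/u, v/u³)` lies on the curve of the reversed polynomial, and `u
Du / v` equals `-D(1/u) / (v/u³)`, so the previous case applies to it. -/
theorem derivation_div_mem (O : ValuationSubring K) (hk : ∀ c : k, algebraMap k K c ∈ O)
    (D : Derivation k K K) (hD : ∀ a ∈ O, D a ∈ O) {f : k[X]} (hf : f.Separable)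
    (hd : f.natDegree ≤ 6) (hf' : (f.reflect 6).Separable) {u v : K}
    (hv : v ^ 2 = aeval u f) : D u / v ∈ O ∧ u * (D u / v) ∈ O := by
  rcases O.mem_or_inv_mem u with hu | hu
  · have := derivation_div_mem_of_mem O hk D hD hf hv hu
    exact ⟨this, mul_mem hu this⟩
  by_cases hu0 : u = 0
  · subst hu0
    simp
  by_cases h0 : v = 0
  · simp [h0]
  have hw : (v * u⁻¹ ^ 3) ^ 2 = aeval u⁻¹ (f.reflect 6) := by
    let := invertibleOfNonzero hu0
    have h := eval₂_reflect_mul_pow (algebraMap k K) u 6 f hd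
    rw [invOf_eq_inv, ← aeval_def, ← aeval_def, ← hv] at h
    rw [mul_pow, ← h]
    field_simp
  have key := derivation_div_mem_of_mem O hk D hD hf' hw hu
  have hDu : D u⁻¹ = -(u⁻¹ ^ 2 * D u) := by
    rw [Derivation.leibniz_inv]; simp
  have h1 : u * (D u / v) = -(D u⁻¹ / (v * u⁻¹ ^ 3)) := by
    rw [hDu]; field_simp
  have h2 : D u / v = u⁻¹ * (u * (D u / v)) := by field_simp
  have h3 : u * (D u / v) ∈ O := h1 ▸ neg_mem key
  exact ⟨h2 ▸ mul_mem hu h3, h3⟩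

end Regularity

end GenusTwo

end

/-! ### Regular functions on the affine curve -/

noncomputable section

namespace GenusTwo

section AffineModel

variable {k K : Type} [Field k] [Field K] [Algebra k K]

/-- The square of the denominator of `q` would divide the squarefree `f`, so the denominator is a
unit. -/
theorem mem_range_algebraMap_of_sq_mul_mem {f : k[X]} (hf : Squarefree f) {q : RatFunc k}
    (h : q ^ 2 * algebraMap k[X] (RatFunc k) f ∈ (algebraMap k[X] (RatFunc k)).range) :
    q ∈ (algebraMap k[X] (RatFunc k)).range := by
  obtain ⟨c, hc⟩ := h
  have hb : q.denom ≠ 0 := q.denom_ne_zero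
  have hb' : algebraMap k[X] (RatFunc k) q.denom ≠ 0 := by simpa using hb
  have h1 : q.num ^ 2 * f = c * q.denom ^ 2 := by
    apply IsFractionRing.injective k[X] (RatFunc k)
    have h2 : q * algebraMap k[X] (RatFunc k) q.denom = algebraMap k[X] (RatFunc k) q.num := by
      rw [← eq_div_iff hb', q.num_div_denom]
    rw [map_mul, map_mul, map_pow, map_pow, hc, ← h2]; ring
  have hcop : IsCoprime (q.denom * q.denom) (q.num ^ 2) := by
    have := q.isCoprime_num_denom.symm
    exact (this.mul_left this).pow_right
  have hdvd : q.denom * q.denom ∣ f :=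
    hcop.dvd_of_dvd_mul_left ⟨c, by rw [h1]; ring⟩
  have hu : IsUnit q.denom := hf _ hdvd
  obtain ⟨e, he⟩ := hu.exists_right_inv
  refine ⟨q.num * e, ?_⟩
  have h2 : algebraMap k[X] (RatFunc k) e = (algebraMap k[X] (RatFunc k) q.denom)⁻¹ :=
    eq_inv_of_mul_eq_one_right (by rw [← map_mul, he, map_one])
  rw [map_mul, h2, ← div_eq_mul_inv, q.num_div_denom]

/-- The trace `2p` and the norm `p² - q² f` of an integral `p + q y` are integral over `k[x]`, hence
polynomials; `f` being squarefree then makes `q` a polynomial too. So the integral closure of `k[x]`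
is `k[x] + k[x] y`. -/
theorem exists_polynomial_of_isIntegral [CharZero k] (φ : RatFunc k →ₐ[k] K) {f : k[X]}
    (hf : Squarefree f) {y : K} (hy : y ^ 2 = φ (algebraMap k[X] (RatFunc k) f))
    (hspan : ∀ w : K, ∃ p q : RatFunc k, w = φ p + φ q * y) (ι : K →+* K)
    (hι : ∀ p, ι (φ p) = φ p) (hιy : ι y = -y) {w : K}
    (hw : (φ.toRingHom.comp (algebraMap k[X] (RatFunc k))).IsIntegralElem w) :
    ∃ p q : k[X], w = φ (algebraMap k[X] (RatFunc k) p) + φ (algebraMap k[X] (RatFunc k) q) * y := by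
  set θ := φ.toRingHom.comp (algebraMap k[X] (RatFunc k)) with hθ
  have hιθ : ι.comp θ = θ := by
    ext x <;> simp [hθ, hι]
  have hw' : θ.IsIntegralElem (ι w) := by
    obtain ⟨P, hP, h⟩ := hw
    refine ⟨P, hP, ?_⟩
    have := congrArg ι h
    rwa [hom_eval₂, map_zero, hιθ] at this
  have key : ∀ r : RatFunc k, θ.IsIntegralElem (φ r) → r ∈ (algebraMap k[X] (RatFunc k)).range := by
    rintro r ⟨P, hP, h⟩
    have hr : IsIntegral k[X] r := by
      refine ⟨P, hP, ?_⟩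
      apply φ.toRingHom.injective
      rw [hom_eval₂, map_zero]
      exact h
    exact (IsIntegrallyClosed.isIntegral_iff).mp hr
  have h2 : IsUnit (2 : k) := by simp
  obtain ⟨p, q, rfl⟩ := hspan w
  have hadd : θ.IsIntegralElem (φ (p + p)) := by
    have := RingHom.IsIntegralElem.add θ hw hw'
    rwa [map_add, map_mul, hι, hι, hιy, show φ p + φ q * y + (φ p + φ q * -y) = φ (p + p) by
      rw [map_add]; ring] at this
  have hmul : θ.IsIntegralElem (φ (p ^ 2 - q ^ 2 * algebraMap k[X] (RatFunc k) f)) := by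
    have := RingHom.IsIntegralElem.mul θ hw hw'
    rwa [map_add, map_mul, hι, hι, hιy, show (φ p + φ q * y) * (φ p + φ q * -y) =
      φ (p ^ 2 - q ^ 2 * algebraMap k[X] (RatFunc k) f) by
        rw [map_sub, map_mul, map_pow, map_pow, ← hy]; ring] at this
  obtain ⟨p₀, hp₀⟩ := key _ hadd
  obtain ⟨n₀, hn₀⟩ := key _ hmul
  have hp : algebraMap k[X] (RatFunc k) (C (2 : k)⁻¹ * p₀) = p := by
    have h2' : (C (2 : k)⁻¹ : k[X]) * 2 = 1 := by
      rw [← map_ofNat C 2, ← C_mul]; simp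
    rw [map_mul, hp₀, ← two_mul, ← mul_assoc,
      ← map_ofNat (algebraMap k[X] (RatFunc k)) 2, ← map_mul, h2', map_one, one_mul]
  obtain ⟨q₀, hq₀⟩ := mem_range_algebraMap_of_sq_mul_mem hf (q := q)
    ⟨(C (2 : k)⁻¹ * p₀) ^ 2 - n₀, by rw [map_sub, map_pow, hp, hn₀]; ring⟩
  exact ⟨_, q₀, by rw [hp, hq₀]⟩

theorem isIntegralElem_polynomial (φ : RatFunc k →ₐ[k] K) {f : k[X]} {y : K}
    (hy : y ^ 2 = φ (algebraMap k[X] (RatFunc k) f)) (p q : k[X]) :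
    (φ.toRingHom.comp (algebraMap k[X] (RatFunc k))).IsIntegralElem
      (φ (algebraMap k[X] (RatFunc k) p) + φ (algebraMap k[X] (RatFunc k) q) * y) := by
  set θ := φ.toRingHom.comp (algebraMap k[X] (RatFunc k)) with hθ
  have hb (r : k[X]) : θ.IsIntegralElem (φ (algebraMap k[X] (RatFunc k) r)) :=
    θ.isIntegralElem_map (x := r)
  have hyi : θ.IsIntegralElem y :=
    ⟨X ^ 2 - C f, monic_X_pow_sub_C f two_ne_zero, by simp [hθ, hy]⟩
  exact RingHom.IsIntegralElem.add θ (hb p) (RingHom.IsIntegralElem.mul θ (hb q) hyi)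

theorem derivation_apply_polynomial (φ : RatFunc k →ₐ[k] K) {y : K} (D : Derivation k K K)
    (hD : D (φ RatFunc.X) = y) (p : k[X]) :
    D (φ (algebraMap k[X] (RatFunc k) p)) =
      φ (algebraMap k[X] (RatFunc k) (derivative p)) * y := by
  have h (r : k[X]) : φ (algebraMap k[X] (RatFunc k) r) = aeval (φ RatFunc.X) r := by
    rw [aeval_algHom_apply]
    congr 1
    rw [RatFunc.aeval_X_left_eq_algebraMap]
  rw [h, h, D.map_aeval, hD, smul_eq_mul]

/-- Since `D y = f'/2`, the derivation `y d/dx` maps `k[x] + k[x] y` to itself, so it is regular on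
the whole affine curve. -/
theorem derivation_apply_polynomial_add [CharZero k] (φ : RatFunc k →ₐ[k] K) {f : k[X]} {y : K}
    (hy0 : y ≠ 0) (hy : y ^ 2 = φ (algebraMap k[X] (RatFunc k) f)) (D : Derivation k K K)
    (hD : D (φ RatFunc.X) = y) (p q : k[X]) :
    ∃ p' q' : k[X],
      D (φ (algebraMap k[X] (RatFunc k) p) + φ (algebraMap k[X] (RatFunc k) q) * y) =
      φ (algebraMap k[X] (RatFunc k) p') + φ (algebraMap k[X] (RatFunc k) q') * y := by
  have : CharZero K := charZero_of_injective_algebraMap (algebraMap k K).injective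
  have hDy : 2 * D y = φ (algebraMap k[X] (RatFunc k) (derivative f)) := by
    have := congrArg D hy
    rw [derivation_apply_polynomial φ D hD, D.leibniz_pow] at this
    simp only [smul_eq_mul, nsmul_eq_mul, Nat.add_one_sub_one, pow_one, Nat.cast_ofNat] at this
    exact mul_right_cancel₀ hy0 (by rw [← this]; ring)
  have hhalf : φ (algebraMap k[X] (RatFunc k) (C (2 : k)⁻¹)) * 2 = 1 := by
    rw [← map_ofNat φ 2, ← map_ofNat (algebraMap k[X] (RatFunc k)) 2, ← map_ofNat C 2, ← map_mul,
      ← map_mul, ← C_mul]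
    simp
  refine ⟨derivative q * f + q * (C (2 : k)⁻¹ * derivative f), derivative p, ?_⟩
  rw [map_add, D.leibniz, derivation_apply_polynomial φ D hD, derivation_apply_polynomial φ D hD]
  simp only [map_add, map_mul, smul_eq_mul]
  rw [← hy, ← hDy]
  linear_combination (-φ (algebraMap k[X] (RatFunc k) q) * D y) * hhalf

/-- If `D` is the derivation `y d/dx` of the function field of `y ^ 2 = f x`, and `v ^ 2 = h u` in
this field, then `D u / v` and `u * (D u / v)` are regular on the affine curve. -/
theorem exists_polynomial_derivation_div [CharZero k] (φ : RatFunc k →ₐ[k] K) {f : k[X]}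
    (hf : Squarefree f) {y : K} (hy0 : y ≠ 0) (hy : y ^ 2 = φ (algebraMap k[X] (RatFunc k) f))
    (hspan : ∀ w : K, ∃ p q : RatFunc k, w = φ p + φ q * y) (ι : K →+* K)
    (hι : ∀ p, ι (φ p) = φ p) (hιy : ι y = -y) (D : Derivation k K K)
    (hD : D (φ RatFunc.X) = y) {h : k[X]} (hh : h.Separable)
    (hd : h.natDegree ≤ 6) (hh' : (h.reflect 6).Separable) {u v : K}
    (hv : v ^ 2 = aeval u h) :
    (∃ p q : k[X], D u / v =
      φ (algebraMap k[X] (RatFunc k) p) + φ (algebraMap k[X] (RatFunc k) q) * y) ∧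
    (∃ p q : k[X], u * (D u / v) =
      φ (algebraMap k[X] (RatFunc k) p) + φ (algebraMap k[X] (RatFunc k) q) * y) := by
  let : Algebra (RatFunc k) K := φ.toRingHom.toAlgebra
  let : Algebra k[X] K := (φ.toRingHom.comp (algebraMap k[X] (RatFunc k))).toAlgebra
  have : IsScalarTower k[X] (RatFunc k) K := IsScalarTower.of_algebraMap_eq (fun _ => rfl)
  have : FiniteDimensional (RatFunc k) K := by
    refine Module.Finite.of_fg_top ⟨({1, y} : Set K).toFinite.toFinset, ?_⟩
    rw [Set.Finite.coe_toFinset, eq_top_iff]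
    rintro w -
    obtain ⟨p, q, rfl⟩ := hspan w
    refine add_mem ?_ ?_
    · rw [show φ p = p • (1 : K) by rw [Algebra.smul_def, mul_one]; rfl]
      exact Submodule.smul_mem _ _ (Submodule.subset_span (by simp))
    · rw [show φ q * y = q • y by rw [Algebra.smul_def]; rfl]
      exact Submodule.smul_mem _ _ (Submodule.subset_span (by simp))
  have : CharZero (RatFunc k) := charZero_of_injective_algebraMap (algebraMap k _).injective
  have : IsDedekindDomain (integralClosure k[X] K) :=
    integralClosure.isDedekindDomain k[X] (RatFunc k) K
  have : IsFractionRing (integralClosure k[X] K) K :=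
    integralClosure.isFractionRing_of_finite_extension (RatFunc k) K
  have hB : ∀ w : K, w ∈ integralClosure k[X] K →
      ∃ p q : k[X], w = φ (algebraMap k[X] (RatFunc k) p) +
        φ (algebraMap k[X] (RatFunc k) q) * y := fun w hw =>
    exists_polynomial_of_isIntegral φ hf hy hspan ι hι hιy hw
  have hDB : ∀ w : K, w ∈ integralClosure k[X] K → D w ∈ integralClosure k[X] K := by
    intro w hw
    obtain ⟨p, q, rfl⟩ := hB w hw
    obtain ⟨p', q', h⟩ := derivation_apply_polynomial_add φ hy0 hy D hD p q
    rw [h]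
    exact isIntegralElem_polynomial φ hy p' q'
  -- An element of the fraction field of a Dedekind domain lies in the domain once it is integral at
  -- every nonzero prime, so regularity can be tested one prime at a time.
  have key : ∀ P : IsDedekindDomain.HeightOneSpectrum (integralClosure k[X] K),
      D u / v ∈ (P.valuation K).valuationSubring ∧
        u * (D u / v) ∈ (P.valuation K).valuationSubring := by
    intro P
    have hle : ∀ w : K, w ∈ integralClosure k[X] K → w ∈ (P.valuation K).valuationSubring :=
      fun w hw => P.valuation_le_one (K := K) ⟨w, hw⟩
    refine derivation_div_mem _ (fun c => hle _ ?_) D (fun a ha => ?_) hh hd hh' hv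
    · have := (integralClosure k[X] K).algebraMap_mem (C c)
      convert this
      change _ = φ (algebraMap k[X] (RatFunc k) (C c))
      rw [← φ.commutes c]
      rfl
    -- Write `a` as `n / d` with `d` outside `P`. The quotient rule shows that `D` preserves the
    -- local ring, because it preserves the integral closure and `d` is a local unit.
    · obtain ⟨n, d, hnd⟩ := P.exists_primeCompl_mul_eq_of_integer a ha
      have hd1 : P.valuation K (algebraMap _ K (d : integralClosure k[X] K)) = 1 := by
        rw [P.valuation_of_algebraMap]
        exact (P.intValuation_eq_one_iff_mem_primeCompl _).mpr d.2
      have hd0 : (algebraMap _ K (d : integralClosure k[X] K)) ≠ 0 := by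
        intro h0
        rw [h0, map_zero] at hd1
        exact zero_ne_one hd1
      have hDn := congrArg D hnd
      rw [D.leibniz, smul_eq_mul, smul_eq_mul] at hDn
      have hDa : D a = (D (algebraMap _ K n) - a * D (algebraMap _ K (d : integralClosure k[X] K)))
          * (algebraMap _ K (d : integralClosure k[X] K))⁻¹ := by
        field_simp
        rw [← hDn]; ring
      rw [hDa]
      refine mul_mem (sub_mem (hle _ (hDB _ n.2)) (mul_mem ha (hle _ (hDB _ d.1.2)))) ?_
      change P.valuation K _ ≤ 1
      rw [map_inv₀, hd1, inv_one]
  constructor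
  · obtain ⟨b, hb⟩ := IsDedekindDomain.HeightOneSpectrum.mem_integers_of_valuation_le_one K
      (D u / v) (fun P => (key P).1)
    rw [← hb]; exact hB _ b.2
  · obtain ⟨b, hb⟩ := IsDedekindDomain.HeightOneSpectrum.mem_integers_of_valuation_le_one K
      (u * (D u / v)) (fun P => (key P).2)
    rw [← hb]; exact hB _ b.2

end AffineModel

end GenusTwo

end

/-! ### The chart at infinity and the degree bound -/

noncomputable section

namespace GenusTwo

section Infinity

variable {k K : Type} [Field k] [Field K] [Algebra k K]

theorem ratFunc_algHom_apply {A : Type} [Field A] [Algebra k A] (φ : RatFunc k →ₐ[k] A)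
    (r : k[X]) : φ (algebraMap k[X] (RatFunc k) r) = aeval (φ RatFunc.X) r := by
  rw [aeval_algHom_apply, RatFunc.aeval_X_left_eq_algebraMap]

theorem ratFunc_algHom_ext {A : Type} [Field A] [Algebra k A] {φ ψ : RatFunc k →ₐ[k] A}
    (h : φ RatFunc.X = ψ RatFunc.X) : φ = ψ := by
  ext r
  rw [← r.num_div_denom, map_div₀, map_div₀]
  simp only [ratFunc_algHom_apply, h]

theorem aeval_inv_X_injective :
    Function.Injective (aeval (RatFunc.X⁻¹ : RatFunc k) : k[X] →ₐ[k] RatFunc k) :=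
  transcendental_iff_injective.mp fun h =>
    RatFunc.transcendental_X (IsAlgebraic.inv_iff.mp h)

theorem exists_invRatFunc (k : Type) [Field k] : ∃ φ : RatFunc k →ₐ[k] RatFunc k,
    ∀ p : k[X], φ (algebraMap k[X] (RatFunc k) p) = aeval (RatFunc.X⁻¹ : RatFunc k) p :=
  ⟨IsLocalization.liftAlgHom (M := nonZeroDivisors k[X]) (f := aeval (RatFunc.X⁻¹ : RatFunc k))
    fun y => isUnit_iff_ne_zero.mpr (by
      rw [Ne, map_eq_zero_iff _ aeval_inv_X_injective]
      exact nonZeroDivisors.coe_ne_zero y),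
    fun p => by rw [IsLocalization.liftAlgHom_apply, IsLocalization.lift_eq]; rfl⟩

/-- The automorphism `X ↦ X⁻¹` of the field of rational functions. -/
def invRatFunc (k : Type) [Field k] : RatFunc k →ₐ[k] RatFunc k :=
  (exists_invRatFunc k).choose

theorem invRatFunc_algebraMap (p : k[X]) :
    invRatFunc k (algebraMap k[X] (RatFunc k) p) = aeval (RatFunc.X⁻¹ : RatFunc k) p :=
  (exists_invRatFunc k).choose_spec p

theorem invRatFunc_X : invRatFunc k RatFunc.X = RatFunc.X⁻¹ := by
  have h := invRatFunc_algebraMap (k := k) X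
  rwa [RatFunc.algebraMap_X, aeval_X] at h

theorem invRatFunc_invRatFunc (r : RatFunc k) : invRatFunc k (invRatFunc k r) = r := by
  have : (invRatFunc k).comp (invRatFunc k) = AlgHom.id k _ := by
    apply ratFunc_algHom_ext
    simp [invRatFunc_X]
  exact DFunLike.congr_fun this r

theorem reflect_reflect (N : ℕ) (p : k[X]) : reflect N (reflect N p) = p := by
  ext i
  simp

theorem aeval_inv_mul_pow {A : Type} [Field A] [Algebra k A] {x : A} (hx : x ≠ 0) {N : ℕ}
    {p : k[X]} (hp : p.natDegree ≤ N) : aeval x⁻¹ p * x ^ N = aeval x (reflect N p) := by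
  have : Invertible x⁻¹ := invertibleOfNonzero (inv_ne_zero hx)
  have h := eval₂_reflect_mul_pow (algebraMap k A) x⁻¹ N p hp
  rw [invOf_eq_inv, inv_inv, ← aeval_def, ← aeval_def] at h
  rw [← h, mul_assoc, ← mul_pow, inv_mul_cancel₀ hx, one_pow, mul_one]

theorem natDegree_reflect_le' {N : ℕ} {p : k[X]} (hp : p.natDegree ≤ N) :
    (reflect N p).natDegree ≤ N := by
  rw [natDegree_le_iff_coeff_eq_zero]
  intro i hi
  rw [coeff_reflect, revAt_eq_self_of_lt hi]
  exact coeff_eq_zero_of_natDegree_lt (lt_of_le_of_lt hp hi)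

theorem X_pow_mul_eq_reflect {p p' : k[X]} {m n : ℕ}
    (h : algebraMap k[X] (RatFunc k) p * RatFunc.X ^ m =
      RatFunc.X ^ n * invRatFunc k (algebraMap k[X] (RatFunc k) p')) :
    p * X ^ (m + p'.natDegree) = X ^ n * reflect p'.natDegree p' := by
  apply IsFractionRing.injective k[X] (RatFunc k)
  have h2 := aeval_inv_mul_pow (x := (RatFunc.X : RatFunc k)) RatFunc.X_ne_zero (le_refl p'.natDegree)
  rw [RatFunc.aeval_X_left_eq_algebraMap] at h2
  rw [map_mul, map_mul, ← h2, map_pow, map_pow, RatFunc.algebraMap_X, ← invRatFunc_algebraMap,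
    ← mul_assoc, ← h]
  ring

/-- A polynomial in `1/x` has no pole at infinity, so multiplying it by `xⁿ⁻ᵐ` gives a pole of order
at most `n - m` there. With `n < m` no nonzero `p` can satisfy the equation. -/
theorem natDegree_add_le_of_inv {p p' : k[X]} (hp : p ≠ 0) {m n : ℕ}
    (h : algebraMap k[X] (RatFunc k) p * RatFunc.X ^ m =
      RatFunc.X ^ n * invRatFunc k (algebraMap k[X] (RatFunc k) p')) :
    p.natDegree + m ≤ n := by
  have h1 := congrArg natDegree (X_pow_mul_eq_reflect h)
  rw [natDegree_mul hp (pow_ne_zero _ X_ne_zero), natDegree_X_pow] at h1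
  have h2 : (X ^ n * reflect p'.natDegree p').natDegree ≤ n + p'.natDegree :=
    natDegree_mul_le.trans (by
      rw [natDegree_X_pow]; exact Nat.add_le_add_left (natDegree_reflect_le' le_rfl) n)
  omega

/-- Adding and subtracting the conjugate equation under `y ↦ -y` separates the two coordinates. -/
theorem ratFunc_coord_unique [CharZero k] (φ : RatFunc k →ₐ[k] K) {y : K} (hy0 : y ≠ 0)
    (ι : K →+* K) (hι : ∀ p, ι (φ p) = φ p) (hιy : ι y = -y) {a b c d : RatFunc k}
    (h : φ a + φ b * y = φ c + φ d * y) : a = c ∧ b = d := by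
  have : CharZero K := charZero_of_injective_algebraMap (algebraMap k K).injective
  have h' := congrArg ι h
  simp only [map_add, map_mul, hι, hιy] at h'
  have h1 : (2 : K) * φ a = 2 * φ c := by linear_combination h + h'
  have h2 : (2 * y) * φ b = (2 * y) * φ d := by linear_combination h - h'
  exact ⟨φ.toRingHom.injective (mul_left_cancel₀ two_ne_zero h1),
    φ.toRingHom.injective (mul_left_cancel₀ (mul_ne_zero two_ne_zero hy0) h2)⟩

/-- Regularity at infinity is stated for `x⁻¹ w` in the coordinates `1/x` and `y/x³`. Comparing
coordinates gives `p = x p'(1/x)`, of degree at most 1, and `q = x⁻² q'(1/x)`, which forces `q = 0`.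
-/
theorem linear_of_regular [CharZero k] (φ : RatFunc k →ₐ[k] K) {y : K} (hy0 : y ≠ 0)
    (ι : K →+* K) (hι : ∀ p, ι (φ p) = φ p) (hιy : ι y = -y) {w : K}
    (h : ∃ p q : k[X], w =
      φ (algebraMap k[X] (RatFunc k) p) + φ (algebraMap k[X] (RatFunc k) q) * y)
    (h' : ∃ p q : k[X], (φ RatFunc.X)⁻¹ * w =
      φ (invRatFunc k (algebraMap k[X] (RatFunc k) p)) +
        φ (invRatFunc k (algebraMap k[X] (RatFunc k) q)) * (y * (φ RatFunc.X)⁻¹ ^ 3)) :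
    ∃ p : k[X], p.natDegree ≤ 1 ∧ w = φ (algebraMap k[X] (RatFunc k) p) := by
  obtain ⟨p, q, rfl⟩ := h
  obtain ⟨p', q', h⟩ := h'
  have hX : φ RatFunc.X ≠ 0 := by
    rw [Ne, map_eq_zero]; exact RatFunc.X_ne_zero
  obtain ⟨h1, h2⟩ := ratFunc_coord_unique φ hy0 ι hι hιy (a := algebraMap _ _ p)
    (b := algebraMap _ _ q) (c := RatFunc.X * invRatFunc k (algebraMap k[X] (RatFunc k) p'))
    (d := (RatFunc.X⁻¹) ^ 2 * invRatFunc k (algebraMap k[X] (RatFunc k) q')) (by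
      have h3 := congrArg (φ RatFunc.X * ·) h
      rw [mul_inv_cancel_left₀ hX] at h3
      rw [h3]
      simp only [map_mul, map_pow, map_inv₀]
      field_simp)
  have hq : q = 0 := by
    by_contra hq
    have := natDegree_add_le_of_inv (p := q) (p' := q') (m := 2) (n := 0) hq (by
      rw [h2]
      have := RatFunc.X_ne_zero (K := k)
      field_simp)
    omega
  refine ⟨p, ?_, by simp [hq]⟩
  by_cases hp : p = 0
  · simp [hp]
  · exact natDegree_add_le_of_inv (p' := p') (m := 0) (n := 1) hp (by rw [h1]; ring)

/-- If `D` is the derivation `y d/dx` of the function field of `y ^ 2 = f x`, and `v ^ 2 = h u` in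
this field, then `D u / v` and `u * (D u / v)` are linear polynomials in `x`. -/
theorem exists_linear_derivation_div [CharZero k] (φ : RatFunc k →ₐ[k] K) {f : k[X]}
    (hf : Squarefree f) (hfd : f.natDegree ≤ 6) (hf' : Squarefree (f.reflect 6))
    {y : K} (hy0 : y ≠ 0) (hy : y ^ 2 = φ (algebraMap k[X] (RatFunc k) f))
    (hspan : ∀ w : K, ∃ p q : RatFunc k, w = φ p + φ q * y) (ι : K →+* K)
    (hι : ∀ p, ι (φ p) = φ p) (hιy : ι y = -y) (D : Derivation k K K)
    (hD : D (φ RatFunc.X) = y) {h : k[X]} (hh : h.Separable)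
    (hd : h.natDegree ≤ 6) (hh' : (h.reflect 6).Separable) {u v : K}
    (hv : v ^ 2 = aeval u h) :
    (∃ p : k[X], p.natDegree ≤ 1 ∧ D u / v = φ (algebraMap k[X] (RatFunc k) p)) ∧
    (∃ p : k[X], p.natDegree ≤ 1 ∧ u * (D u / v) = φ (algebraMap k[X] (RatFunc k) p)) := by
  have hX : φ RatFunc.X ≠ 0 := by
    rw [Ne, map_eq_zero]; exact RatFunc.X_ne_zero
  have h1 := exists_polynomial_derivation_div φ hf hy0 hy hspan ι hι hιy D hD hh hd hh' hv
  -- In the second chart the coordinates are `1/x` and `y/x³`, and the curve is given by the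
  -- reversed polynomial. The derivation must send `1/x` to `y/x³`, which requires the factor
  -- `-1/x`; this is also why the polynomials found here are negated below.
  have h2 := exists_polynomial_derivation_div (φ.comp (invRatFunc k)) (f := f.reflect 6) hf'
    (y := y * (φ RatFunc.X)⁻¹ ^ 3) (by positivity) (by
      rw [AlgHom.comp_apply, invRatFunc_algebraMap, mul_pow, hy]
      have := aeval_inv_mul_pow (x := (RatFunc.X : RatFunc k)) RatFunc.X_ne_zero
        (natDegree_reflect_le' hfd)
      rw [reflect_reflect, RatFunc.aeval_X_left_eq_algebraMap] at this
      rw [← this, map_mul, map_pow]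
      field_simp)
    (fun w => by
      obtain ⟨p, q, rfl⟩ := hspan w
      refine ⟨invRatFunc k p, invRatFunc k (q * RatFunc.X ^ 3), ?_⟩
      simp only [AlgHom.comp_apply, invRatFunc_invRatFunc, map_mul, map_pow]
      field_simp)
    ι (fun p => hι _) (by
      rw [map_mul, hιy, map_pow, map_inv₀, hι]; ring)
    ((-(φ RatFunc.X)⁻¹) • D) (by
      rw [AlgHom.comp_apply, invRatFunc_X, map_inv₀, Derivation.smul_apply, Derivation.leibniz_inv,
        hD]
      simp only [smul_eq_mul]
      ring) hh hd hh' hv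
  simp only [Derivation.smul_apply, smul_eq_mul, AlgHom.comp_apply] at h2
  obtain ⟨⟨p, q, hpq⟩, ⟨p', q', hpq'⟩⟩ := h2
  exact ⟨linear_of_regular φ hy0 ι hι hιy h1.1 ⟨-p, -q, by
      simp only [map_neg]; linear_combination -hpq⟩,
    linear_of_regular φ hy0 ι hι hιy h1.2 ⟨-p', -q', by
      simp only [map_neg]; linear_combination -hpq'⟩⟩

end Infinity

end GenusTwo

end

noncomputable section

namespace GenusTwo

/-! ### Binary sextics as products of linear forms -/

section Sextic

variable {k : Type} [Field k]

/-- The linear form `w 0 * x + w 1 * z`, dehomogenised by `z = 1`. -/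
def linForm (w : Fin 2 → k) : k[X] := C (w 0) * X + C (w 1)

/-- The product of six linear forms. -/
def sextic (v : Fin 6 → Fin 2 → k) : k[X] := ∏ i, linForm (v i)

/-- The determinant of two linear forms. -/
def bracket (w w' : Fin 2 → k) : k := w 0 * w' 1 - w' 0 * w 1

/-- No two of the six linear forms are proportional. -/
def IsGeneral (v : Fin 6 → Fin 2 → k) : Prop := ∀ i j, i ≠ j → bracket (v i) (v j) ≠ 0

/-- The linear substitution with matrix `M`. -/
def actBy (v : Fin 6 → Fin 2 → k) (M : Matrix (Fin 2) (Fin 2) k) : Fin 6 → Fin 2 → k :=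
  fun i => Matrix.vecMul (v i) M

theorem actBy_apply (v : Fin 6 → Fin 2 → k) (M : Matrix (Fin 2) (Fin 2) k) (i : Fin 6)
    (j : Fin 2) : actBy v M i j = v i 0 * M 0 j + v i 1 * M 1 j := by
  simp [actBy, Matrix.vecMul, dotProduct, Fin.sum_univ_two]

theorem actBy_mul (v : Fin 6 → Fin 2 → k) (M N : Matrix (Fin 2) (Fin 2) k) :
    actBy v (M * N) = actBy (actBy v M) N := by
  funext i
  simp [actBy, Matrix.vecMul_vecMul]

theorem bracket_actBy (v : Fin 6 → Fin 2 → k) (M : Matrix (Fin 2) (Fin 2) k) (i j : Fin 6) :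
    bracket (actBy v M i) (actBy v M j) = M.det * bracket (v i) (v j) := by
  simp only [bracket, actBy_apply, Matrix.det_fin_two]
  ring

theorem IsGeneral.actBy {v : Fin 6 → Fin 2 → k} (hv : IsGeneral v)
    {M : Matrix (Fin 2) (Fin 2) k} (hM : M.det ≠ 0) : IsGeneral (actBy v M) := fun i j hij => by
  rw [bracket_actBy]; exact mul_ne_zero hM (hv i j hij)

theorem isCoprime_linForm {w w' : Fin 2 → k} (h : bracket w w' ≠ 0) :
    IsCoprime (linForm w) (linForm w') := by
  refine ⟨C (-(bracket w w')⁻¹ * w' 0), C ((bracket w w')⁻¹ * w 0), ?_⟩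
  rw [← C_1, ← inv_mul_cancel₀ h]
  simp only [linForm, bracket, C_mul, C_neg, C_sub]
  ring

theorem linForm_ne_zero {w w' : Fin 2 → k} (h : bracket w w' ≠ 0) : linForm w ≠ 0 := by
  intro h0
  apply h
  have h1 := congrArg (coeff · 1) h0
  have h2 := congrArg (coeff · 0) h0
  simp [linForm] at h1 h2
  simp [bracket, h1, h2]

theorem separable_linForm {w w' : Fin 2 → k} (h : bracket w w' ≠ 0) :
    (linForm w).Separable := by
  by_cases h0 : w 0 = 0
  · have h1 : w 1 ≠ 0 := by
      rintro h1
      simp [bracket, h0, h1] at h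
    rw [linForm, h0, C_0, zero_mul, zero_add]
    exact (separable_C _).mpr (isUnit_iff_ne_zero.mpr h1)
  · refine ⟨0, C (w 0)⁻¹, ?_⟩
    simp [linForm, ← C_mul, h0]

theorem natDegree_linForm [DecidableEq k] (w : Fin 2 → k) :
    (linForm w).natDegree = if w 0 = 0 then 0 else 1 := by
  split_ifs with h
  · simp [linForm, h]
  · exact natDegree_linear h

theorem exists_ne_fin_six (i : Fin 6) : ∃ j, i ≠ j := ⟨i + 1, by revert i; decide⟩

theorem IsGeneral.separable {v : Fin 6 → Fin 2 → k} (hv : IsGeneral v) :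
    (sextic v).Separable := by
  apply separable_prod'
  · intro i _ j _ hij
    exact isCoprime_linForm (hv i j hij)
  · intro i _
    obtain ⟨j, hj⟩ := exists_ne_fin_six i
    exact separable_linForm (hv i j hj)

theorem IsGeneral.natDegree {v : Fin 6 → Fin 2 → k} (hv : IsGeneral v) :
    (sextic v).natDegree = 5 ∨ (sextic v).natDegree = 6 := by
  classical
  rw [sextic, natDegree_prod _ _ fun i _ => by
    obtain ⟨j, hj⟩ := exists_ne_fin_six i
    exact linForm_ne_zero (hv i j hj)]
  simp only [natDegree_linForm]
  have h1 : (Finset.univ.filter fun i : Fin 6 => v i 0 = 0).card ≤ 1 := by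
    rw [Finset.card_le_one]
    intro i hi j hj
    by_contra hij
    simp only [Finset.mem_filter, Finset.mem_univ, true_and] at hi hj
    exact hv i j hij (by simp [bracket, hi, hj])
  have h2 := Finset.card_filter_add_card_filter_not (s := Finset.univ)
    (fun i : Fin 6 => v i 0 = 0)
  have h3 : (∑ i : Fin 6, if v i 0 = 0 then 0 else 1) =
      (Finset.univ.filter fun i : Fin 6 => ¬ v i 0 = 0).card := by
    rw [Finset.card_filter]
    exact Finset.sum_congr rfl fun i _ => by split_ifs <;> simp_all
  rw [h3]
  simp at h2
  omega

theorem sextic_natDegree_le (v : Fin 6 → Fin 2 → k) : (sextic v).natDegree ≤ 6 := by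
  classical
  refine (natDegree_prod_le _ _).trans ?_
  refine (Finset.sum_le_card_nsmul _ _ 1 fun i _ => ?_).trans (by simp)
  rw [natDegree_linForm]
  split_ifs <;> simp

theorem eval_sextic_actBy (v : Fin 6 → Fin 2 → k) (M : Matrix (Fin 2) (Fin 2) k) (t : k)
    (ht : M 1 0 * t + M 1 1 ≠ 0) : (sextic (actBy v M)).eval t =
      (M 1 0 * t + M 1 1) ^ 6 * (sextic v).eval ((M 0 0 * t + M 0 1) / (M 1 0 * t + M 1 1)) := by
  have h6 : (M 1 0 * t + M 1 1) ^ 6 = ∏ _i : Fin 6, (M 1 0 * t + M 1 1) := by simp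
  rw [sextic, sextic, eval_prod, eval_prod, h6, ← Finset.prod_mul_distrib]
  refine Finset.prod_congr rfl fun i _ => ?_
  simp only [linForm, eval_add, eval_mul, eval_C, eval_X, actBy_apply]
  field_simp
  ring

/-- Multiplying the difference by `aX + b` makes it vanish at the excluded point too, hence
everywhere. -/
theorem eq_of_eval_eq [Infinite k] {p q : k[X]} (a b : k) (hab : a ≠ 0 ∨ b ≠ 0)
    (h : ∀ t, a * t + b ≠ 0 → p.eval t = q.eval t) : p = q := by
  have h1 : (p - q) * (C a * X + C b) = 0 := by
    apply Polynomial.funext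
    intro t
    by_cases ht : a * t + b = 0
    · simp [ht]
    · simp [h t ht]
  rcases mul_eq_zero.mp h1 with h2 | h2
  · exact sub_eq_zero.mp h2
  · exfalso
    have e1 := congrArg (coeff · 1) h2
    have e0 := congrArg (coeff · 0) h2
    simp at e1 e0
    tauto

theorem det_ne_zero_row {M : Matrix (Fin 2) (Fin 2) k} (hM : M.det ≠ 0) :
    M 1 0 ≠ 0 ∨ M 1 1 ≠ 0 := by
  by_contra! h
  apply hM
  rw [Matrix.det_fin_two, h.1, h.2]; ring

/-- The action is defined on factorisations; evaluation shows that, up to scalars, its effect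
depends only on the product. -/
theorem sextic_actBy_congr [Infinite k] {v w : Fin 6 → Fin 2 → k} {c : k}
    (h : sextic v = C c * sextic w) {M : Matrix (Fin 2) (Fin 2) k} (hM : M.det ≠ 0) :
    sextic (actBy v M) = C c * sextic (actBy w M) := by
  refine eq_of_eval_eq _ _ (det_ne_zero_row hM) fun t ht => ?_
  rw [eval_sextic_actBy v M t ht, h, eval_mul, eval_mul, eval_C, eval_C, eval_sextic_actBy w M t ht]
  ring

theorem coeff_reflect_sextic (v : Fin 6 → Fin 2 → k) :
    (sextic v).reflect 6 = sextic fun i => ![v i 1, v i 0] := by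
  have h1 (w : Fin 2 → k) : linForm ![w 1, w 0] = reflect 1 (linForm w) := by
    rw [linForm, linForm, reflect_add, reflect_C, ← pow_one (X : k[X]), reflect_C_mul_X_pow]
    simp [revAt_le]
    ring
  have hd (w : Fin 2 → k) : (linForm w).natDegree ≤ 1 := by
    classical
    rw [natDegree_linForm]; split_ifs <;> simp
  have key : ∀ n (v : Fin n → Fin 2 → k), (∏ i, linForm (v i)).natDegree ≤ n ∧
      reflect n (∏ i, linForm (v i)) = ∏ i, linForm ![v i 1, v i 0] := by
    intro n
    induction n with
    | zero =>
      intro v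
      rw [Finset.univ_eq_empty, Finset.prod_empty, Finset.prod_empty]
      exact ⟨by simp, by simp⟩
    | succ n ih =>
      intro v
      rw [Fin.prod_univ_castSucc, Fin.prod_univ_castSucc]
      obtain ⟨h2, h3⟩ := ih fun i => v i.castSucc
      exact ⟨natDegree_mul_le.trans (add_le_add h2 (hd _)), by
        rw [reflect_mul _ _ h2 (hd _), h3, h1]⟩
  exact (key 6 v).2

theorem IsGeneral.swap {v : Fin 6 → Fin 2 → k} (hv : IsGeneral v) :
    IsGeneral fun i => ![v i 1, v i 0] := fun i j hij h => hv i j hij (by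
  simp [bracket] at h ⊢; linear_combination -h)

theorem sextic_cons (w : Fin 2 → k) (v : Fin 5 → Fin 2 → k) :
    sextic (Fin.cons w v) = linForm w * ∏ i, linForm (v i) := by
  simp only [sextic, Fin.prod_univ_succ (n := 5), Fin.cons_zero, Fin.cons_succ]

/-- In degree 5 the sixth linear form is the constant leading coefficient, a root at infinity. In
degree 6 the leading coefficient is absorbed into the first form. Degrees 5 and 6 are thereby
treated alike from here on. -/
theorem exists_sextic_eq [IsAlgClosed k] {f : k[X]}
    (hd : f.natDegree = 5 ∨ f.natDegree = 6) (hf : f.Separable) :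
    ∃ v : Fin 6 → Fin 2 → k, IsGeneral v ∧ f = sextic v := by
  have hf0 : f ≠ 0 := hf.ne_zero
  have hlc : f.leadingCoeff ≠ 0 := leadingCoeff_ne_zero.mpr hf0
  have hsplit := IsAlgClosed.splits f
  set l := f.roots.toList with hl
  have hlen : l.length = f.natDegree := by
    rw [hl, Multiset.length_toList, hsplit.natDegree_eq_card_roots]
  have hnd : l.Nodup := by
    rw [hl, ← Multiset.coe_nodup, Multiset.coe_toList]
    exact nodup_roots hf
  have hprod : f = C f.leadingCoeff * (l.map fun r => X - C r).prod := by
    conv_lhs => rw [hsplit.eq_prod_roots]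
    rw [← Multiset.prod_coe, ← Multiset.map_coe, hl, Multiset.coe_toList]
  have hget : ∀ n (e : l.length = n), ∃ r : Fin n → k, Function.Injective r ∧
      f = C f.leadingCoeff * ∏ i, (X - C (r i)) := by
    rintro n rfl
    refine ⟨l.get, List.nodup_iff_injective_get.mp hnd, ?_⟩
    conv_lhs => rw [hprod]
    congr 1
    rw [← List.prod_ofFn]
    congr 1
    simp only [List.get_eq_getElem]
    exact (List.ofFn_getElem_eq_map l _).symm
  rcases hd with hd | hd
  · obtain ⟨r, hr, h⟩ := hget 5 (by rw [hlen, hd])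
    refine ⟨Fin.cons ![0, f.leadingCoeff] fun i => ![1, -r i], ?_, ?_⟩
    · intro i j
      refine Fin.cases ?_ (fun i => ?_) i <;> refine Fin.cases ?_ (fun j => ?_) j
      · simp
      · simp [bracket, hlc]
      · simp [bracket, hlc]
      · intro hij
        simp only [bracket, Fin.cons_succ, Matrix.cons_val_zero, Matrix.cons_val_one]
        intro h0
        exact hij (congrArg Fin.succ (hr (by linear_combination h0)))
    · conv_lhs => rw [h]
      rw [sextic_cons]
      simp [linForm, sub_eq_add_neg]
  · obtain ⟨r, hr, h⟩ := hget 6 (by rw [hlen, hd])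
    refine ⟨Fin.cons ![f.leadingCoeff, -(f.leadingCoeff * r 0)] fun i => ![1, -r i.succ], ?_, ?_⟩
    · intro i j
      refine Fin.cases ?_ (fun i => ?_) i <;> refine Fin.cases ?_ (fun j => ?_) j
      · simp
      · intro hij
        simp only [bracket, Fin.cons_zero, Fin.cons_succ, Matrix.cons_val_zero, Matrix.cons_val_one]
        intro h0
        exact hij (hr (mul_left_cancel₀ hlc (by linear_combination h0)))
      · intro hij
        simp only [bracket, Fin.cons_zero, Fin.cons_succ, Matrix.cons_val_zero, Matrix.cons_val_one]
        intro h0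
        exact hij (hr (mul_left_cancel₀ hlc (by linear_combination h0)))
      · intro hij
        simp only [bracket, Fin.cons_succ, Matrix.cons_val_zero, Matrix.cons_val_one]
        intro h0
        exact hij (hr (by linear_combination h0))
    · rw [Fin.prod_univ_succ, ← mul_assoc] at h
      conv_lhs => rw [h]
      rw [sextic_cons]
      refine congrArg₂ (· * ·) ?_ (Finset.prod_congr rfl fun i _ => ?_)
      · simp only [linForm, Matrix.cons_val_zero, Matrix.cons_val_one, C_neg, C_mul]
        ring
      · simp [linForm, sub_eq_add_neg]

end Sextic

end GenusTwo

end

/-! ### Automorphisms act by linear fractional transformations -/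

noncomputable section

namespace GenusTwo

section Automorphism

variable {k K : Type} [Field k] [Field K] [Algebra k K]

theorem aeval_sextic_mul_pow {A : Type} [Field A] [Algebra k A] (v : Fin 6 → Fin 2 → k)
    (g : Matrix (Fin 2) (Fin 2) k) (x : A) (h : aeval x (linForm (g.row 1)) ≠ 0) :
    aeval (aeval x (linForm (g.row 0)) / aeval x (linForm (g.row 1))) (sextic v) *
      aeval x (linForm (g.row 1)) ^ 6 = aeval x (sextic (actBy v g)) := by
  have h6 : aeval x (linForm (g.row 1)) ^ 6 = ∏ _i : Fin 6, aeval x (linForm (g.row 1)) := by simp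
  rw [sextic, sextic, map_prod, map_prod, h6, ← Finset.prod_mul_distrib]
  refine Finset.prod_congr rfl fun i _ => ?_
  have h2 (u : A) : aeval u (linForm (v i)) = algebraMap k A (v i 0) * u + algebraMap k A (v i 1) := by
    simp [linForm]
  rw [h2, add_mul, mul_assoc, div_mul_cancel₀ _ h]
  simp only [linForm, map_add, map_mul, aeval_X, aeval_C, actBy_apply, Matrix.row_apply]
  ring

theorem eq_linForm_of_natDegree_le_one {p : k[X]} (hp : p.natDegree ≤ 1) :
    p = linForm ![p.coeff 1, p.coeff 0] := eq_X_add_C_of_natDegree_le_one hp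

/-- If `D` killed `σ x`, it would kill `σ(k(x))`, then `σ y` because its square lies there, and so
the whole field, contrary to `D x = y ≠ 0`. -/
theorem derivation_aut_ne_zero [CharZero k] (φ : RatFunc k →ₐ[k] K) {f : k[X]} {y : K}
    (hy0 : y ≠ 0) (hy : y ^ 2 = φ (algebraMap k[X] (RatFunc k) f))
    (hspan : ∀ w : K, ∃ p q : RatFunc k, w = φ p + φ q * y) (D : Derivation k K K)
    (hD : D (φ RatFunc.X) = y) (σ : K ≃ₐ[k] K) : D (σ (φ RatFunc.X)) ≠ 0 := by
  have : CharZero K := charZero_of_injective_algebraMap (algebraMap k K).injective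
  intro h0
  have hpoly (p : k[X]) : D (σ (φ (algebraMap k[X] (RatFunc k) p))) = 0 := by
    rw [ratFunc_algHom_apply, ← AlgEquiv.coe_toAlgHom, ← aeval_algHom_apply, D.map_aeval]
    simp [h0]
  have hrat (r : RatFunc k) : D (σ (φ r)) = 0 := by
    rw [← r.num_div_denom, map_div₀, map_div₀, D.leibniz_div, hpoly, hpoly]
    simp
  have hσy : σ y ≠ 0 := by rwa [Ne, map_eq_zero]
  have hDy : D (σ y) = 0 := by
    have h1 := congrArg (fun w => D (σ w)) hy
    simp only [hrat] at h1
    rw [map_pow, D.leibniz_pow] at h1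
    simp only [smul_eq_mul, nsmul_eq_mul, Nat.add_one_sub_one, pow_one, Nat.cast_ofNat] at h1
    simpa [hσy] using h1
  have hall (w : K) : D w = 0 := by
    obtain ⟨p, q, h⟩ := hspan (σ.symm w)
    rw [← σ.apply_symm_apply w, h, map_add, map_mul, map_add, D.leibniz, hrat, hrat, hDy]
    simp
  exact hy0 (by rw [← hD, hall])

/-- Write `σ y = a + b y`. Its square is a rational function of `x`, so `2ab = 0`. If `b` were 0,
then `σ` would map the whole field into `k(x)`, which does not contain `y`; so `a = 0`. -/
theorem exists_rational_of_aut_coord [CharZero k] (φ : RatFunc k →ₐ[k] K) {f : k[X]} {y : K}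
    (hy0 : y ≠ 0) (hy : y ^ 2 = φ (algebraMap k[X] (RatFunc k) f))
    (hspan : ∀ w : K, ∃ p q : RatFunc k, w = φ p + φ q * y) (ι : K →+* K)
    (hι : ∀ p, ι (φ p) = φ p) (hιy : ι y = -y) (σ : K ≃ₐ[k] K) {r : RatFunc k}
    (hr : σ (φ RatFunc.X) = φ r) : ∃ b : RatFunc k, b ≠ 0 ∧ σ y = φ b * y ∧
      b ^ 2 * algebraMap k[X] (RatFunc k) f = aeval r f := by
  have hpoly (p : k[X]) : σ (φ (algebraMap k[X] (RatFunc k) p)) = φ (aeval r p) := by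
    rw [ratFunc_algHom_apply, ← AlgEquiv.coe_toAlgHom, ← aeval_algHom_apply, AlgEquiv.coe_toAlgHom,
      hr, aeval_algHom_apply]
  have hrat (s : RatFunc k) : ∃ t, σ (φ s) = φ t :=
    ⟨aeval r s.num / aeval r s.denom, by
      conv_lhs => rw [← s.num_div_denom]
      rw [map_div₀, map_div₀, map_div₀, hpoly, hpoly]⟩
  obtain ⟨a, b, hab⟩ := hspan (σ y)
  have hsq : σ y ^ 2 = φ (aeval r f) := by rw [← map_pow, hy, hpoly]
  have h2 := ratFunc_coord_unique φ hy0 ι hι hιy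
    (a := a ^ 2 + b ^ 2 * algebraMap k[X] (RatFunc k) f) (b := 2 * a * b) (c := aeval r f) (d := 0)
    (by
      rw [map_zero, zero_mul, add_zero, ← hsq, hab]
      simp only [map_add, map_mul, map_pow, map_ofNat, ← hy]
      ring)
  have hb : b ≠ 0 := by
    rintro rfl
    rw [map_zero, zero_mul, add_zero] at hab
    have hall (w : K) : ∃ t, σ w = φ t := by
      obtain ⟨p, q, rfl⟩ := hspan w
      obtain ⟨p', hp⟩ := hrat p
      obtain ⟨q', hq⟩ := hrat q
      exact ⟨p' + q' * a, by rw [map_add, map_mul, hp, hq, hab, map_add, map_mul]⟩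
    obtain ⟨t, ht⟩ := hall (σ.symm y)
    rw [σ.apply_symm_apply] at ht
    have := ratFunc_coord_unique φ hy0 ι hι hιy (a := 0) (b := 1) (c := t) (d := 0)
      (by rw [map_zero, map_one, ← ht]; ring)
    exact one_ne_zero this.2
  have : CharZero (RatFunc k) := charZero_of_injective_algebraMap (algebraMap k _).injective
  have ha : a = 0 := by simpa [hb] using h2.2
  refine ⟨b, hb, by rw [hab, ha, map_zero, zero_add], ?_⟩
  rw [← h2.1, ha]; ring

/-- An automorphism of the function field of `y ^ 2 = f x` acts on `x` by a linear fractional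
transformation that preserves the sextic form attached to `f`. -/
theorem exists_matrix_of_aut [CharZero k] (φ : RatFunc k →ₐ[k] K) {v : Fin 6 → Fin 2 → k}
    (hv : IsGeneral v) {y : K} (hy : y ^ 2 = φ (algebraMap k[X] (RatFunc k) (sextic v)))
    (hspan : ∀ w : K, ∃ p q : RatFunc k, w = φ p + φ q * y) (ι : K →+* K)
    (hι : ∀ p, ι (φ p) = φ p) (hιy : ι y = -y) (D : Derivation k K K)
    (hD : D (φ RatFunc.X) = y) (σ : K ≃ₐ[k] K) :
    ∃ g : Matrix (Fin 2) (Fin 2) k, g.det ≠ 0 ∧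
      σ (φ RatFunc.X) = φ (algebraMap k[X] (RatFunc k) (linForm (g.row 0)) /
        algebraMap k[X] (RatFunc k) (linForm (g.row 1))) ∧
      ∃ c : k, c ≠ 0 ∧ sextic (actBy v g) = C c * sextic v := by
  have hf0 : sextic v ≠ 0 := hv.separable.ne_zero
  have hy0 : y ≠ 0 := by
    rintro rfl
    rw [zero_pow two_ne_zero, eq_comm, map_eq_zero] at hy
    exact hf0 (by simpa using hy)
  have hsep' : ((sextic v).reflect 6).Separable := by
    rw [coeff_reflect_sextic]; exact hv.swap.separable
  have hdeg := sextic_natDegree_le v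
  have hDu := derivation_aut_ne_zero φ hy0 hy hspan D hD σ
  have hσy : σ y ≠ 0 := by rwa [Ne, map_eq_zero]
  obtain ⟨⟨q, hq1, hq⟩, ⟨p, hp1, hp⟩⟩ := exists_linear_derivation_div φ hv.separable.squarefree hdeg
    hsep'.squarefree hy0 hy hspan ι hι hιy D hD hv.separable hdeg hsep' (u := σ (φ RatFunc.X))
    (v := σ y) (by
      rw [← map_pow, hy, ratFunc_algHom_apply, ← AlgEquiv.coe_toAlgHom, ← aeval_algHom_apply])
  have hg0 : D (σ (φ RatFunc.X)) / σ y ≠ 0 := div_ne_zero hDu hσy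
  have hq0 : algebraMap k[X] (RatFunc k) q ≠ 0 := by
    intro h
    rw [h, map_zero] at hq
    exact hg0 hq
  have hu : σ (φ RatFunc.X) =
      φ (algebraMap k[X] (RatFunc k) p / algebraMap k[X] (RatFunc k) q) := by
    rw [map_div₀, ← hp, ← hq, mul_div_cancel_right₀ _ hg0]
  set g : Matrix (Fin 2) (Fin 2) k := !![p.coeff 1, p.coeff 0; q.coeff 1, q.coeff 0] with hgdef
  have hpg : linForm (g.row 0) = p := (eq_linForm_of_natDegree_le_one hp1).symm
  have hqg : linForm (g.row 1) = q := (eq_linForm_of_natDegree_le_one hq1).symm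
  refine ⟨g, ?_, by rw [hpg, hqg]; exact hu, ?_⟩
  -- Determinant zero makes the numerator a constant multiple of the denominator, so `σ x` would be
  -- constant and killed by `D`.
  · intro hdet
    have hconst : ∃ t : k, p = C t * q := by
      have hqne : q ≠ 0 := by simpa using hq0
      rw [hgdef, Matrix.det_fin_two_of] at hdet
      by_cases h1 : q.coeff 1 = 0
      · have h0 : q.coeff 0 ≠ 0 := by
          intro h0
          apply hqne
          rw [eq_X_add_C_of_natDegree_le_one hq1, h0, h1]; simp
        refine ⟨p.coeff 0 / q.coeff 0, ?_⟩
        have hp0 : p.coeff 1 = 0 := by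
          rw [h1, mul_zero, sub_zero] at hdet
          exact (mul_eq_zero.mp hdet).resolve_right h0
        rw [eq_X_add_C_of_natDegree_le_one hq1, eq_X_add_C_of_natDegree_le_one hp1, hp0, h1]
        simp [← C_mul, h0]
      · refine ⟨p.coeff 1 / q.coeff 1, ?_⟩
        rw [eq_X_add_C_of_natDegree_le_one hq1]
        conv_lhs => rw [eq_X_add_C_of_natDegree_le_one hp1]
        simp only [coeff_add, coeff_C_mul, coeff_X_one, coeff_C_succ, mul_one, add_zero, mul_add]
        rw [← mul_assoc, ← C_mul, ← C_mul, div_mul_cancel₀ _ h1]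
        congr 2
        field_simp
        linear_combination -hdet
    obtain ⟨t, ht⟩ := hconst
    apply hDu
    rw [hu, ht, map_mul, mul_div_cancel_right₀ _ hq0]
    have : φ (algebraMap k[X] (RatFunc k) (C t)) = algebraMap k K t := by
      rw [ratFunc_algHom_apply, aeval_C]
    rw [this, D.map_algebraMap]
  · obtain ⟨b, hb0, -, hb⟩ := exists_rational_of_aut_coord φ hy0 hy hspan ι hι hιy σ hu
    have h6 := aeval_sextic_mul_pow v g (RatFunc.X : RatFunc k) (by
      rwa [hqg, RatFunc.aeval_X_left_eq_algebraMap])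
    rw [hpg, hqg, RatFunc.aeval_X_left_eq_algebraMap, RatFunc.aeval_X_left_eq_algebraMap,
      RatFunc.aeval_X_left_eq_algebraMap, ← hb] at h6
    -- The transformed sextic is `(b q³)²` times the original one; squarefreeness makes `b q³` a
    -- polynomial `s`, and the degree bound `2 deg s + 5 ≤ 6` makes `s` constant.
    obtain ⟨s, hs⟩ := mem_range_algebraMap_of_sq_mul_mem hv.separable.squarefree
      (q := b * algebraMap k[X] (RatFunc k) q ^ 3) ⟨_, by rw [← h6]; ring⟩
    have hs2 : s ^ 2 * sextic v = sextic (actBy v g) := by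
      apply IsFractionRing.injective k[X] (RatFunc k)
      rw [map_mul, map_pow, hs, ← h6]; ring
    have hs0 : s ≠ 0 := by
      rintro rfl
      rw [map_zero, eq_comm] at hs
      exact mul_ne_zero hb0 (pow_ne_zero 3 hq0) hs
    have hdeg2 := congrArg Polynomial.natDegree hs2
    rw [natDegree_mul (pow_ne_zero 2 hs0) hf0, natDegree_pow] at hdeg2
    have hd' := sextic_natDegree_le (actBy v g)
    have hs1 : s.natDegree = 0 := by
      rcases hv.natDegree with h | h <;> omega
    obtain ⟨c, rfl⟩ := natDegree_eq_zero.mp hs1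
    exact ⟨c ^ 2, pow_ne_zero 2 (by rintro rfl; simp at hs0), by rw [← hs2, C_pow]⟩

theorem algEquiv_ext_of_coord (φ : RatFunc k →ₐ[k] K) {y : K}
    (hspan : ∀ w : K, ∃ p q : RatFunc k, w = φ p + φ q * y) {σ τ : K ≃ₐ[k] K}
    (hx : σ (φ RatFunc.X) = τ (φ RatFunc.X)) (hy : σ y = τ y) : σ = τ := by
  have h : (σ : K →ₐ[k] K).comp φ = (τ : K →ₐ[k] K).comp φ := ratFunc_algHom_ext hx
  ext w
  obtain ⟨p, q, rfl⟩ := hspan w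
  have hp := DFunLike.congr_fun h p
  have hq := DFunLike.congr_fun h q
  simp only [AlgHom.comp_apply, AlgEquiv.coe_toAlgHom] at hp hq
  rw [map_add, map_mul, map_add, map_mul, hp, hq, hy]

/-- An automorphism fixing `x` is determined by `y ↦ ±y`, so at most two automorphisms fix `x`. -/
theorem exists_aut_ne_of_card (φ : RatFunc k →ₐ[k] K) {f : k[X]} {y : K}
    (hy : y ^ 2 = φ (algebraMap k[X] (RatFunc k) f))
    (hspan : ∀ w : K, ∃ p q : RatFunc k, w = φ p + φ q * y)
    (h : 2 < ENat.card (K ≃ₐ[k] K)) : ∃ σ : K ≃ₐ[k] K, σ (φ RatFunc.X) ≠ φ RatFunc.X := by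
  classical
  by_contra! hall
  have hσy (σ : K ≃ₐ[k] K) : σ y ∈ ({y, -y} : Finset K) := by
    have hσ : (σ : K →ₐ[k] K).comp φ = φ := ratFunc_algHom_ext (hall σ)
    have h1 : σ y ^ 2 = y ^ 2 := by
      rw [← map_pow, hy]
      exact DFunLike.congr_fun hσ _
    simpa using sq_eq_sq_iff_eq_or_eq_neg.mp h1
  let F : (K ≃ₐ[k] K) → ({y, -y} : Finset K) := fun σ => ⟨σ y, hσy σ⟩
  have hF : Function.Injective F := fun σ τ hστ =>
    algEquiv_ext_of_coord φ hspan ((hall σ).trans (hall τ).symm) (congrArg Subtype.val hστ)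
  have h1 := ENat.card_le_card_of_injective hF
  have h2 : ENat.card ({y, -y} : Finset K) ≤ 2 := by
    rw [ENat.card_eq_coe_fintype_card, Fintype.card_coe]
    exact_mod_cast Finset.card_le_two
  exact absurd h (not_lt.mpr (h1.trans h2))

end Automorphism

end GenusTwo

end

/-! ### The function field, its derivation, and the matrix of an extra automorphism -/

noncomputable section

namespace GenusTwo

section FunctionField

variable {k : Type} [Field k]

theorem irreducible_X_sq_sub_C [CharZero k] {f : k[X]} (hf : Squarefree f)
    (hd : 0 < f.natDegree) :
    Irreducible (X ^ 2 - Polynomial.C (algebraMap k[X] (RatFunc k) f) : (RatFunc k)[X]) := by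
  refine X_pow_sub_C_irreducible_of_prime Nat.prime_two fun b hb => ?_
  obtain ⟨b₀, rfl⟩ := mem_range_algebraMap_of_sq_mul_mem (f := 1) squarefree_one (q := b)
    ⟨f, by rw [map_one, mul_one, hb]⟩
  rw [← map_pow] at hb
  have h := IsFractionRing.injective k[X] (RatFunc k) hb
  have hu : IsUnit b₀ := hf b₀ ⟨1, by rw [← h]; ring⟩
  have h0 := natDegree_eq_zero_of_isUnit hu
  rw [← h, natDegree_pow, h0] at hd
  omega

/-- The derivation `y d/dx` of the function field of `y ^ 2 = f x`. -/
theorem exists_derivation {K : Type} [Field K] [Algebra k K] [CharZero k] (φ : RatFunc k →ₐ[k] K)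
    {f : k[X]} {P : (RatFunc k)[X]} (hP : P = X ^ 2 - C (algebraMap k[X] (RatFunc k) f))
    (e : AdjoinRoot P ≃+* K) (he : ∀ r, e (AdjoinRoot.of P r) = φ r) {y : K}
    (hey : e (AdjoinRoot.root P) = y) (hy : y ^ 2 = φ (algebraMap k[X] (RatFunc k) f)) :
    ∃ D : Derivation k K K, D (φ RatFunc.X) = y := by
  have : CharZero K := charZero_of_injective_algebraMap (algebraMap k K).injective
  let x := φ RatFunc.X
  -- The derivation is the `ε`-part of a ring map `K → K[ε]` with `x ↦ x + yε` and `y ↦ y +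
  -- (f'(x)/2) ε`. The second value is forced by `y² = f(x)`.
  let ξ : TrivSqZeroExt K K := TrivSqZeroExt.inl x + TrivSqZeroExt.inr y
  have hξ (p : k[X]) : aeval ξ p =
      TrivSqZeroExt.inl (aeval x p) + TrivSqZeroExt.inr (aeval x (derivative p) * y) := by
    rw [aeval_add_of_sq_eq_zero _ _ _ (by simp [pow_two])]
    have hinl (q : k[X]) : aeval (TrivSqZeroExt.inl x : TrivSqZeroExt K K) q =
        TrivSqZeroExt.inl (aeval x q) :=
      aeval_algHom_apply (TrivSqZeroExt.inlAlgHom k K K) x q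
    rw [hinl, hinl, TrivSqZeroExt.inl_mul_inr, smul_eq_mul]
  have hunit (s : nonZeroDivisors k[X]) :
      IsUnit ((aeval ξ : k[X] →ₐ[k] TrivSqZeroExt K K) s) := by
    rw [TrivSqZeroExt.isUnit_iff_isUnit_fst, hξ]
    simp only [TrivSqZeroExt.fst_add, TrivSqZeroExt.fst_inl, TrivSqZeroExt.fst_inr, add_zero]
    rw [isUnit_iff_ne_zero, ← ratFunc_algHom_apply, Ne, map_eq_zero]
    simp
  let Ψ₀ : RatFunc k →ₐ[k] TrivSqZeroExt K K :=
    IsLocalization.liftAlgHom (M := nonZeroDivisors k[X]) (f := aeval ξ) hunit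
  have hΨ₀ (p : k[X]) : Ψ₀ (algebraMap k[X] (RatFunc k) p) = aeval ξ p := by
    rw [IsLocalization.liftAlgHom_apply, IsLocalization.lift_eq]; rfl
  let η : TrivSqZeroExt K K :=
    TrivSqZeroExt.inl y + TrivSqZeroExt.inr (aeval x (derivative f) / 2)
  have hη : P.eval₂ (Ψ₀ : RatFunc k →+* TrivSqZeroExt K K) η = 0 := by
    rw [hP, eval₂_sub, eval₂_pow, eval₂_X, eval₂_C, sub_eq_zero, RingHom.coe_coe, hΨ₀, hξ]
    ext
    · simp [η, pow_two, ← ratFunc_algHom_apply, x, ← hy]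
    · simp [η, pow_two, x]
      ring
  let Ψ : K →+* TrivSqZeroExt K K := (AdjoinRoot.lift _ η hη).comp e.symm.toRingHom
  have hΨφ (r : RatFunc k) : Ψ (φ r) = Ψ₀ r := by
    simp only [Ψ, RingHom.comp_apply]
    rw [← he r]
    simp [AdjoinRoot.lift_of]
  have hΨy : Ψ y = η := by
    simp only [Ψ, RingHom.comp_apply]
    rw [← hey]
    simp [AdjoinRoot.lift_root]
  have hfst₀ (r : RatFunc k) : (Ψ₀ r).fst = φ r := by
    have : (TrivSqZeroExt.fstHom k K K).comp Ψ₀ = φ := by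
      apply ratFunc_algHom_ext
      rw [AlgHom.comp_apply, ← RatFunc.algebraMap_X, hΨ₀, RatFunc.algebraMap_X, aeval_X]
      simp [ξ, x]
    exact DFunLike.congr_fun this r
  -- The map lifts the identity of `K`; this turns multiplicativity into the Leibniz rule for the
  -- `ε`-part.
  have hfst (w : K) : (Ψ w).fst = w := by
    have : ((TrivSqZeroExt.fstHom k K K : TrivSqZeroExt K K →+* K).comp Ψ).comp e.toRingHom =
        e.toRingHom := by
      apply AdjoinRoot.ringHom_ext
      · ext r
        simp [he, hΨφ, hfst₀]
      · simp [hey, hΨy, η]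
    have h := RingHom.congr_fun this (e.symm w)
    simpa using h
  have hk (c : k) : Ψ (algebraMap k K c) = TrivSqZeroExt.inl (algebraMap k K c) := by
    rw [← φ.commutes c, hΨφ, AlgHom.commutes, φ.commutes]
    rfl
  let D₀ : K →ₗ[k] K :=
    { toFun := fun w => (Ψ w).snd
      map_add' := fun a b => by simp
      map_smul' := fun c a => by
        rw [Algebra.smul_def, map_mul, hk, TrivSqZeroExt.snd_mul]
        simp [Algebra.smul_def] }
  refine ⟨Derivation.mk' D₀ fun a b => ?_, ?_⟩
  · change (Ψ (a * b)).snd = a • (Ψ b).snd + b • (Ψ a).snd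
    rw [map_mul, TrivSqZeroExt.snd_mul, hfst, hfst]
    simp [mul_comm]
  · change (Ψ (φ RatFunc.X)).snd = y
    rw [hΨφ, ← RatFunc.algebraMap_X, hΨ₀, aeval_X]
    simp [ξ]

theorem Curve.exists_matrix_of_hasExtraAutomorphism [CharZero k] (C : Curve k)
    (h : C.HasExtraAutomorphism) {v : Fin 6 → Fin 2 → k} (hv : IsGeneral v)
    (hf : C.f = sextic v) :
    ∃ g : Matrix (Fin 2) (Fin 2) k, g.det ≠ 0 ∧
      ¬ (g 0 1 = 0 ∧ g 1 0 = 0 ∧ g 0 0 = g 1 1) ∧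
      ∃ c : k, c ≠ 0 ∧ sextic (actBy v g) = Polynomial.C c * sextic v := by
  have hsq : Squarefree C.f := C.separable_f.squarefree
  have hd : 0 < C.f.natDegree := by rcases C.natDegree_f with h | h <;> omega
  set P : (RatFunc k)[X] := X ^ 2 - Polynomial.C (algebraMap k[X] (RatFunc k) C.f) with hP
  have hev {A : Type} [CommRing A] (i : RatFunc k →+* A) (z : A) :
      P.eval₂ i z = z ^ 2 - i (algebraMap k[X] (RatFunc k) C.f) := by
    rw [hP, eval₂_sub, eval₂_pow, eval₂_X, eval₂_C]
  have : Fact (Irreducible P) := ⟨irreducible_X_sq_sub_C hsq hd⟩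
  let φ : RatFunc k →ₐ[k] AdjoinRoot P := IsScalarTower.toAlgHom k (RatFunc k) (AdjoinRoot P)
  let y : AdjoinRoot P := AdjoinRoot.root P
  have hφ (r : RatFunc k) : φ r = AdjoinRoot.of P r := rfl
  have hy : y ^ 2 = φ (algebraMap k[X] (RatFunc k) C.f) := by
    have h0 := AdjoinRoot.eval₂_root P
    rw [hev, sub_eq_zero] at h0
    exact h0
  have hmonic : P.Monic := monic_X_pow_sub_C _ two_ne_zero
  have hspan : ∀ w : AdjoinRoot P, ∃ p q : RatFunc k, w = φ p + φ q * y := by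
    intro w
    obtain ⟨Q, rfl⟩ := AdjoinRoot.mk_surjective w
    have hQ : AdjoinRoot.mk P Q = AdjoinRoot.mk P (Q %ₘ P) := by
      conv_lhs => rw [← modByMonic_add_div Q P]
      rw [map_add, map_mul, AdjoinRoot.mk_self, zero_mul, add_zero]
    have hdeg : (Q %ₘ P).natDegree ≤ 1 := by
      have := natDegree_modByMonic_lt Q hmonic (by
        intro h1
        have := congrArg natDegree h1
        rw [hP, natDegree_X_pow_sub_C, natDegree_one] at this
        omega)
      rw [hP, natDegree_X_pow_sub_C] at this
      exact Nat.le_of_lt_succ this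
    refine ⟨(Q %ₘ P).coeff 0, (Q %ₘ P).coeff 1, ?_⟩
    rw [hQ]
    conv_lhs => rw [eq_X_add_C_of_natDegree_le_one hdeg]
    rw [map_add, map_mul, AdjoinRoot.mk_C, AdjoinRoot.mk_C, AdjoinRoot.mk_X, add_comm]
    rfl
  let ι : AdjoinRoot P →+* AdjoinRoot P := AdjoinRoot.lift (AdjoinRoot.of P) (-y) (by
    rw [hev, sub_eq_zero, neg_sq]
    exact hy)
  have hι (p : RatFunc k) : ι (φ p) = φ p := AdjoinRoot.lift_of _
  have hιy : ι y = -y := AdjoinRoot.lift_root _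
  obtain ⟨D, hD⟩ := exists_derivation φ hP (RingEquiv.refl _) hφ (y := y) rfl hy
  obtain ⟨σ, hσ⟩ := exists_aut_ne_of_card φ hy hspan h
  rw [hf] at hy
  obtain ⟨g, hg, hgσ, hc⟩ := exists_matrix_of_aut φ hv hy hspan ι hι hιy D hD σ
  refine ⟨g, hg, fun ⟨h01, h10, h00⟩ => hσ ?_, hc⟩
  rw [hgσ]
  congr 1
  have h11 : g 1 1 ≠ 0 := by
    intro h11
    apply hg
    rw [Matrix.det_fin_two, h01, h11]; ring
  rw [div_eq_iff]
  · rw [← RatFunc.algebraMap_X, ← map_mul]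
    congr 1
    simp [linForm, h01, h10, h00]
  · simpa [linForm, h10] using h11

end FunctionField

end GenusTwo

end

noncomputable section

namespace GenusTwo

/-! ### Covariance of the invariants -/

section Invariants

/-- The polynomial `J2` over a commutative ring. -/
def ringJ2 {R : Type} [CommRing R] (a : ℕ → R) : R :=
  6 * a 3 ^ 2 - 240 * a 0 * a 6 + 40 * a 1 * a 5 - 16 * a 2 * a 4

/-- The polynomial `J4` over a commutative ring. -/
def ringJ4 {R : Type} [CommRing R] (a : ℕ → R) : R :=
  48 * a 0 * a 4 ^ 3 + 48 * a 2 ^ 3 * a 6 + 4 * a 2 ^ 2 * a 4 ^ 2 + 1620 * a 0 ^ 2 * a 6 ^ 2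
    + 36 * a 1 * a 3 ^ 2 * a 5 - 12 * a 1 * a 3 * a 4 ^ 2 - 12 * a 2 ^ 2 * a 3 * a 5
    + 300 * a 1 ^ 2 * a 4 * a 6 + 300 * a 0 * a 5 ^ 2 * a 2 + 324 * a 0 * a 6 * a 3 ^ 2
    - 504 * a 0 * a 4 * a 2 * a 6 - 180 * a 0 * a 4 * a 3 * a 5 - 180 * a 1 * a 3 * a 2 * a 6
    + 4 * a 1 * a 4 * a 2 * a 5 - 540 * a 0 * a 5 * a 1 * a 6 - 80 * a 1 ^ 2 * a 5 ^ 2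

/-- The polynomial `J6` over a commutative ring. -/
def ringJ6 {R : Type} [CommRing R] (a : ℕ → R) : R :=
  176 * a 1 ^ 2 * a 5 ^ 2 * a 3 ^ 2 + 64 * a 1 ^ 2 * a 5 ^ 2 * a 4 * a 2
    + 1600 * a 1 ^ 3 * a 5 * a 4 * a 6 + 1600 * a 1 * a 5 ^ 3 * a 0 * a 2
    - 160 * a 0 * a 4 ^ 4 * a 2 - 96 * a 0 ^ 2 * a 4 ^ 3 * a 6 + 60 * a 0 * a 4 ^ 3 * a 3 ^ 2
    + 72 * a 1 * a 3 ^ 4 * a 5 - 24 * a 1 * a 3 ^ 3 * a 4 ^ 2 - 119880 * a 0 ^ 3 * a 6 ^ 3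
    - 320 * a 1 ^ 3 * a 5 ^ 3 - 160 * a 2 ^ 4 * a 4 * a 6 - 96 * a 2 ^ 3 * a 0 * a 6 ^ 2
    + 60 * a 2 ^ 3 * a 3 ^ 2 * a 6 - 24 * a 2 ^ 2 * a 3 ^ 3 * a 5
    + 8 * a 2 ^ 2 * a 3 ^ 2 * a 4 ^ 2 - 900 * a 2 ^ 2 * a 1 ^ 2 * a 6 ^ 2
    - 24 * a 2 ^ 3 * a 4 ^ 3 - 36 * a 2 ^ 4 * a 5 ^ 2 - 36 * a 1 ^ 2 * a 4 ^ 4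
    + 424 * a 0 * a 4 ^ 2 * a 2 ^ 2 * a 6 - 2240 * a 1 ^ 2 * a 5 ^ 2 * a 0 * a 6
    + 2250 * a 1 ^ 3 * a 3 * a 6 ^ 2 + 492 * a 0 * a 4 ^ 2 * a 2 * a 3 * a 5
    + 20664 * a 0 ^ 2 * a 4 * a 6 ^ 2 * a 2 + 3060 * a 0 ^ 2 * a 4 * a 6 * a 3 * a 5
    - 468 * a 0 * a 4 * a 3 ^ 2 * a 2 * a 6 - 198 * a 0 * a 4 * a 3 ^ 3 * a 5
    - 640 * a 0 * a 4 * a 2 ^ 2 * a 5 ^ 2 + 3472 * a 0 * a 4 * a 2 * a 5 * a 1 * a 6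
    - 18600 * a 0 * a 4 * a 1 ^ 2 * a 6 ^ 2 - 876 * a 0 * a 4 ^ 2 * a 1 * a 6 * a 3
    + 492 * a 1 * a 3 * a 2 ^ 2 * a 4 * a 6 - 238 * a 1 * a 3 ^ 2 * a 2 * a 4 * a 5
    + 76 * a 1 * a 3 * a 2 * a 4 ^ 3 + 3060 * a 1 * a 3 * a 0 * a 6 ^ 2 * a 2
    + 1818 * a 1 * a 3 ^ 2 * a 0 * a 6 * a 5 + 26 * a 1 * a 3 * a 2 ^ 2 * a 5 ^ 2
    - 1860 * a 1 ^ 2 * a 3 * a 2 * a 5 * a 6 + 330 * a 1 ^ 2 * a 3 ^ 2 * a 6 * a 4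
    + 76 * a 2 ^ 3 * a 4 * a 3 * a 5 - 876 * a 2 ^ 2 * a 0 * a 6 * a 3 * a 5
    + 616 * a 2 ^ 3 * a 5 * a 1 * a 6 + 2250 * a 0 ^ 2 * a 5 ^ 3 * a 3
    - 10044 * a 0 ^ 2 * a 6 ^ 2 * a 3 ^ 2 + 28 * a 1 * a 4 ^ 2 * a 2 ^ 2 * a 5
    - 640 * a 1 ^ 2 * a 4 ^ 2 * a 2 * a 6 + 26 * a 1 ^ 2 * a 4 ^ 2 * a 3 * a 5
    - 1860 * a 1 * a 4 * a 0 * a 5 ^ 2 * a 3 + 616 * a 1 * a 4 ^ 3 * a 0 * a 5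
    - 18600 * a 0 ^ 2 * a 5 ^ 2 * a 6 * a 2 + 59940 * a 0 ^ 2 * a 5 * a 6 ^ 2 * a 1
    + 330 * a 0 * a 5 ^ 2 * a 3 ^ 2 * a 2 + 162 * a 0 * a 6 * a 3 ^ 4
    - 900 * a 0 ^ 2 * a 5 ^ 2 * a 4 ^ 2 - 198 * a 1 * a 3 ^ 3 * a 2 * a 6

theorem ringJ2_eq {k : Type} [Field k] (a : ℕ → k) : ringJ2 a = J2 a := rfl

theorem ringJ4_eq {k : Type} [Field k] (a : ℕ → k) : ringJ4 a = J4 a := rfl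

theorem ringJ6_eq {k : Type} [Field k] (a : ℕ → k) : ringJ6 a = J6 a := rfl

theorem map_ringJ2 {R S : Type} [CommRing R] [CommRing S] (φ : R →+* S) (a : ℕ → R) :
    φ (ringJ2 a) = ringJ2 fun i => φ (a i) := by
  simp only [ringJ2, map_add, map_sub, map_mul, map_pow, map_ofNat]

theorem map_ringJ4 {R S : Type} [CommRing R] [CommRing S] (φ : R →+* S) (a : ℕ → R) :
    φ (ringJ4 a) = ringJ4 fun i => φ (a i) := by
  simp only [ringJ4, map_add, map_sub, map_mul, map_pow, map_ofNat]

theorem map_ringJ6 {R S : Type} [CommRing R] [CommRing S] (φ : R →+* S) (a : ℕ → R) :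
    φ (ringJ6 a) = ringJ6 fun i => φ (a i) := by
  simp only [ringJ6, map_add, map_sub, map_mul, map_pow, map_ofNat]

section Derivation

variable {R A : Type} [CommRing R] [CommRing A] [Algebra R A] (D : Derivation R A A) {a : ℕ → A}

theorem derivation_ofNat (n : ℕ) [n.AtLeastTwo] : D (ofNat(n) : A) = 0 :=
  D.map_natCast n

/-- The rules `D aᵢ = (i + 1) aᵢ₊₁` describe the translation `x ↦ x + t` to first order on the
coefficients of a sextic. Here and in the next two lemmas, being killed by `D` is infinitesimal
translation invariance, verified by expansion. -/
theorem derivation_ringJ2 (h0 : D (a 0) = a 1) (h1 : D (a 1) = 2 * a 2) (h2 : D (a 2) = 3 * a 3)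
    (h3 : D (a 3) = 4 * a 4) (h4 : D (a 4) = 5 * a 5) (h5 : D (a 5) = 6 * a 6)
    (h6 : D (a 6) = 0) : D (ringJ2 a) = 0 := by
  simp only [ringJ2, map_add, map_sub, D.leibniz, D.leibniz_pow, derivation_ofNat, h0, h1, h2,
    h3, h4, h5, h6, smul_eq_mul, nsmul_eq_mul]
  push_cast
  ring

theorem derivation_ringJ4 (h0 : D (a 0) = a 1) (h1 : D (a 1) = 2 * a 2) (h2 : D (a 2) = 3 * a 3)
    (h3 : D (a 3) = 4 * a 4) (h4 : D (a 4) = 5 * a 5) (h5 : D (a 5) = 6 * a 6)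
    (h6 : D (a 6) = 0) : D (ringJ4 a) = 0 := by
  simp only [ringJ4, map_add, map_sub, D.leibniz, D.leibniz_pow, derivation_ofNat, h0, h1, h2,
    h3, h4, h5, h6, smul_eq_mul, nsmul_eq_mul]
  push_cast
  ring

theorem derivation_ringJ6 (h0 : D (a 0) = a 1) (h1 : D (a 1) = 2 * a 2) (h2 : D (a 2) = 3 * a 3)
    (h3 : D (a 3) = 4 * a 4) (h4 : D (a 4) = 5 * a 5) (h5 : D (a 5) = 6 * a 6)
    (h6 : D (a 6) = 0) : D (ringJ6 a) = 0 := by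
  simp only [ringJ6, map_add, map_sub, D.leibniz, D.leibniz_pow, derivation_ofNat, h0, h1, h2,
    h3, h4, h5, h6, smul_eq_mul, nsmul_eq_mul]
  push_cast
  ring

end Derivation

end Invariants

end GenusTwo

end

/-! ### Covariance of `J₂, J₄, J₆` under linear substitutions -/

noncomputable section

namespace GenusTwo

section Covariance

variable {k : Type} [Field k]

/-- The three polynomial invariants of a form transform under `M` with the powers of `det M`
prescribed by their degrees. -/
def IsCovariant (M : Matrix (Fin 2) (Fin 2) k) : Prop :=
  ∀ v : Fin 6 → Fin 2 → k,
    J2 (sextic (actBy v M)).coeff = M.det ^ 6 * J2 (sextic v).coeff ∧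
    J4 (sextic (actBy v M)).coeff = M.det ^ 12 * J4 (sextic v).coeff ∧
    J6 (sextic (actBy v M)).coeff = M.det ^ 18 * J6 (sextic v).coeff

theorem IsCovariant.mul {M N : Matrix (Fin 2) (Fin 2) k} (hM : IsCovariant M)
    (hN : IsCovariant N) : IsCovariant (M * N) := fun v => by
  obtain ⟨h2, h4, h6⟩ := hM v
  obtain ⟨h2', h4', h6'⟩ := hN (actBy v M)
  rw [actBy_mul, h2', h4', h6', h2, h4, h6, Matrix.det_mul]
  exact ⟨by ring, by ring, by ring⟩

theorem sextic_actBy_diagonal (v : Fin 6 → Fin 2 → k) (d : Fin 2 → k) (h : d 1 ≠ 0) :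
    sextic (actBy v (Matrix.diagonal d)) = C (d 1 ^ 6) * (sextic v).comp (C (d 0 / d 1) * X) := by
  have h6 : (C (d 1 ^ 6) : k[X]) = ∏ _i : Fin 6, C (d 1) := by simp
  rw [sextic, sextic, prod_comp, h6, ← Finset.prod_mul_distrib]
  refine Finset.prod_congr rfl fun i _ => ?_
  simp only [linForm, actBy_apply, add_comp, mul_comp, C_comp, X_comp, Matrix.diagonal_apply_eq]
  simp only [Matrix.diagonal_apply_ne d (show (1 : Fin 2) ≠ 0 by decide),
    Matrix.diagonal_apply_ne d (show (0 : Fin 2) ≠ 1 by decide), mul_zero, add_zero, zero_add]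
  have h1 : C (v i 0 * d 0) = C (d 1) * (C (v i 0) * C (d 0 / d 1)) := by
    rw [← C_mul, ← C_mul]
    congr 1
    field_simp
  rw [h1, C_mul]
  ring

theorem coeff_sextic_actBy_diagonal (v : Fin 6 → Fin 2 → k) (d : Fin 2 → k) (h : d 1 ≠ 0)
    {i : ℕ} (hi : i ≤ 6) : (sextic (actBy v (Matrix.diagonal d))).coeff i =
      d 0 ^ i * d 1 ^ (6 - i) * (sextic v).coeff i := by
  rw [sextic_actBy_diagonal v d h, coeff_C_mul, comp_C_mul_X_coeff, div_pow]
  have : d 1 ^ 6 = d 1 ^ i * d 1 ^ (6 - i) := by rw [← pow_add, Nat.add_sub_cancel' hi]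
  rw [this]
  field_simp

/-- Each monomial of the invariant of degree `m` has index sum `3m`, so it is scaled by `(d 0 * d 1)
^ (3m)`. -/
theorem isCovariant_diagonal (d : Fin 2 → k) (hd : (Matrix.diagonal d).det ≠ 0) :
    IsCovariant (Matrix.diagonal d) := fun v => by
  have h1 : d 1 ≠ 0 := by
    rintro h
    exact hd (by simp [Matrix.det_diagonal, Fin.prod_univ_two, h])
  have hc {i : ℕ} (hi : i ≤ 6) := coeff_sextic_actBy_diagonal v d h1 hi
  have hdet : (Matrix.diagonal d).det = d 0 * d 1 := by
    simp [Matrix.det_diagonal, Fin.prod_univ_two]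
  have e0 := hc (i := 0) (by norm_num)
  have e1 := hc (i := 1) (by norm_num)
  have e2 := hc (i := 2) (by norm_num)
  have e3 := hc (i := 3) (by norm_num)
  have e4 := hc (i := 4) (by norm_num)
  have e5 := hc (i := 5) (by norm_num)
  have e6 := hc (i := 6) (by norm_num)
  generalize (sextic (actBy v (Matrix.diagonal d))).coeff = b at *
  generalize (sextic v).coeff = a at *
  norm_num at e0 e1 e2 e3 e4 e5 e6
  rw [hdet]
  refine ⟨?_, ?_, ?_⟩
  · simp only [J2, e0, e1, e2, e3, e4, e5, e6]; ring
  · simp only [J4, e0, e1, e2, e3, e4, e5, e6]; ring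
  · simp only [J6, e0, e1, e2, e3, e4, e5, e6]; ring

theorem isCovariant_swap : IsCovariant (!![0, 1; 1, 0] : Matrix (Fin 2) (Fin 2) k) := fun v => by
  have hs : sextic (actBy v !![0, 1; 1, 0]) = (sextic v).reflect 6 := by
    rw [coeff_reflect_sextic]
    congr 1
    funext i j
    fin_cases j <;> simp [actBy_apply]
  have hdet : (!![0, 1; 1, 0] : Matrix (Fin 2) (Fin 2) k).det = -1 := by
    simp [Matrix.det_fin_two]
  have hr (i : ℕ) (hi : i ≤ 6) : (sextic (actBy v !![0, 1; 1, 0])).coeff i =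
      (sextic v).coeff (6 - i) := by
    rw [hs, coeff_reflect, revAt_le hi]
  have e0 := hr 0 (by norm_num)
  have e1 := hr 1 (by norm_num)
  have e2 := hr 2 (by norm_num)
  have e3 := hr 3 (by norm_num)
  have e4 := hr 4 (by norm_num)
  have e5 := hr 5 (by norm_num)
  have e6 := hr 6 (by norm_num)
  generalize (sextic (actBy v !![0, 1; 1, 0])).coeff = b at *
  generalize (sextic v).coeff = a at *
  norm_num at e0 e1 e2 e3 e4 e5 e6
  rw [hdet]
  refine ⟨?_, ?_, ?_⟩
  · simp only [J2, e0, e1, e2, e3, e4, e5, e6]; ring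
  · simp only [J4, e0, e1, e2, e3, e4, e5, e6]; ring
  · simp only [J6, e0, e1, e2, e3, e4, e5, e6]; ring

theorem eval_eq_of_derivative_eq_zero [CharZero k] {p : k[X]} (h : derivative p = 0) (s t : k) :
    p.eval s = p.eval t := by
  obtain ⟨c, rfl⟩ := natDegree_eq_zero.mp (derivative_eq_zero.mp h)
  simp

theorem derivative_hasseDeriv (p : k[X]) (n : ℕ) :
    derivative (hasseDeriv n p) = ((n + 1 : ℕ) : k[X]) * hasseDeriv (n + 1) p := by
  have h := congrArg (fun L => L p) (hasseDeriv_comp (R := k) 1 n)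
  simp only [LinearMap.comp_apply, hasseDeriv_one', LinearMap.smul_apply] at h
  rw [h, Nat.choose_one_right, add_comm 1 n, nsmul_eq_mul]

/-- The Hasse derivatives of `p`, evaluated at `t`, are the coefficients of the translate of `p` by
`t`. An invariant of these is a polynomial in `t` with zero derivative, hence takes the same value
at `c` and at 0. -/
theorem taylor_invariant [CharZero k] {p : k[X]} (hp : p.natDegree ≤ 6) (c : k) :
    J2 (taylor c p).coeff = J2 p.coeff ∧ J4 (taylor c p).coeff = J4 p.coeff ∧
      J6 (taylor c p).coeff = J6 p.coeff := by
  set a : ℕ → k[X] := fun i => hasseDeriv i p with ha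
  let D : Derivation k k[X] k[X] := derivative'
  have hD (i : ℕ) : D (a i) = ((i + 1 : ℕ) : k[X]) * a (i + 1) := derivative_hasseDeriv p i
  have h0 : D (a 0) = a 1 := by simpa using hD 0
  have h1 : D (a 1) = 2 * a 2 := by simpa using hD 1
  have h2 : D (a 2) = 3 * a 3 := by simpa using hD 2
  have h3 : D (a 3) = 4 * a 4 := by simpa using hD 3
  have h4 : D (a 4) = 5 * a 5 := by simpa using hD 4
  have h5 : D (a 5) = 6 * a 6 := by simpa using hD 5
  have h6 : D (a 6) = 0 := by
    rw [hD 6, ha]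
    simp only
    rw [hasseDeriv_eq_zero_of_lt_natDegree _ _ (by omega), mul_zero]
  have hev (t : k) : (fun i => (evalRingHom t) (a i)) = (taylor t p).coeff := by
    funext i
    rw [taylor_coeff]; rfl
  have key {F : (ℕ → k[X]) → k[X]} {G : (ℕ → k) → k} (hF : D (F a) = 0)
      (hFG : ∀ t, evalRingHom t (F a) = G fun i => evalRingHom t (a i)) :
      G (taylor c p).coeff = G p.coeff := by
    have := eval_eq_of_derivative_eq_zero (p := F a) hF c 0
    rw [← coe_evalRingHom, ← coe_evalRingHom, hFG, hFG, hev, hev, taylor_zero] at this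
    exact this
  exact ⟨key (derivation_ringJ2 D h0 h1 h2 h3 h4 h5 h6) fun t => map_ringJ2 _ a,
    key (derivation_ringJ4 D h0 h1 h2 h3 h4 h5 h6) fun t => map_ringJ4 _ a,
    key (derivation_ringJ6 D h0 h1 h2 h3 h4 h5 h6) fun t => map_ringJ6 _ a⟩

theorem sextic_actBy_upper (v : Fin 6 → Fin 2 → k) (c : k) :
    sextic (actBy v !![1, c; 0, 1]) = taylor c (sextic v) := by
  rw [taylor_apply, sextic, sextic, prod_comp]
  refine Finset.prod_congr rfl fun i _ => ?_
  simp [linForm, actBy_apply]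
  ring

theorem isCovariant_upper [CharZero k] (c : k) :
    IsCovariant (!![1, c; 0, 1] : Matrix (Fin 2) (Fin 2) k) := fun v => by
  have hdet : (!![1, c; 0, 1] : Matrix (Fin 2) (Fin 2) k).det = 1 := by
    simp [Matrix.det_fin_two]
  rw [sextic_actBy_upper, hdet]
  simpa using taylor_invariant (sextic_natDegree_le v) c

/-- Diagonal matrices and transvections generate; a lower transvection is an upper one conjugated by
the swap of coordinates. -/
theorem isCovariant [CharZero k] {M : Matrix (Fin 2) (Fin 2) k} (hM : M.det ≠ 0) :
    IsCovariant M := by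
  refine Matrix.diagonal_transvection_induction_of_det_ne_zero IsCovariant M hM
    isCovariant_diagonal ?_ fun A B _ _ hA hB => hA.mul hB
  rintro ⟨i, j, hij, c⟩
  rw [Matrix.TransvectionStruct.toMatrix_mk]
  have hlow : (Matrix.transvection 1 0 c : Matrix (Fin 2) (Fin 2) k) =
      !![0, 1; 1, 0] * !![1, c; 0, 1] * !![0, 1; 1, 0] := by
    ext a b
    fin_cases a <;> fin_cases b <;> simp [Matrix.transvection]
  have hup : (Matrix.transvection 0 1 c : Matrix (Fin 2) (Fin 2) k) = !![1, c; 0, 1] := by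
    ext a b
    fin_cases a <;> fin_cases b <;> simp [Matrix.transvection]
  fin_cases i <;> fin_cases j
  · exact absurd rfl hij
  · exact hup ▸ isCovariant_upper c
  · exact hlow ▸ (isCovariant_swap.mul (isCovariant_upper c)).mul isCovariant_swap
  · exact absurd rfl hij

end Covariance

end GenusTwo

end

/-! ### The discriminant as a product of brackets, and weighted equivalence -/

noncomputable section

namespace GenusTwo

section Discriminant

variable {k : Type} [Field k]

/-- The resultant of `f` and `f'` is, up to a power of the leading coefficient, the product of `f'`
over the roots, and `f'(xᵢ) = c ∏ (xᵢ - xⱼ)`. -/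
theorem discr_C_mul_prod {ι : Type} [DecidableEq ι] (s : Finset ι) (hs : s.Nonempty) (x : ι → k)
    {c : k} (hc : c ≠ 0) : (C c * ∏ i ∈ s, (X - C (x i))).discr =
      (-1) ^ (s.card * (s.card - 1) / 2) * c ^ (2 * s.card - 2) *
        ∏ i ∈ s, ∏ j ∈ s.erase i, (x i - x j) := by
  set f := C c * ∏ i ∈ s, (X - C (x i)) with hf
  have hcard : 0 < s.card := hs.card_pos
  have hmonic : (∏ i ∈ s, (X - C (x i))).Monic := monic_prod_X_sub_C _ _
  have hdeg : f.natDegree = s.card := by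
    rw [hf, natDegree_C_mul hc, natDegree_finsetProd_X_sub_C_eq_card]
  have hlc : f.leadingCoeff = c := by
    rw [hf, leadingCoeff_mul, hmonic.leadingCoeff, leadingCoeff_C, mul_one]
  have hroots : f.roots = s.val.map x := by
    have h := roots_multiset_prod_X_sub_C (s.val.map x)
    rw [Multiset.map_map] at h
    rw [hf, roots_C_mul _ hc, Finset.prod_eq_multiset_prod]
    exact h
  have hsplit : f.Splits := by
    refine Splits.mul (Splits.C c) (Splits.prod fun i _ => Splits.X_sub_C _)
  have h1 := resultant_deriv (f := f) (natDegree_pos_iff_degree_pos.mp (hdeg ▸ hcard))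
  rw [resultant_eq_prod_eval _ _ _ (natDegree_derivative_le f) hsplit, hroots, hlc, hdeg,
    Multiset.map_map] at h1
  have hder (i : ι) (hi : i ∈ s) : (derivative f).eval (x i) = c * ∏ j ∈ s.erase i, (x i - x j) := by
    rw [hf, derivative_C_mul, eval_mul, eval_C, derivative_prod_finset, eval_finsetSum,
      Finset.sum_eq_single i]
    · simp [eval_prod]
    · intro j _ hji
      rw [eval_mul, eval_prod, Finset.prod_eq_zero (i := i)]
      · simp
      · exact Finset.mem_erase.mpr ⟨hji.symm, hi⟩
      · simp
    · exact fun h => absurd hi h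
  have h2 : (Multiset.map ((fun t => eval t (derivative f)) ∘ x) s.val).prod =
      c ^ s.card * ∏ i ∈ s, ∏ j ∈ s.erase i, (x i - x j) := by
    rw [← Finset.prod_eq_multiset_prod, ← Finset.prod_const, ← Finset.prod_mul_distrib]
    exact Finset.prod_congr rfl fun i hi => hder i hi
  rw [h2] at h1
  have hsign : ((-1 : k) ^ (s.card * (s.card - 1) / 2)) * (-1) ^ (s.card * (s.card - 1) / 2) = 1 := by
    rw [← mul_pow]; simp
  apply mul_left_cancel₀ hc
  have hpow : c * c ^ (2 * s.card - 2) = c ^ (s.card - 1) * c ^ s.card := by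
    rw [← pow_succ', ← pow_add]
    congr 1
    omega
  calc c * f.discr = (-1) ^ (s.card * (s.card - 1) / 2) *
        ((-1) ^ (s.card * (s.card - 1) / 2) * c * f.discr) := by
        linear_combination (-c * f.discr) * hsign
    _ = _ := by
        rw [← h1]
        linear_combination (-(-1) ^ (s.card * (s.card - 1) / 2) *
          ∏ i ∈ s, ∏ j ∈ s.erase i, (x i - x j)) * hpow

/-- The discriminant of the binary sextic attached to a polynomial of degree 5 or 6. -/
def sexticDiscr (p : k[X]) : k :=
  if p.natDegree = 6 then p.discr else p.leadingCoeff ^ 2 * p.discr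

theorem linForm_eq {w : Fin 2 → k} (h : w 0 ≠ 0) :
    linForm w = C (w 0) * (X - C (-(w 1 / w 0))) := by
  rw [linForm, mul_sub, ← C_mul, mul_neg, mul_div_cancel₀ _ h, C_neg, sub_neg_eq_add]

theorem prod_linForm {ι : Type} (s : Finset ι) {v : ι → Fin 2 → k} (h : ∀ i ∈ s, v i 0 ≠ 0) :
    ∏ i ∈ s, linForm (v i) =
      C (∏ i ∈ s, v i 0) * ∏ i ∈ s, (X - C (-(v i 1 / v i 0))) := by
  rw [map_prod, ← Finset.prod_mul_distrib]
  exact Finset.prod_congr rfl fun i hi => linForm_eq (h i hi)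

/-- Each leading coefficient occurs in `card - 1` ordered pairs as first entry and in as many as
second entry, hence the exponent `2 * card - 2`. -/
theorem prod_root_sub {ι : Type} [DecidableEq ι] (s : Finset ι) {v : ι → Fin 2 → k}
    (h : ∀ i ∈ s, v i 0 ≠ 0) :
    (∏ i ∈ s, v i 0) ^ (2 * s.card - 2) *
      ∏ i ∈ s, ∏ j ∈ s.erase i, (-(v i 1 / v i 0) - -(v j 1 / v j 0)) =
      ∏ i ∈ s, ∏ j ∈ s.erase i, bracket (v i) (v j) := by
  have h1 : ∏ i ∈ s, ∏ j ∈ s.erase i, (v i 0 * v j 0) = (∏ i ∈ s, v i 0) ^ (2 * s.card - 2) := by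
    -- The last factor corrects the truncated exponent `s.card - 2` when `s` is a singleton.
    have h2 (i) (hi : i ∈ s) : ∏ j ∈ s.erase i, (v i 0 * v j 0) =
        v i 0 ^ (s.card - 2) * (v i 0 * ∏ j ∈ s.erase i, v j 0) * if s.card = 1 then (v i 0)⁻¹ else 1 := by
      rw [Finset.prod_mul_distrib, Finset.prod_const, Finset.card_erase_of_mem hi]
      have hpos : 0 < s.card := Finset.card_pos.mpr ⟨i, hi⟩
      split_ifs with hc
      · have := h i hi
        simp only [hc]
        field_simp
      · rw [← mul_assoc, ← pow_succ, show s.card - 2 + 1 = s.card - 1 by omega, mul_one]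
    rw [Finset.prod_congr rfl h2]
    by_cases hc : s.card = 1
    · obtain ⟨i, rfl⟩ := Finset.card_eq_one.mp hc
      have := h i (by simp)
      simp [this]
    · simp only [hc, if_false, mul_one]
      rw [Finset.prod_mul_distrib, Finset.prod_pow,
        Finset.prod_congr rfl fun i hi => Finset.mul_prod_erase s (fun i => v i 0) hi,
        Finset.prod_const, ← pow_add]
      rcases s.eq_empty_or_nonempty with rfl | hs
      · simp
      · congr 1
        have := hs.card_pos
        omega
  rw [← h1, ← Finset.prod_mul_distrib]
  refine Finset.prod_congr rfl fun i hi => ?_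
  rw [← Finset.prod_mul_distrib]
  refine Finset.prod_congr rfl fun j hj => ?_
  have hi0 := h i hi
  have hj0 := h j (Finset.mem_of_mem_erase hj)
  rw [bracket]
  field_simp
  ring

/-- In degree 6 the sign is `(-1)¹⁵`. In degree 5 the discriminant itself has sign `(-1)¹⁰ = 1`, the
minus sign comes from the five brackets whose first entry is the root at infinity, and the brackets
with that root supply the extra square of the leading coefficient. -/
theorem sexticDiscr_sextic {v : Fin 6 → Fin 2 → k} (hv : IsGeneral v) :
    sexticDiscr (sextic v) = -∏ i, ∏ j ∈ Finset.univ.erase i, bracket (v i) (v j) := by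
  classical
  by_cases hall : ∀ i, v i 0 ≠ 0
  · have hc : ∏ i, v i 0 ≠ 0 := Finset.prod_ne_zero_iff.mpr fun i _ => hall i
    have hs : sextic v = C (∏ i, v i 0) * ∏ i, (X - C (-(v i 1 / v i 0))) :=
      prod_linForm Finset.univ fun i _ => hall i
    have hd : (sextic v).natDegree = 6 := by
      rw [hs, natDegree_C_mul hc, natDegree_finsetProd_X_sub_C_eq_card]
      simp
    rw [sexticDiscr, if_pos hd, hs, discr_C_mul_prod _ Finset.univ_nonempty _ hc,
      ← prod_root_sub Finset.univ fun i _ => hall i]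
    simp only [Finset.card_univ, Fintype.card_fin]
    norm_num
  · push Not at hall
    obtain ⟨m, hm⟩ := hall
    have hne (i) (hi : i ∈ Finset.univ.erase m) : v i 0 ≠ 0 := fun h0 =>
      hv i m (Finset.ne_of_mem_erase hi) (by simp [bracket, h0, hm])
    have hm1 : v m 1 ≠ 0 := fun h1 => by
      obtain ⟨j, hj⟩ := exists_ne_fin_six m
      exact hv m j hj (by simp [bracket, h1, hm])
    set s : Finset (Fin 6) := Finset.univ.erase m with hsdef
    have hscard : s.card = 5 := by simp [hsdef]
    have hP : ∏ i ∈ s, v i 0 ≠ 0 := Finset.prod_ne_zero_iff.mpr hne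
    have hc : v m 1 * ∏ i ∈ s, v i 0 ≠ 0 := mul_ne_zero hm1 hP
    have hs : sextic v = C (v m 1 * ∏ i ∈ s, v i 0) * ∏ i ∈ s, (X - C (-(v i 1 / v i 0))) := by
      rw [C_mul, mul_assoc, ← prod_linForm s hne, sextic,
        ← Finset.mul_prod_erase Finset.univ _ (Finset.mem_univ m)]
      simp [linForm, hm, hsdef]
    have hmon : (∏ i ∈ s, (X - C (-(v i 1 / v i 0)))).Monic := monic_prod_X_sub_C _ _
    have hd : (sextic v).natDegree = 5 := by
      rw [hs, natDegree_C_mul hc, natDegree_finsetProd_X_sub_C_eq_card, hscard]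
    have hlc : (sextic v).leadingCoeff = v m 1 * ∏ i ∈ s, v i 0 := by
      rw [hs, leadingCoeff_mul, hmon.leadingCoeff, leadingCoeff_C, mul_one]
    rw [sexticDiscr, if_neg (by omega), hlc, hs,
      discr_C_mul_prod _ (Finset.card_pos.mp (by omega)) _ hc,
      ← Finset.mul_prod_erase Finset.univ _ (Finset.mem_univ m)]
    have h1 (i) (hi : i ∈ s) : ∏ j ∈ Finset.univ.erase i, bracket (v i) (v j) =
        (v i 0 * v m 1) * ∏ j ∈ s.erase i, bracket (v i) (v j) := by
      rw [← Finset.mul_prod_erase (Finset.univ.erase i) _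
        (Finset.mem_erase.mpr ⟨(Finset.ne_of_mem_erase hi).symm, Finset.mem_univ m⟩),
        Finset.erase_right_comm]
      congr 1
      simp [bracket, hm]
    have h2 : ∏ j ∈ s, bracket (v m) (v j) = -(v m 1 ^ 5 * ∏ j ∈ s, v j 0) := by
      have : ∀ j ∈ s, bracket (v m) (v j) = -v m 1 * v j 0 := fun j _ => by
        simp [bracket, hm]; ring
      rw [Finset.prod_congr rfl this, Finset.prod_mul_distrib, Finset.prod_const, hscard]
      ring
    rw [Finset.prod_congr rfl h1, Finset.prod_mul_distrib, ← prod_root_sub s hne, h2,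
      Finset.prod_mul_distrib, Finset.prod_const, hscard]
    norm_num
    ring

theorem sexticDiscr_actBy {v : Fin 6 → Fin 2 → k} (hv : IsGeneral v)
    {M : Matrix (Fin 2) (Fin 2) k} (hM : M.det ≠ 0) :
    sexticDiscr (sextic (actBy v M)) = M.det ^ 30 * sexticDiscr (sextic v) := by
  rw [sexticDiscr_sextic hv, sexticDiscr_sextic (hv.actBy hM)]
  simp only [bracket_actBy, Finset.prod_mul_distrib, Finset.prod_const]
  have (i : Fin 6) : (Finset.univ.erase i).card = 5 := by simp
  simp only [this, Finset.prod_const, Finset.card_univ, Fintype.card_fin]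
  ring

/-- The invariants of the binary sextic attached to a polynomial of degree 5 or 6. -/
def sexticInvariants (p : k[X]) : Fin 4 → k :=
  ![J2 p.coeff, J4 p.coeff, J6 p.coeff, sexticDiscr p]

theorem Curve.invariants_eq (C : Curve k) : C.invariants = sexticInvariants C.f := rfl

/-- The exponents 6, 12, 18, 30 of the determinant are three times the weights, so `r = det ^ 3`
works. -/
theorem weightedEquiv_actBy [CharZero k] {v : Fin 6 → Fin 2 → k} (hv : IsGeneral v)
    {M : Matrix (Fin 2) (Fin 2) k} (hM : M.det ≠ 0) :
    WeightedEquiv (sexticInvariants (sextic (actBy v M))) (sexticInvariants (sextic v)) := by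
  obtain ⟨h2, h4, h6⟩ := isCovariant hM v
  refine ⟨Units.mk0 (M.det ^ 3) (pow_ne_zero 3 hM), fun i => ?_⟩
  rw [Units.val_mk0, ← pow_mul]
  fin_cases i
  · exact h2
  · exact h4
  · exact h6
  · exact sexticDiscr_actBy hv hM

end Discriminant

end GenusTwo

end

/-! ### Diagonalising an extra automorphism -/

noncomputable section

namespace GenusTwo

section NormalForm

variable {k : Type} [Field k]

theorem sextic_actBy_conj [Infinite k] {v : Fin 6 → Fin 2 → k}
    {g M h : Matrix (Fin 2) (Fin 2) k} (hM : M.det ≠ 0) (hgM : g * M = M * h) {c : k}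
    (hc : sextic (actBy v g) = C c * sextic v) :
    sextic (actBy (actBy v M) h) = C c * sextic (actBy v M) := by
  rw [← actBy_mul, ← hgM, actBy_mul]
  exact sextic_actBy_congr hc hM

theorem exists_upperTriangular [IsAlgClosed k] [CharZero k] (g : Matrix (Fin 2) (Fin 2) k) :
    ∃ M h : Matrix (Fin 2) (Fin 2) k, M.det ≠ 0 ∧ g * M = M * h ∧ h 1 0 = 0 := by
  -- `s` is a square root of the discriminant of the characteristic polynomial, so `l` below is an
  -- eigenvalue. Completing an eigenvector `p` to a basis gives the triangularising matrix.
  obtain ⟨s, hs⟩ := IsAlgClosed.exists_pow_nat_eq (g.trace ^ 2 - 4 * g.det) (n := 2) (by norm_num)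
  rw [Matrix.trace_fin_two, Matrix.det_fin_two] at hs
  set l := (g 0 0 + g 1 1 + s) / 2 with hl
  have hdet : (g - Matrix.scalar (Fin 2) l).det = 0 := by
    rw [Matrix.det_fin_two]
    simp only [Matrix.sub_apply, Matrix.scalar_apply, Matrix.diagonal_apply, if_true]
    simp [hl]
    linear_combination (1 / 4 : k) * hs
  obtain ⟨p, hp0, hp⟩ := Matrix.exists_mulVec_eq_zero_iff.mpr hdet
  have e0 := congrFun hp 0
  have e1 := congrFun hp 1
  simp [Matrix.mulVec, dotProduct, Fin.sum_univ_two] at e0 e1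
  obtain ⟨q, hq⟩ : ∃ q : Fin 2 → k, p 0 * q 1 - q 0 * p 1 ≠ 0 := by
    by_cases h0 : p 0 = 0
    · have h1 : p 1 ≠ 0 := by
        intro h1
        apply hp0
        funext i
        fin_cases i
        · exact h0
        · exact h1
      exact ⟨![1, 0], by simpa using h1⟩
    · exact ⟨![0, 1], by simpa using h0⟩
  set M : Matrix (Fin 2) (Fin 2) k := !![p 0, q 0; p 1, q 1] with hMdef
  have hM : M.det ≠ 0 := by rwa [hMdef, Matrix.det_fin_two_of]
  have hMu : IsUnit M.det := isUnit_iff_ne_zero.mpr hM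
  refine ⟨M, M⁻¹ * (g * M), hM, ?_, ?_⟩
  · rw [← mul_assoc, Matrix.mul_nonsing_inv M hMu, one_mul]
  · rw [Matrix.inv_def, Matrix.adjugate_fin_two, Matrix.smul_mul, Matrix.smul_apply]
    simp [hMdef, Matrix.mul_apply, Fin.sum_univ_two]
    right
    linear_combination (-p 1) * e0 + p 0 * e1

/-- After triangularisation, distinct eigenvalues allow diagonalisation by a unipotent matrix, and
equal ones leave a nontrivial Jordan block, because scalar matrices are excluded. -/
theorem exists_normal_matrix [IsAlgClosed k] [CharZero k] (g : Matrix (Fin 2) (Fin 2) k)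
    (hg : g.det ≠ 0) (hns : ¬ (g 0 1 = 0 ∧ g 1 0 = 0 ∧ g 0 0 = g 1 1)) :
    ∃ M h : Matrix (Fin 2) (Fin 2) k, M.det ≠ 0 ∧ g * M = M * h ∧ h.det ≠ 0 ∧
      ((∃ d : Fin 2 → k, d 0 ≠ d 1 ∧ h = Matrix.diagonal d) ∨
        ∃ l b : k, b ≠ 0 ∧ h = !![l, b; 0, l]) := by
  obtain ⟨M, h, hM, hgM, h10⟩ := exists_upperTriangular g
  have hdet : h.det ≠ 0 := by
    have := congrArg Matrix.det hgM
    rw [Matrix.det_mul, Matrix.det_mul, mul_comm] at this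
    rwa [← mul_left_cancel₀ hM this]
  by_cases h00 : h 0 0 = h 1 1
  · refine ⟨M, h, hM, hgM, hdet, Or.inr ⟨h 0 0, h 0 1, ?_, ?_⟩⟩
    · intro h01
      have hsc : h = Matrix.scalar (Fin 2) (h 0 0) := by
        ext i j
        fin_cases i <;> fin_cases j <;> simp [h01, h10, h00]
      have hgs : g = Matrix.scalar (Fin 2) (h 0 0) := by
        have hcomm : M * Matrix.scalar (Fin 2) (h 0 0) = Matrix.scalar (Fin 2) (h 0 0) * M := by
          ext i j
          simp [mul_comm]
        rw [hsc, hcomm] at hgM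
        have hMu : IsUnit M.det := isUnit_iff_ne_zero.mpr hM
        have := congrArg (· * M⁻¹) hgM
        simp only [mul_assoc, Matrix.mul_nonsing_inv M hMu, mul_one] at this
        simpa using this
      exact hns (by rw [hgs]; simp)
    · ext i j
      fin_cases i <;> fin_cases j <;> simp [h10, h00]
  · set t := h 0 1 / (h 1 1 - h 0 0) with ht
    have hne : h 1 1 - h 0 0 ≠ 0 := sub_ne_zero.mpr (Ne.symm h00)
    have hN : h * !![1, t; 0, 1] = !![1, t; 0, 1] * Matrix.diagonal ![h 0 0, h 1 1] := by
      ext i j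
      fin_cases i <;> fin_cases j <;> simp [Matrix.mul_apply, Fin.sum_univ_two, h10]
      rw [ht]
      field_simp
      ring
    refine ⟨M * !![1, t; 0, 1], Matrix.diagonal ![h 0 0, h 1 1], ?_, ?_, ?_, Or.inl ⟨_, ?_, rfl⟩⟩
    · rw [Matrix.det_mul]
      exact mul_ne_zero hM (by simp [Matrix.det_fin_two])
    · rw [← mul_assoc, hgM, mul_assoc, hN, mul_assoc]
    · rw [Matrix.det_fin_two, h10, mul_zero, sub_zero] at hdet
      simpa [Matrix.det_diagonal, Fin.prod_univ_two] using hdet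
    · simpa using h00

/-- Invariance under translation by `t` would make `r + n t` a root for every natural `n` as soon as
`r` is one. -/
theorem taylor_ne_self [CharZero k] [IsAlgClosed k] {p : k[X]} (hp : 0 < p.natDegree) {t : k}
    (ht : t ≠ 0) : taylor t p ≠ p := by
  intro h
  have hp0 : p ≠ 0 := by rintro rfl; simp at hp
  obtain ⟨r, hr⟩ := IsAlgClosed.exists_root p (by
    rw [degree_eq_natDegree hp0]; exact_mod_cast hp.ne')
  have hroot (n : ℕ) : p.IsRoot (r + n * t) := by
    induction n with
    | zero => simpa using hr
    | succ n ih =>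
      have h1 : (taylor t p).eval (r + n * t) = p.eval (r + n * t + t) := taylor_eval t p _
      rw [h] at h1
      rw [IsRoot.def] at ih ⊢
      rw [← ih, h1]
      congr 1
      push_cast
      ring
  refine hp0 (eq_zero_of_infinite_isRoot p (Set.Infinite.mono (s := Set.range fun n : ℕ => r + n * t)
    ?_ (Set.infinite_range_of_injective fun a b hab => ?_)))
  · rintro _ ⟨n, rfl⟩
    exact hroot n
  · have h2 : (a : k) * t = b * t := add_left_cancel hab
    exact_mod_cast mul_right_cancel₀ ht h2

/-- The block is translation by `b / l` followed by multiplication by `l ^ 6`. Comparing leading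
coefficients forces `c = l ^ 6`, leaving a polynomial fixed by a nonzero translation. -/
theorem sextic_actBy_unipotent_ne [CharZero k] [IsAlgClosed k] {v : Fin 6 → Fin 2 → k}
    (hv : IsGeneral v) {l b c : k} (hl : l ≠ 0) (hb : b ≠ 0) :
    sextic (actBy v !![l, b; 0, l]) ≠ C c * sextic v := by
  intro h
  have hd : 0 < (sextic v).natDegree := by rcases hv.natDegree with h | h <;> omega
  have hM : (!![l, b; 0, l] : Matrix (Fin 2) (Fin 2) k) =
      !![1, b / l; 0, 1] * Matrix.diagonal ![l, l] := by
    ext i j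
    fin_cases i <;> fin_cases j <;> simp [hl]
  rw [hM, actBy_mul, sextic_actBy_diagonal _ _ (by simpa using hl), sextic_actBy_upper] at h
  simp only [Matrix.cons_val_zero, Matrix.cons_val_one, div_self hl, C_1, one_mul, comp_X] at h
  have hlc := congrArg leadingCoeff h
  rw [leadingCoeff_mul, leadingCoeff_mul, leadingCoeff_taylor, leadingCoeff_C, leadingCoeff_C] at hlc
  have hlc0 : (sextic v).leadingCoeff ≠ 0 := leadingCoeff_ne_zero.mpr hv.separable.ne_zero
  have hlc' := mul_right_cancel₀ hlc0 hlc
  rw [← hlc'] at h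
  have hl6 : (C (l ^ 6) : k[X]) ≠ 0 := by simpa using hl
  exact taylor_ne_self hd (div_ne_zero hb hl) (mul_left_cancel₀ hl6 h)

/-- A curve with extra automorphisms has a model with a diagonal automorphism. -/
theorem Curve.exists_diagonal_model [CharZero k] [IsAlgClosed k] (C : Curve k)
    (h : C.HasExtraAutomorphism) : ∃ (w : Fin 6 → Fin 2 → k) (l c : k), IsGeneral w ∧
      WeightedEquiv C.invariants (sexticInvariants (sextic w)) ∧ l ≠ 0 ∧ l ≠ 1 ∧
      ∀ i ≤ 6, l ^ i * (sextic w).coeff i = c * (sextic w).coeff i := by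
  obtain ⟨v, hv, hf⟩ := exists_sextic_eq C.natDegree_f C.separable_f
  obtain ⟨g, hg, hns, c, hc, hgc⟩ := C.exists_matrix_of_hasExtraAutomorphism h hv hf
  obtain ⟨M, n, hM, hgM, hn, hcases⟩ := exists_normal_matrix g hg hns
  have hconj := sextic_actBy_conj hM hgM hgc
  have hw := hv.actBy hM
  rcases hcases with ⟨d, hd, rfl⟩ | ⟨l, b, hb, rfl⟩
  · have hd1 : d 1 ≠ 0 := by
      rintro h1
      exact hn (by simp [Matrix.det_diagonal, Fin.prod_univ_two, h1])
    refine ⟨actBy v M, d 0 / d 1, c / d 1 ^ 6, hw, ?_, ?_, ?_, fun i hi => ?_⟩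
    · rw [C.invariants_eq, hf]
      exact (weightedEquiv_actBy hv hM).symm
    · refine div_ne_zero ?_ hd1
      rintro h0
      exact hn (by simp [Matrix.det_diagonal, Fin.prod_univ_two, h0])
    · rwa [Ne, div_eq_one_iff_eq hd1]
    · have h1 := coeff_sextic_actBy_diagonal (actBy v M) d hd1 hi
      rw [hconj, coeff_C_mul] at h1
      have : d 1 ^ 6 = d 1 ^ i * d 1 ^ (6 - i) := by rw [← pow_add, Nat.add_sub_cancel' hi]
      rw [div_pow]
      field_simp
      linear_combination d 0 ^ i * (sextic (actBy v M)).coeff i * this - d 1 ^ i * h1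
  · refine absurd hconj (sextic_actBy_unipotent_ne hw ?_ hb)
    rintro rfl
    exact hn (by simp [Matrix.det_fin_two])

end NormalForm

end GenusTwo

end

/-! ### The five normal forms -/

noncomputable section

namespace GenusTwo

section NormalForm

variable {k : Type} [Field k]

/-- Otherwise `X²` would divide a squarefree polynomial. -/
theorem IsGeneral.coeff_zero_or_one {v : Fin 6 → Fin 2 → k} (hv : IsGeneral v) :
    (sextic v).coeff 0 ≠ 0 ∨ (sextic v).coeff 1 ≠ 0 := by
  by_contra! h
  have h2 : (X : k[X]) ^ 2 ∣ sextic v := by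
    rw [X_pow_dvd_iff]
    intro d hd
    interval_cases d
    · exact h.1
    · exact h.2
  rw [pow_two] at h2
  exact not_isUnit_X (hv.separable.squarefree X h2)

theorem IsGeneral.coeff_five_or_six {v : Fin 6 → Fin 2 → k} (hv : IsGeneral v) :
    (sextic v).coeff 5 ≠ 0 ∨ (sextic v).coeff 6 ≠ 0 := by
  have h0 : (sextic v).leadingCoeff ≠ 0 := leadingCoeff_ne_zero.mpr hv.separable.ne_zero
  rw [leadingCoeff] at h0
  rcases hv.natDegree with h | h <;> rw [h] at h0
  · exact Or.inl h0
  · exact Or.inr h0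

/-- With `d ^ 6 = e`, the diagonal matrix with entries `t d` and `d` multiplies the `i`-th
coefficient by `(t d)ⁱ d⁶⁻ⁱ = e tⁱ`. -/
theorem exists_rescale [IsAlgClosed k] [CharZero k] {w : Fin 6 → Fin 2 → k} (hw : IsGeneral w)
    {t e : k} (ht : t ≠ 0) (he : e ≠ 0) : ∃ w' : Fin 6 → Fin 2 → k, IsGeneral w' ∧
      WeightedEquiv (sexticInvariants (sextic w)) (sexticInvariants (sextic w')) ∧
      ∀ i ≤ 6, (sextic w').coeff i = e * t ^ i * (sextic w).coeff i := by
  obtain ⟨d, hd⟩ := IsAlgClosed.exists_pow_nat_eq e (n := 6) (by norm_num)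
  have hd0 : d ≠ 0 := by
    rintro rfl
    exact he (by rw [← hd]; simp)
  have hM : (Matrix.diagonal ![t * d, d]).det ≠ 0 := by
    simp [Matrix.det_diagonal, Fin.prod_univ_two, ht, hd0]
  refine ⟨actBy w (Matrix.diagonal ![t * d, d]), hw.actBy hM, (weightedEquiv_actBy hw hM).symm,
    fun i hi => ?_⟩
  rw [coeff_sextic_actBy_diagonal w _ (by simpa using hd0) hi]
  simp only [Matrix.cons_val_zero, Matrix.cons_val_one]
  have : d ^ 6 = d ^ i * d ^ (6 - i) := by rw [← pow_add, Nat.add_sub_cancel' hi]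
  rw [← hd, this]
  ring

/-- The polynomials with a diagonal automorphism, up to rescaling. -/
def IsNormalForm (p : k[X]) : Prop :=
  (∃ a b, p = X ^ 6 + C a * X ^ 4 + C b * X ^ 2 + 1) ∨ (∃ a, p = X ^ 6 + C a * X ^ 3 + 1) ∨
    p = X ^ 5 + 1 ∨ p = X ^ 6 + X ∨ ∃ a, p = X ^ 5 + C a * X ^ 3 + X

theorem eq_of_coeff_le_six {p q : k[X]} (hp : p.natDegree ≤ 6) (hq : q.natDegree ≤ 6)
    (h0 : p.coeff 0 = q.coeff 0) (h1 : p.coeff 1 = q.coeff 1) (h2 : p.coeff 2 = q.coeff 2)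
    (h3 : p.coeff 3 = q.coeff 3) (h4 : p.coeff 4 = q.coeff 4) (h5 : p.coeff 5 = q.coeff 5)
    (h6 : p.coeff 6 = q.coeff 6) : p = q := by
  ext i
  by_cases hi : i ≤ 6
  · interval_cases i <;> assumption
  · rw [coeff_eq_zero_of_natDegree_lt (by omega), coeff_eq_zero_of_natDegree_lt (by omega)]

theorem isNormalForm_of_coeff {p : k[X]} (hp : p.natDegree ≤ 6)
    (h : (p.coeff 0 = 1 ∧ p.coeff 1 = 0 ∧ p.coeff 3 = 0 ∧ p.coeff 5 = 0 ∧ p.coeff 6 = 1) ∨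
      (p.coeff 0 = 1 ∧ p.coeff 1 = 0 ∧ p.coeff 2 = 0 ∧ p.coeff 4 = 0 ∧ p.coeff 5 = 0 ∧
        p.coeff 6 = 1) ∨
      (p.coeff 0 = 1 ∧ p.coeff 1 = 0 ∧ p.coeff 2 = 0 ∧ p.coeff 3 = 0 ∧ p.coeff 4 = 0 ∧
        p.coeff 5 = 1 ∧ p.coeff 6 = 0) ∨
      (p.coeff 0 = 0 ∧ p.coeff 1 = 1 ∧ p.coeff 2 = 0 ∧ p.coeff 3 = 0 ∧ p.coeff 4 = 0 ∧
        p.coeff 5 = 0 ∧ p.coeff 6 = 1) ∨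
      (p.coeff 0 = 0 ∧ p.coeff 1 = 1 ∧ p.coeff 2 = 0 ∧ p.coeff 4 = 0 ∧
        p.coeff 5 = 1 ∧ p.coeff 6 = 0)) : IsNormalForm p := by
  rcases h with h | h | h | h | h
  · refine Or.inl ⟨p.coeff 4, p.coeff 2,
      eq_of_coeff_le_six hp (by compute_degree) ?_ ?_ ?_ ?_ ?_ ?_ ?_⟩ <;>
      simp [h, coeff_one]
  · refine Or.inr (Or.inl ⟨p.coeff 3, eq_of_coeff_le_six hp (by compute_degree) ?_ ?_ ?_ ?_ ?_ ?_ ?_⟩) <;>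
      simp [h, coeff_one]
  · refine Or.inr (Or.inr (Or.inl (eq_of_coeff_le_six hp (by compute_degree!) ?_ ?_ ?_ ?_ ?_ ?_ ?_))) <;>
      simp [h, coeff_one]
  · refine Or.inr (Or.inr (Or.inr (Or.inl
      (eq_of_coeff_le_six hp (by compute_degree) ?_ ?_ ?_ ?_ ?_ ?_ ?_)))) <;>
      simp [h, coeff_X]
  · refine Or.inr (Or.inr (Or.inr (Or.inr ⟨p.coeff 3,
      eq_of_coeff_le_six hp (by compute_degree!) ?_ ?_ ?_ ?_ ?_ ?_ ?_⟩))) <;>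
      simp [h, coeff_X]

/-- All exponents `i` in the support satisfy `lⁱ = c`, and the support meets `{0, 1}` and `{5, 6}`.
Each choice of the two extreme exponents makes `l` a root of unity of order dividing 4, 5 or 6,
which eliminates most other exponents as `l ≠ 1`. Rescaling then makes the extreme coefficients
equal to 1. -/
theorem exists_isNormalForm [IsAlgClosed k] [CharZero k] {w : Fin 6 → Fin 2 → k}
    (hw : IsGeneral w) {l c : k} (hl0 : l ≠ 0) (hl : l ≠ 1)
    (h : ∀ i ≤ 6, l ^ i * (sextic w).coeff i = c * (sextic w).coeff i) :
    ∃ w' : Fin 6 → Fin 2 → k, IsGeneral w' ∧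
      WeightedEquiv (sexticInvariants (sextic w)) (sexticInvariants (sextic w')) ∧
      IsNormalForm (sextic w') := by
  have hc (i) (hi : i ≤ 6) (h0 : (sextic w).coeff i ≠ 0) : l ^ i = c :=
    mul_right_cancel₀ h0 (h i hi)
  have h0 := hc 0 (by norm_num)
  have h1 := hc 1 (by norm_num)
  have h2 := hc 2 (by norm_num)
  have h3 := hc 3 (by norm_num)
  have h4 := hc 4 (by norm_num)
  have h5 := hc 5 (by norm_num)
  have h6 := hc 6 (by norm_num)
  have finish {t e : k} (ht : t ≠ 0) (he : e ≠ 0)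
      (H : ∀ w', IsGeneral w' → (∀ i ≤ 6, (sextic w').coeff i = e * t ^ i * (sextic w).coeff i) →
        IsNormalForm (sextic w')) :
      ∃ w' : Fin 6 → Fin 2 → k, IsGeneral w' ∧
        WeightedEquiv (sexticInvariants (sextic w)) (sexticInvariants (sextic w')) ∧
        IsNormalForm (sextic w') := by
    obtain ⟨w', hw', hwe, hco⟩ := exists_rescale hw ht he
    exact ⟨w', hw', hwe, H w' hw' hco⟩
  have root {a b : k} (ha : a ≠ 0) (hb : b ≠ 0) {n : ℕ} (hn : 0 < n) :
      ∃ t : k, t ≠ 0 ∧ t ^ n * b = a := by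
    obtain ⟨t, ht⟩ := IsAlgClosed.exists_pow_nat_eq (a / b) hn
    refine ⟨t, ?_, by rw [ht]; field_simp⟩
    rintro rfl
    rw [zero_pow hn.ne', eq_comm, div_eq_zero_iff] at ht
    tauto
  have hdeg (w' : Fin 6 → Fin 2 → k) := sextic_natDegree_le w'
  have hinv : l * l⁻¹ = 1 := mul_inv_cancel₀ hl0
  rcases eq_or_ne ((sextic w).coeff 0) 0 with a0 | a0
  · have a1 : (sextic w).coeff 1 ≠ 0 := hw.coeff_zero_or_one.resolve_left (by simpa using a0)
    have c1 : c = l := by simpa using (h1 a1).symm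
    -- The lowest exponent is 1, so the scalar `c` is the multiplier itself and now stands for `l`.
    subst c1
    have a2 : (sextic w).coeff 2 = 0 := by
      by_contra ha
      have := h2 ha
      grind
    rcases eq_or_ne ((sextic w).coeff 6) 0 with a6 | a6
    · have a5 : (sextic w).coeff 5 ≠ 0 := hw.coeff_five_or_six.resolve_right (by simpa using a6)
      have e5 : c ^ 4 = 1 := mul_left_cancel₀ hl0 (by linear_combination h5 a5)
      have a4 : (sextic w).coeff 4 = 0 := by
        by_contra ha
        have e : c ^ 3 = 1 := mul_left_cancel₀ hl0 (by linear_combination h4 ha)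
        grind
      obtain ⟨t, ht, hta⟩ := root a1 a5 (n := 4) (by norm_num)
      refine finish ht (e := (t * (sextic w).coeff 1)⁻¹) (by positivity) fun w' _ H =>
        isNormalForm_of_coeff (hdeg w') (Or.inr (Or.inr (Or.inr (Or.inr ?_))))
      rw [H 0 (by norm_num), H 1 (by norm_num), H 2 (by norm_num), H 4 (by norm_num),
        H 5 (by norm_num), H 6 (by norm_num), a0, a2, a4, a6]
      refine ⟨by ring, by field_simp, by ring, by ring, ?_, by ring⟩
      field_simp
      exact hta
    · have e6 : c ^ 5 = 1 := mul_left_cancel₀ hl0 (by linear_combination h6 a6)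
      have a3 : (sextic w).coeff 3 = 0 := by
        by_contra ha
        have e : c ^ 2 = 1 := mul_left_cancel₀ hl0 (by linear_combination h3 ha)
        grind
      have a4 : (sextic w).coeff 4 = 0 := by
        by_contra ha
        have e : c ^ 3 = 1 := mul_left_cancel₀ hl0 (by linear_combination h4 ha)
        grind
      have a5 : (sextic w).coeff 5 = 0 := by
        by_contra ha
        have e : c ^ 4 = 1 := mul_left_cancel₀ hl0 (by linear_combination h5 ha)
        grind
      obtain ⟨t, ht, hta⟩ := root a1 a6 (n := 5) (by norm_num)
      refine finish ht (e := (t * (sextic w).coeff 1)⁻¹) (by positivity) fun w' _ H =>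
        isNormalForm_of_coeff (hdeg w') (Or.inr (Or.inr (Or.inr (Or.inl ?_))))
      rw [H 0 (by norm_num), H 1 (by norm_num), H 2 (by norm_num), H 3 (by norm_num),
        H 4 (by norm_num), H 5 (by norm_num), H 6 (by norm_num), a0, a2, a3, a4, a5]
      refine ⟨by ring, by field_simp, by ring, by ring, by ring, by ring, ?_⟩
      field_simp
      exact hta
  · have c1 : c = 1 := by simpa using (h0 a0).symm
    subst c1
    have a1 : (sextic w).coeff 1 = 0 := by
      by_contra ha
      have := h1 ha
      grind
    rcases eq_or_ne ((sextic w).coeff 6) 0 with a6 | a6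
    · have a5 : (sextic w).coeff 5 ≠ 0 := hw.coeff_five_or_six.resolve_right (by simpa using a6)
      have e5 := h5 a5
      have a2 : (sextic w).coeff 2 = 0 := by
        by_contra ha
        have e := h2 ha
        grind
      have a3 : (sextic w).coeff 3 = 0 := by
        by_contra ha
        have e := h3 ha
        grind
      have a4 : (sextic w).coeff 4 = 0 := by
        by_contra ha
        have e := h4 ha
        grind
      obtain ⟨t, ht, hta⟩ := root a0 a5 (n := 5) (by norm_num)
      refine finish ht (e := ((sextic w).coeff 0)⁻¹) (inv_ne_zero a0) fun w' _ H =>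
        isNormalForm_of_coeff (hdeg w') (Or.inr (Or.inr (Or.inl ?_)))
      rw [H 0 (by norm_num), H 1 (by norm_num), H 2 (by norm_num), H 3 (by norm_num),
        H 4 (by norm_num), H 5 (by norm_num), H 6 (by norm_num), a1, a2, a3, a4, a6]
      refine ⟨by field_simp, by ring, by ring, by ring, by ring, ?_, by ring⟩
      field_simp
      exact hta
    · have e6 := h6 a6
      have a5 : (sextic w).coeff 5 = 0 := by
        by_contra ha
        have e := h5 ha
        grind
      obtain ⟨t, ht, hta⟩ := root a0 a6 (n := 6) (by norm_num)
      refine finish ht (e := ((sextic w).coeff 0)⁻¹) (inv_ne_zero a0) fun w' _ H =>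
        isNormalForm_of_coeff (hdeg w') ?_
      -- Here `l⁶ = 1`. If `l² = 1`, only even exponents survive; otherwise exponents 2 and 4 are
      -- impossible and only 0, 3, 6 remain.
      by_cases hl2 : l ^ 2 = 1
      · have a3 : (sextic w).coeff 3 = 0 := by
          by_contra ha
          have e := h3 ha
          grind
        left
        rw [H 0 (by norm_num), H 1 (by norm_num), H 3 (by norm_num),
          H 5 (by norm_num), H 6 (by norm_num), a1, a3, a5]
        refine ⟨by field_simp, by ring, by ring, by ring, ?_⟩
        field_simp
        exact hta
      · have a2 : (sextic w).coeff 2 = 0 := by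
          by_contra ha
          exact hl2 (h2 ha)
        have a4 : (sextic w).coeff 4 = 0 := by
          by_contra ha
          have e := h4 ha
          exact hl2 (by linear_combination e6 - l ^ 2 * e)
        right; left
        rw [H 0 (by norm_num), H 1 (by norm_num), H 2 (by norm_num), H 4 (by norm_num),
          H 5 (by norm_num), H 6 (by norm_num), a1, a2, a4, a5]
        refine ⟨by field_simp, by ring, by ring, by ring, by ring, ?_⟩
        field_simp
        exact hta

theorem Curve.exists_normalForm [CharZero k] [IsAlgClosed k] (C : Curve k)
    (h : C.HasExtraAutomorphism) : ∃ p : k[X], IsNormalForm p ∧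
      WeightedEquiv C.invariants (sexticInvariants p) := by
  obtain ⟨w, l, c, hw, hwe, hl0, hl, hco⟩ := C.exists_diagonal_model h
  obtain ⟨w', -, hwe', hn⟩ := exists_isNormalForm hw hl0 hl hco
  exact ⟨_, hn, hwe.trans hwe'⟩

end NormalForm

end GenusTwo

end

/-! ### A hypersurface containing all points with extra automorphisms -/

noncomputable section

namespace GenusTwo

section Relation

/-- The coordinates `[J₂⁵ : J₄ J₂³ : J₆ J₂² : J₁₀]` over a commutative ring. -/
def ringProj {R : Type} [CommRing R] (q : Fin 4 → R) : Fin 4 → R :=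
  ![q 0 ^ 5, q 1 * q 0 ^ 3, q 2 * q 0 ^ 2, q 3]

theorem ringProj_map {R S : Type} [CommRing R] [CommRing S] (φ : R →+* S) (q : Fin 4 → R) (i) :
    ringProj (fun j => φ (q j)) i = φ (ringProj q i) := by
  fin_cases i <;> simp [ringProj]

theorem WeightedEquiv.exists_ringProj {k : Type} [Field k] {x y : Fin 4 → k}
    (h : WeightedEquiv x y) : ∃ r : k, ∀ i, ringProj x i = r * ringProj y i := by
  obtain ⟨r, hr⟩ := h
  refine ⟨(r : k) ^ 10, fun i => ?_⟩
  have h0 := hr 0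
  have h1 := hr 1
  have h2 := hr 2
  have h3 := hr 3
  simp only [weight, Matrix.cons_val] at h0 h1 h2 h3
  fin_cases i <;> simp [ringProj, h0, h1, h2, h3] <;> ring

/-- Monicity keeps the degree under specialisation, so the resultant defining the discriminant
commutes with the map. This allows working with generic parameters first. -/
theorem discr_map_of_monic {R k : Type} [CommRing R] [Field k] (φ : R →+* k) {p : R[X]}
    (hp : p.Monic) (h0 : 0 < p.natDegree) : (p.map φ).discr = φ p.discr := by
  have : Nontrivial R := φ.domain_nontrivial
  have hd : (p.map φ).natDegree = p.natDegree := hp.natDegree_map φ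
  have h1 := resultant_deriv (natDegree_pos_iff_degree_pos.mp h0)
  have h2 := resultant_deriv (natDegree_pos_iff_degree_pos.mp (hd ▸ h0))
  rw [hd, derivative_map, resultant_map_map, h1, (hp.map φ).leadingCoeff, hp.leadingCoeff] at h2
  simp only [mul_one, map_mul, map_pow, map_neg, map_one] at h2
  exact (mul_left_cancel₀ (pow_ne_zero _ (neg_ne_zero.mpr one_ne_zero)) h2).symm

/-- The invariants of a monic sextic or quintic over a commutative ring. -/
def monicInvariants {R : Type} [CommRing R] (p : R[X]) : Fin 4 → R :=
  ![ringJ2 p.coeff, ringJ4 p.coeff, ringJ6 p.coeff, p.discr]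

theorem sexticInvariants_map {R k : Type} [CommRing R] [Field k] (φ : R →+* k) {p : R[X]}
    (hp : p.Monic) (h0 : 0 < p.natDegree) :
    sexticInvariants (p.map φ) = fun i => φ (monicInvariants p i) := by
  have hc : (p.map φ).coeff = fun i => φ (p.coeff i) := by
    funext i
    simp
  have hd : sexticDiscr (p.map φ) = φ p.discr := by
    rw [← discr_map_of_monic φ hp h0, sexticDiscr, (hp.map φ).leadingCoeff]
    simp
  funext i
  fin_cases i
  · simp [sexticInvariants, monicInvariants, hc, ← ringJ2_eq, map_ringJ2]
  · simp [sexticInvariants, monicInvariants, hc, ← ringJ4_eq, map_ringJ4]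
  · simp [sexticInvariants, monicInvariants, hc, ← ringJ6_eq, map_ringJ6]
  · simp [sexticInvariants, monicInvariants, hd]

/-- The transcendence degree of a polynomial ring in `n` variables is `n`, so more than `n` of its
elements are dependent. -/
theorem exists_relation_of_card_lt {m n : ℕ} (h : n < m) (P : Fin m → MvPolynomial (Fin n) ℚ) :
    ∃ G : MvPolynomial (Fin m) ℚ, G ≠ 0 ∧ MvPolynomial.aeval P G = 0 := by
  by_contra! hG
  have hi : AlgebraicIndependent ℚ P := by
    rw [algebraicIndependent_iff]
    intro G h0
    by_contra hne
    exact hG G hne h0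
  have := hi.cardinalMk_le_trdeg
  rw [MvPolynomial.trdeg_of_isDomain] at this
  simp at this
  omega

/-- Variable 2 multiplies all coordinates, so that the relation holds on every representative of the
projective point. The families substituted for `p` involve only variables 0 and 1. -/
theorem exists_relation_of_monic {p : (MvPolynomial (Fin 3) ℚ)[X]} (hp : p.Monic)
    (h0 : 0 < p.natDegree) :
    ∃ G : MvPolynomial (Fin 4) ℚ, G ≠ 0 ∧ ∀ (s : Fin 3 → QBar) (x : Fin 4 → ℚ),
      (∀ i, algebraMap ℚ QBar (x i) = s 2 *
        ringProj (sexticInvariants (p.map (MvPolynomial.aeval s).toRingHom)) i) →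
      MvPolynomial.eval x G = 0 := by
  obtain ⟨G, hG, hG0⟩ := exists_relation_of_card_lt (by norm_num : 3 < 4)
    (fun i => MvPolynomial.X 2 * ringProj (monicInvariants p) i)
  refine ⟨G, hG, fun s x hx => ?_⟩
  have h1 := congrArg (MvPolynomial.aeval s) hG0
  rw [map_zero, ← AlgHom.comp_apply, MvPolynomial.comp_aeval] at h1
  have h2 : (fun i => (MvPolynomial.aeval s)
      (MvPolynomial.X 2 * ringProj (monicInvariants p) i)) = fun i => algebraMap ℚ QBar (x i) := by
    funext i
    rw [hx, sexticInvariants_map _ hp h0, ringProj_map, map_mul, MvPolynomial.aeval_X]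
    rfl
  rw [h2] at h1
  apply (algebraMap ℚ QBar).injective
  rw [map_zero, ← h1]
  exact MvPolynomial.eval₂_comp_left (algebraMap ℚ QBar) (RingHom.id ℚ) x G

/-- The moduli points of the curves with extra automorphisms, in the coordinates
`[J₂⁵ : J₄ J₂³ : J₆ J₂² : J₁₀]`, lie on a hypersurface. -/
theorem exists_relation_of_hasExtraAutomorphism :
    ∃ G : MvPolynomial (Fin 4) ℚ, G ≠ 0 ∧ ∀ C : Curve QBar, C.HasExtraAutomorphism →
      ∀ (s : QBar) (x : Fin 4 → ℚ),
        (∀ i, algebraMap ℚ QBar (x i) = s * ringProj C.invariants i) →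
        MvPolynomial.eval x G = 0 := by
  let Y (i : Fin 3) : (MvPolynomial (Fin 3) ℚ)[X] := C (MvPolynomial.X i)
  obtain ⟨G₁, h₁, H₁⟩ := exists_relation_of_monic
    (p := X ^ 6 + Y 0 * X ^ 4 + Y 1 * X ^ 2 + 1) (by unfold Y; monicity!)
    (lt_of_lt_of_eq (by norm_num) (by unfold Y; compute_degree! : _ = 6).symm)
  obtain ⟨G₂, h₂, H₂⟩ := exists_relation_of_monic
    (p := X ^ 6 + Y 0 * X ^ 3 + 1) (by unfold Y; monicity!)
    (lt_of_lt_of_eq (by norm_num) (by unfold Y; compute_degree! : _ = 6).symm)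
  obtain ⟨G₃, h₃, H₃⟩ := exists_relation_of_monic
    (p := X ^ 5 + 1) (by monicity!)
    (lt_of_lt_of_eq (by norm_num) (by compute_degree! : _ = 5).symm)
  obtain ⟨G₄, h₄, H₄⟩ := exists_relation_of_monic
    (p := X ^ 6 + X) (by monicity!)
    (lt_of_lt_of_eq (by norm_num) (by compute_degree! : _ = 6).symm)
  obtain ⟨G₅, h₅, H₅⟩ := exists_relation_of_monic
    (p := X ^ 5 + Y 0 * X ^ 3 + X) (by unfold Y; monicity!)
    (lt_of_lt_of_eq (by norm_num) (by unfold Y; compute_degree! : _ = 5).symm)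
  refine ⟨G₁ * G₂ * G₃ * G₄ * G₅, by simp [h₁, h₂, h₃, h₄, h₅], fun C hC s x hx => ?_⟩
  obtain ⟨p, hp, hw⟩ := C.exists_normalForm hC
  obtain ⟨r, hr⟩ := hw.exists_ringProj
  have hx' : ∀ i, algebraMap ℚ QBar (x i) = (s * r) * ringProj (sexticInvariants p) i := by
    intro i
    rw [hx, hr, mul_assoc]
  simp only [map_mul, mul_eq_zero]
  rcases hp with ⟨a, b, rfl⟩ | ⟨a, rfl⟩ | rfl | rfl | ⟨a, rfl⟩
  · have := H₁ ![a, b, s * r] x (by simpa [Y] using hx')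
    tauto
  · have := H₂ ![a, 0, s * r] x (by simpa [Y] using hx')
    tauto
  · have := H₃ ![0, 0, s * r] x (by simpa [Y] using hx')
    tauto
  · have := H₄ ![0, 0, s * r] x (by simpa [Y] using hx')
    tauto
  · have := H₅ ![a, 0, s * r] x (by simpa [Y] using hx')
    tauto

end Relation

end GenusTwo

end

/-! ### Algebraic independence and dominant polynomial maps -/

noncomputable section

namespace GenusTwo

section Dominance

theorem pderiv_aeval {n : ℕ} (P : Fin n → MvPolynomial (Fin n) ℚ) (G : MvPolynomial (Fin n) ℚ)
    (j : Fin n) :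
    MvPolynomial.pderiv j (MvPolynomial.aeval P G) =
      ∑ i, MvPolynomial.aeval P (MvPolynomial.pderiv i G) * MvPolynomial.pderiv j (P i) := by
  induction G using MvPolynomial.induction_on with
  | C a => simp
  | add p q hp hq => simp only [map_add, hp, hq, add_mul, Finset.sum_add_distrib]
  | mul_X p m h =>
    simp only [map_mul, MvPolynomial.aeval_X, Derivation.leibniz, h, smul_eq_mul, map_add,
      MvPolynomial.pderiv_X, add_mul, Finset.sum_add_distrib, Finset.mul_sum]
    congr 1
    · rw [Finset.sum_eq_single m]
      · simp
      · intro b _ hb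
        simp [hb.symm]
      · simp
    · exact Finset.sum_congr rfl fun i _ => by ring

theorem totalDegree_pderiv_lt {n : ℕ} (G : MvPolynomial (Fin n) ℚ) (i : Fin n)
    (h : MvPolynomial.pderiv i G ≠ 0) :
    (MvPolynomial.pderiv i G).totalDegree < G.totalDegree := by
  obtain ⟨m, hm⟩ : (MvPolynomial.pderiv i G).support.Nonempty := by
    rwa [MvPolynomial.support_nonempty]
  have hpos : ∀ m ∈ (MvPolynomial.pderiv i G).support,
      (m.sum fun _ e => e) < G.totalDegree := by
    intro m hm
    have hc : MvPolynomial.coeff m (MvPolynomial.pderiv i G) ≠ 0 := MvPolynomial.mem_support_iff.mp hm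
    rw [MvPolynomial.coeff_pderiv] at hc
    have := MvPolynomial.le_totalDegree (MvPolynomial.mem_support_iff.mpr (left_ne_zero_of_mul hc))
    rw [Finsupp.sum_add_index' (by simp) (by simp), Finsupp.sum_single_index rfl] at this
    omega
  rw [MvPolynomial.totalDegree, Finset.sup_lt_iff (lt_of_le_of_lt (Nat.zero_le _) (hpos m hm))]
  exact hpos

theorem eq_C_of_pderiv_eq_zero {n : ℕ} {G : MvPolynomial (Fin n) ℚ}
    (h : ∀ i, MvPolynomial.pderiv i G = 0) : G = MvPolynomial.C (MvPolynomial.coeff 0 G) := by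
  ext m
  rw [MvPolynomial.coeff_C]
  split_ifs with hm
  · rw [hm]
  · obtain ⟨i, hi⟩ := Finsupp.ne_iff.mp (Ne.symm hm)
    have := congrArg (MvPolynomial.coeff (m - Finsupp.single i 1)) (h i)
    rw [MvPolynomial.coeff_pderiv, MvPolynomial.coeff_zero, tsub_add_cancel_of_le] at this
    · rcases mul_eq_zero.mp this with h | h
      · exact h
      · norm_cast at h
    · rw [Finsupp.single_le_iff]
      exact Nat.one_le_iff_ne_zero.mpr hi

/-- The Jacobian criterion for algebraic independence in characteristic zero. -/
theorem algebraicIndependent_of_det_ne_zero {n : ℕ} (P : Fin n → MvPolynomial (Fin n) ℚ)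
    (h : (Matrix.of fun i j => MvPolynomial.pderiv j (P i)).det ≠ 0) :
    AlgebraicIndependent ℚ P := by
  rw [algebraicIndependent_iff]
  intro G
  induction hd : G.totalDegree using Nat.strong_induction_on generalizing G with
  | _ d ih =>
    intro hG
    -- Differentiating `G(P) = 0` by the chain rule gives `(∇G)(P) · Jac = 0`. As the Jacobian is
    -- nonsingular, the partial derivatives of `G` are again relations, of smaller degree unless
    -- they vanish.
    have hz : ∀ i, MvPolynomial.aeval P (MvPolynomial.pderiv i G) = 0 := by
      have := Matrix.eq_zero_of_vecMul_eq_zero h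
        (v := fun i => MvPolynomial.aeval P (MvPolynomial.pderiv i G)) (by
          funext j
          simp only [Matrix.vecMul, dotProduct, Matrix.of_apply, Pi.zero_apply]
          rw [← pderiv_aeval, hG, map_zero])
      exact fun i => congrFun this i
    have h0 : ∀ i, MvPolynomial.pderiv i G = 0 := by
      intro i
      by_contra hne
      exact hne (ih _ (hd ▸ totalDegree_pderiv_lt G i hne) _ rfl (hz i))
    rw [eq_C_of_pderiv_eq_zero h0] at hG ⊢
    simpa using hG

section Extension

variable {A B : Type} [CommRing A] [IsDomain A] [CommRing B] [Algebra A B]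

/-- One `a` makes each of the finitely many generators integral; sums and products then need only
higher powers of `a`. -/
theorem exists_forall_pow_smul_isIntegral [Algebra.IsAlgebraic A B] [Algebra.FiniteType A B] :
    ∃ a : A, a ≠ 0 ∧ ∀ b : B, ∃ n : ℕ, IsIntegral A (a ^ n • b) := by
  obtain ⟨s, hs⟩ := Algebra.FiniteType.out (R := A) (A := B)
  obtain ⟨a, ha, has⟩ := Algebra.IsAlgebraic.exists_integral_multiples A s
  refine ⟨a, ha, fun b => ?_⟩
  have hb : b ∈ Algebra.adjoin A (s : Set B) := hs ▸ Algebra.mem_top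
  induction hb using Algebra.adjoin_induction with
  | mem x hx => exact ⟨1, by simpa using has x hx⟩
  | algebraMap r => exact ⟨0, by simpa using isIntegral_algebraMap⟩
  | add x y _ _ hx hy =>
    obtain ⟨n, hn⟩ := hx
    obtain ⟨m, hm⟩ := hy
    refine ⟨n + m, ?_⟩
    have : a ^ (n + m) • (x + y) = a ^ m • a ^ n • x + a ^ n • a ^ m • y := by
      rw [smul_add, smul_smul, smul_smul, ← pow_add, ← pow_add, add_comm m n]
    rw [this]
    exact (hn.smul _).add (hm.smul _)
  | mul x y _ _ hx hy =>
    obtain ⟨n, hn⟩ := hx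
    obtain ⟨m, hm⟩ := hy
    refine ⟨n + m, ?_⟩
    rw [pow_add, mul_smul_mul_comm]
    exact hn.mul hm

/-- This is the generic surjectivity of a dominant map. Lying over holds for the integral closure of
`A` in `B`; if the extension of `m` to `B` contained 1, a power of `a` would lie in the prime over
`m`, hence in `m`. -/
theorem exists_forall_map_ne_top [FaithfulSMul A B] [Algebra.IsAlgebraic A B]
    [Algebra.FiniteType A B] :
    ∃ a : A, a ≠ 0 ∧ ∀ m : Ideal A, m.IsPrime → a ∉ m → m.map (algebraMap A B) ≠ ⊤ := by
  obtain ⟨a, ha, hint⟩ := exists_forall_pow_smul_isIntegral (A := A) (B := B)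
  refine ⟨a, ha, fun m hm ham htop => ham ?_⟩
  have hinj : Function.Injective (algebraMap A B) := FaithfulSMul.algebraMap_injective A B
  let S := integralClosure A B
  obtain ⟨Q, -, hQ, hQm⟩ := Ideal.exists_ideal_over_prime_of_isIntegral (S := S) m ⊥ (by
    intro x hx
    have : algebraMap A S x = 0 := hx
    have h2 : algebraMap A B x = 0 := by
      rw [IsScalarTower.algebraMap_apply A S B, this, map_zero]
    rw [(map_eq_zero_iff _ hinj).mp h2]
    exact zero_mem m)
  have key : ∀ b ∈ m.map (algebraMap A B), ∃ n : ℕ, ∃ q ∈ Q, a ^ n • b = (q : B) := by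
    intro b hb
    induction hb using Submodule.span_induction with
    | mem x hx =>
      obtain ⟨y, hy, rfl⟩ := hx
      refine ⟨0, algebraMap A S y, ?_, by simp⟩
      rw [← hQm] at hy
      exact hy
    | zero => exact ⟨0, 0, zero_mem _, by simp⟩
    | add x y _ _ hx hy =>
      obtain ⟨n, p, hp, hn⟩ := hx
      obtain ⟨k, q, hq, hk⟩ := hy
      refine ⟨n + k, a ^ k • p + a ^ n • q, ?_, ?_⟩
      · exact add_mem (Submodule.smul_of_tower_mem Q _ hp) (Submodule.smul_of_tower_mem Q _ hq)
      · push_cast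
        rw [← hn, ← hk, smul_smul, smul_smul, smul_add, pow_add, mul_comm (a ^ k)]
    | smul c x _ hx =>
      obtain ⟨n, p, hp, hn⟩ := hx
      obtain ⟨k, hk⟩ := hint c
      refine ⟨k + n, (⟨a ^ k • c, hk⟩ : S) * p, Q.mul_mem_left _ hp, ?_⟩
      rw [pow_add, smul_eq_mul, mul_smul_mul_comm, hn]
      rfl
  obtain ⟨n, q, hq, hn⟩ := key 1 (by rw [htop]; trivial)
  have : algebraMap A S (a ^ n) = q := by
    apply Subtype.ext
    rw [← hn, Algebra.smul_def, mul_one]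
    rfl
  rw [← this] at hq
  have : a ^ n ∈ m := by
    rw [← hQm]
    exact hq
  exact hm.mem_of_pow_mem n this

/-- By the Nullstellensatz, the quotient by a maximal ideal containing `I` is a finite extension of
`ℚ`, so it embeds in `QBar`. -/
theorem exists_algHom_qbar [Algebra ℚ B] [Algebra.FiniteType ℚ B] {I : Ideal B} (hI : I ≠ ⊤) :
    ∃ ψ : B →ₐ[ℚ] QBar, ∀ b ∈ I, ψ b = 0 := by
  obtain ⟨M, hM, hIM⟩ := Ideal.exists_le_maximal I hI
  let _ : Field (B ⧸ M) := Ideal.Quotient.field M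
  have : Module.Finite ℚ (B ⧸ M) := finite_of_finite_type_of_isJacobsonRing ℚ (B ⧸ M)
  refine ⟨(IsAlgClosed.lift (R := ℚ) (S := B ⧸ M) (M := QBar)).comp (Ideal.Quotient.mkₐ ℚ M),
    fun b hb => ?_⟩
  have : Ideal.Quotient.mkₐ ℚ M b = 0 := Ideal.Quotient.eq_zero_iff_mem.mpr (hIM hb)
  rw [AlgHom.comp_apply, this, map_zero]

end Extension

/-- Algebraically independent polynomials define a dominant map: the generic rational point is the
image of an algebraic point. -/
theorem exists_aeval_eq_of_algebraicIndependent {n : ℕ} {P : Fin n → MvPolynomial (Fin n) ℚ}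
    (hP : AlgebraicIndependent ℚ P) :
    ∃ G : MvPolynomial (Fin n) ℚ, G ≠ 0 ∧ ∀ x : Fin n → ℚ, MvPolynomial.eval x G ≠ 0 →
      ∃ s : Fin n → QBar, ∀ i, MvPolynomial.aeval s (P i) = algebraMap ℚ QBar (x i) := by
  have hb : IsTranscendenceBasis ℚ P := hP.isTranscendenceBasis_of_trdeg_le_of_finite (by
    rw [MvPolynomial.trdeg_of_isDomain]
    simp)
  have := hb.isAlgebraic
  have : Algebra.FiniteType (Algebra.adjoin ℚ (Set.range P)) (MvPolynomial (Fin n) ℚ) :=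
    Algebra.FiniteType.of_restrictScalars_finiteType ℚ _ _
  obtain ⟨a, ha, H⟩ := exists_forall_map_ne_top (A := Algebra.adjoin ℚ (Set.range P))
    (B := MvPolynomial (Fin n) ℚ)
  refine ⟨hP.aevalEquiv.symm a, by simpa using ha, fun x hx => ?_⟩
  -- By independence, `P i ↦ x i` defines a rational point of the image ring. Its kernel avoids `a`
  -- exactly when `G(x) ≠ 0`, and a point of the extended ideal is a preimage of `x`.
  let φ : Algebra.adjoin ℚ (Set.range P) →ₐ[ℚ] ℚ :=
    (MvPolynomial.aeval x).comp hP.aevalEquiv.symm.toAlgHom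
  obtain ⟨ψ, hψ⟩ := exists_algHom_qbar (H (RingHom.ker φ) (RingHom.ker_isPrime φ) (by
    rw [RingHom.mem_ker]
    exact hx))
  refine ⟨fun i => ψ (MvPolynomial.X i), fun i => ?_⟩
  have hψX : MvPolynomial.aeval (fun i => ψ (MvPolynomial.X i)) = ψ :=
    (MvPolynomial.aeval_unique ψ).symm
  rw [hψX]
  have hφ : φ ⟨P i, Algebra.subset_adjoin ⟨i, rfl⟩⟩ = x i := by
    have : (⟨P i, Algebra.subset_adjoin ⟨i, rfl⟩⟩ : Algebra.adjoin ℚ (Set.range P)) =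
        hP.aevalEquiv (MvPolynomial.X i) := by
      apply Subtype.ext
      simp
    rw [this]
    simp [φ]
  have hk : (⟨P i, Algebra.subset_adjoin ⟨i, rfl⟩⟩ : Algebra.adjoin ℚ (Set.range P)) -
      algebraMap ℚ _ (x i) ∈ RingHom.ker φ := by
    rw [RingHom.mem_ker, map_sub, hφ, AlgHom.commutes]
    simp
  have := hψ _ (Ideal.mem_map_of_mem _ hk)
  rw [map_sub, map_sub] at this
  have h2 := sub_eq_zero.mp this
  rw [← AlgHom.commutes ψ]
  exact h2

end Dominance

end GenusTwo

end

/-! ### The four-parameter family of quintics and its Jacobian at a point -/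

noncomputable section

namespace GenusTwo

section Family

variable {R : Type} [CommRing R]

/-- The coefficients of the quintic `w₀ x (x - 1) (x - w₁) (x - w₂) (x - w₃)`. -/
def familyCoeff (w : Fin 4 → R) : ℕ → R
  | 1 => w 0 * (w 1 * w 2 * w 3)
  | 2 => -(w 0 * (w 1 * w 2 + w 1 * w 3 + w 2 * w 3 + w 1 * w 2 * w 3))
  | 3 => w 0 * (w 1 + w 2 + w 3 + w 1 * w 2 + w 1 * w 3 + w 2 * w 3)
  | 4 => -(w 0 * (1 + w 1 + w 2 + w 3))
  | 5 => w 0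
  | _ => 0

/-- The discriminant of the quintic `w₀ x (x - 1) (x - w₁) (x - w₂) (x - w₃)`, regarded as a
binary sextic. -/
def familyDiscr (w : Fin 4 → R) : R :=
  w 0 ^ 10 * (w 1 * w 2 * w 3 * (w 1 - 1) * (w 2 - 1) * (w 3 - 1) * (w 1 - w 2) * (w 1 - w 3) *
    (w 2 - w 3)) ^ 2

/-- The invariants of the quintic `w₀ x (x - 1) (x - w₁) (x - w₂) (x - w₃)`. -/
def familyInvariants (w : Fin 4 → R) : Fin 4 → R :=
  ![ringJ2 (familyCoeff w), ringJ4 (familyCoeff w), ringJ6 (familyCoeff w), familyDiscr w]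

theorem familyCoeff_map {S : Type} [CommRing S] (φ : R →+* S) (w : Fin 4 → R) (i : ℕ) :
    φ (familyCoeff w i) = familyCoeff (fun j => φ (w j)) i := by
  unfold familyCoeff
  split <;> simp

theorem familyInvariants_map {S : Type} [CommRing S] (φ : R →+* S) (w : Fin 4 → R) (i) :
    φ (familyInvariants w i) = familyInvariants (fun j => φ (w j)) i := by
  fin_cases i
  · simp [familyInvariants, map_ringJ2, familyCoeff_map]
  · simp [familyInvariants, map_ringJ4, familyCoeff_map]
  · simp [familyInvariants, map_ringJ6, familyCoeff_map]
  · simp [familyInvariants, familyDiscr]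

/-- The roots of the quintic `w₀ x (x - 1) (x - w₁) (x - w₂) (x - w₃)` on the projective line. -/
def familyRoots (w : Fin 4 → R) : Fin 6 → Fin 2 → R :=
  ![![0, w 0], ![1, 0], ![1, -1], ![1, -w 1], ![1, -w 2], ![1, -w 3]]

variable {k : Type} [Field k]

/-- The sign cancels the one in `sexticDiscr_sextic`. Nonvanishing of the right side also gives the
pairwise independence of the six linear forms. -/
theorem prod_bracket_familyRoots (w : Fin 4 → k) :
    ∏ i, ∏ j ∈ Finset.univ.erase i, bracket (familyRoots w i) (familyRoots w j) =
      -familyDiscr w := by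
  have : ∀ i, ∏ j ∈ Finset.univ.erase i, bracket (familyRoots w i) (familyRoots w j) =
      ∏ j, if j = i then 1 else bracket (familyRoots w i) (familyRoots w j) := by
    intro i
    rw [← Finset.mul_prod_erase Finset.univ _ (Finset.mem_univ i), if_pos rfl, one_mul]
    exact Finset.prod_congr rfl fun j hj => by rw [if_neg (Finset.ne_of_mem_erase hj)]
  simp only [this]
  simp [Fin.prod_univ_succ, bracket, familyRoots, familyDiscr]
  ring

theorem isGeneral_familyRoots {w : Fin 4 → k} (h : familyDiscr w ≠ 0) :
    IsGeneral (familyRoots w) := by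
  intro i j hij
  rw [← neg_ne_zero, ← prod_bracket_familyRoots, Finset.prod_ne_zero_iff] at h
  exact Finset.prod_ne_zero_iff.mp (h i (Finset.mem_univ i)) j
    (Finset.mem_erase.mpr ⟨hij.symm, Finset.mem_univ j⟩)

theorem sextic_familyRoots (w : Fin 4 → k) :
    sextic (familyRoots w) = C (w 0) * (X * (X - 1) * (X - C (w 1)) * (X - C (w 2)) *
      (X - C (w 3))) := by
  simp [sextic, familyRoots, Fin.prod_univ_succ, linForm]
  left
  ring

theorem coeff_sextic_familyRoots (w : Fin 4 → k) :
    (sextic (familyRoots w)).coeff = familyCoeff w := by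
  have : sextic (familyRoots w) = C (familyCoeff w 5) * X ^ 5 + C (familyCoeff w 4) * X ^ 4 +
      C (familyCoeff w 3) * X ^ 3 + C (familyCoeff w 2) * X ^ 2 + C (familyCoeff w 1) * X ^ 1 := by
    rw [sextic_familyRoots]
    simp [familyCoeff]
    ring
  rw [this]
  funext i
  simp only [coeff_add, coeff_C_mul_X_pow]
  rcases i with _ | _ | _ | _ | _ | _ | i <;> simp [familyCoeff]

theorem sexticInvariants_familyRoots {w : Fin 4 → k} (h : familyDiscr w ≠ 0) :
    sexticInvariants (sextic (familyRoots w)) = familyInvariants w := by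
  have hd : sexticDiscr (sextic (familyRoots w)) = familyDiscr w := by
    rw [sexticDiscr_sextic (isGeneral_familyRoots h), prod_bracket_familyRoots, neg_neg]
  rw [sexticInvariants, hd, coeff_sextic_familyRoots]
  rfl

theorem exists_curve_of_familyDiscr_ne_zero {w : Fin 4 → k} (h : familyDiscr w ≠ 0) :
    ∃ C : Curve k, C.invariants = familyInvariants w :=
  ⟨⟨sextic (familyRoots w), (isGeneral_familyRoots h).natDegree,
    (isGeneral_familyRoots h).separable⟩, by
    rw [Curve.invariants_eq, sexticInvariants_familyRoots h]⟩

section Jacobian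

open MvPolynomial (pderiv eval)

/-- A point at which the Jacobian matrix of the family of quintics is regular. -/
def basePoint : Fin 4 → ℚ := ![1, -1, 2, -3]

theorem familyCoeff_basePoint : familyCoeff basePoint 0 = 0 ∧ familyCoeff basePoint 1 = 6 ∧
    familyCoeff basePoint 2 = -1 ∧ familyCoeff basePoint 3 = -7 ∧ familyCoeff basePoint 4 = 1 ∧
    familyCoeff basePoint 5 = 1 ∧ familyCoeff basePoint 6 = 0 := by
  simp only [familyCoeff, basePoint, Matrix.cons_val]
  norm_num

theorem eval_familyInvariants (i) :
    eval basePoint (familyInvariants MvPolynomial.X i) = ![550, 8272, 1399200, 2073600] i := by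
  obtain ⟨h0, h1, h2, h3, h4, h5, h6⟩ := familyCoeff_basePoint
  rw [familyInvariants_map]
  simp only [MvPolynomial.eval_X]
  fin_cases i
  · simp only [familyInvariants, Fin.zero_eta, Matrix.cons_val, ringJ2, h0, h1, h2, h3, h4, h5, h6]
    norm_num
  · simp only [familyInvariants, Fin.mk_one, Matrix.cons_val, ringJ4, h0, h1, h2, h3, h4, h5, h6]
    norm_num
  · simp only [familyInvariants, Fin.reduceFinMk, Matrix.cons_val, ringJ6, h0, h1, h2, h3, h4, h5,
      h6]
    norm_num
  · simp only [familyInvariants, Fin.reduceFinMk, Matrix.cons_val, familyDiscr, basePoint]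
    norm_num

theorem eval_familyCoeff (i) :
    eval basePoint (familyCoeff MvPolynomial.X i) = familyCoeff basePoint i := by
  rw [familyCoeff_map]
  simp

theorem eval_pderiv_familyCoeff (i : ℕ) (j : Fin 4) :
    eval basePoint (pderiv j (familyCoeff MvPolynomial.X i)) =
      ![familyCoeff basePoint, fun i => [0, -6, 7, 0, -1, 0].getD i 0,
        fun i => [0, 3, 1, -3, -1, 0].getD i 0, fun i => [0, -2, 1, 2, -1, 0].getD i 0] j i := by
  rcases i with _ | _ | _ | _ | _ | _ | i <;> fin_cases j <;>
    simp [familyCoeff, basePoint, MvPolynomial.pderiv_X] <;> norm_num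

theorem eval_pderiv_familyDiscr (j) :
    eval basePoint (pderiv j (familyDiscr MvPolynomial.X)) =
      ![20736000, -5529600, 8432640, -5322240] j := by
  fin_cases j <;>
    simp [familyDiscr, basePoint, MvPolynomial.pderiv_X, Derivation.leibniz_pow,
      Derivation.leibniz] <;> norm_num

/-- Row `i` is the gradient at the base point of the `i`-th of `J₂, J₄, J₆, J₁₀`. With the values in
`eval_familyInvariants`, the product rule yields the Jacobian of the projective coordinates. -/
theorem eval_pderiv_familyInvariants (i j) :
    eval basePoint (pderiv j (familyInvariants MvPolynomial.X i)) =
      !![1100, -368, 340, -280;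
        33088, -7360, 10832, -9128;
        8395200, -2326080, 2705760, -2215920;
        20736000, -5529600, 8432640, -5322240] i j := by
  obtain ⟨h0, h1, h2, h3, h4, h5, h6⟩ := familyCoeff_basePoint
  have hd := fun i => eval_pderiv_familyCoeff i j
  fin_cases i
  · simp only [familyInvariants, Fin.zero_eta, Matrix.cons_val, ringJ2, map_add, map_sub, map_mul,
      map_pow, map_ofNat, Derivation.leibniz, Derivation.leibniz_pow, derivation_ofNat, smul_eq_mul,
      nsmul_eq_mul, map_natCast, map_zero, eval_familyCoeff, hd]
    fin_cases j <;> simp [h0, h1, h2, h3, h4, h5, h6] <;> norm_num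
  · simp only [familyInvariants, Fin.mk_one, Matrix.cons_val, ringJ4, map_add, map_sub, map_mul,
      map_pow, map_ofNat, Derivation.leibniz, Derivation.leibniz_pow, derivation_ofNat, smul_eq_mul,
      nsmul_eq_mul, map_natCast, map_zero, eval_familyCoeff, hd]
    fin_cases j <;> simp [h0, h1, h2, h3, h4, h5, h6] <;> norm_num
  · simp only [familyInvariants, Fin.reduceFinMk, Matrix.cons_val, ringJ6, map_add, map_sub,
      map_mul, map_pow, map_ofNat, Derivation.leibniz, Derivation.leibniz_pow, derivation_ofNat,
      smul_eq_mul, nsmul_eq_mul, map_natCast, map_zero, eval_familyCoeff, hd]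
    fin_cases j <;> simp [h0, h1, h2, h3, h4, h5, h6] <;> norm_num
  · exact eval_pderiv_familyDiscr j

end Jacobian

end Family

end GenusTwo

end

/-! ### A generic rational vector comes from a curve -/

noncomputable section

namespace GenusTwo

section Generic

open MvPolynomial (pderiv eval)

/-- The Jacobian determinant is a nonzero polynomial because its value at the base point is nonzero.
The scale `w₀` is kept as a parameter so that four variables map to four coordinates. -/
theorem algebraicIndependent_ringProj_familyInvariants :
    AlgebraicIndependent ℚ
      (ringProj (familyInvariants (MvPolynomial.X : Fin 4 → MvPolynomial (Fin 4) ℚ))) := by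
  apply algebraicIndependent_of_det_ne_zero
  intro h
  have h' := congrArg (MvPolynomial.eval basePoint) h
  rw [RingHom.map_det, map_zero] at h'
  have hM : (MvPolynomial.eval basePoint).mapMatrix (Matrix.of fun i j =>
      pderiv j (ringProj (familyInvariants MvPolynomial.X) i)) =
      !![503284375000000, -168371500000000, 155560625000000, -128108750000000;
        13762540000000, -3987037120000, 4354499600000, -3620586200000;
        4232580000000, -1270035360000, 1341793200000, -1101269400000;
        20736000, -5529600, 8432640, -5322240] := by
    ext i j
    rw [RingHom.mapMatrix_apply, Matrix.map_apply, Matrix.of_apply]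
    fin_cases i <;>
      simp only [ringProj, Fin.zero_eta, Fin.mk_one, Fin.reduceFinMk, Matrix.cons_val, map_add,
        map_mul, map_pow, Derivation.leibniz, Derivation.leibniz_pow, smul_eq_mul, nsmul_eq_mul,
        map_natCast, eval_pderiv_familyInvariants, eval_familyInvariants] <;>
      fin_cases j <;> simp <;> norm_num
  rw [hM] at h'
  simp [Matrix.det_succ_row_zero, Fin.sum_univ_succ, Fin.succAbove] at h'
  norm_num at h'

/-- Every generic rational vector has the form `(J₂⁵, J₄ J₂³, J₆ J₂², J₁₀)` for a genus 2 curve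
over the algebraic numbers. -/
theorem exists_curve_of_eval_ne_zero :
    ∃ G : MvPolynomial (Fin 4) ℚ, G ≠ 0 ∧ ∀ x : Fin 4 → ℚ, MvPolynomial.eval x G ≠ 0 →
      ∃ C : Curve QBar, ∀ i, algebraMap ℚ QBar (x i) = ringProj C.invariants i := by
  obtain ⟨G, hG, H⟩ :=
    exists_aeval_eq_of_algebraicIndependent algebraicIndependent_ringProj_familyInvariants
  -- The factor `X 3` excludes `J₁₀ = 0`, so that the parameters found define a separable quintic.
  refine ⟨G * MvPolynomial.X 3, mul_ne_zero hG (MvPolynomial.X_ne_zero 3), fun x hx => ?_⟩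
  rw [map_mul, MvPolynomial.eval_X] at hx
  obtain ⟨s, hs⟩ := H x (left_ne_zero_of_mul hx)
  have hs' : ∀ i, ringProj (familyInvariants s) i = algebraMap ℚ QBar (x i) := by
    intro i
    rw [← hs]
    have := ringProj_map (MvPolynomial.aeval s : MvPolynomial (Fin 4) ℚ →ₐ[ℚ] QBar).toRingHom
      (familyInvariants MvPolynomial.X) i
    simp only [familyInvariants_map] at this
    simpa using this
  obtain ⟨C, hC⟩ := exists_curve_of_familyDiscr_ne_zero (w := s) (by
    have := hs' 3
    intro h0
    simp only [ringProj, familyInvariants, Matrix.cons_val, h0] at this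
    exact right_ne_zero_of_mul hx ((map_eq_zero _).mp this.symm))
  exact ⟨C, fun i => by rw [hC, hs']⟩

end Generic

end GenusTwo

end

/-! ### Rational points as primitive integer vectors -/

noncomputable section

namespace GenusTwo

section Points

/-- The point of the weighted projective space with `[J₂⁵ : J₄ J₂³ : J₆ J₂² : J₁₀] = x` and
`J₂ = 1`. -/
def point (x : Fin 4 → ℚ) : WPQ :=
  Quotient.mk _ ⟨![1, x 1 / x 0, x 2 / x 0, x 3 / x 0], fun h => by simpa using congrFun h 0⟩

theorem ringProj_dehomogenize {k : Type} [Field k] {x : Fin 4 → k} (h : x 0 ≠ 0) (i : Fin 4) :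
    ringProj ![1, x 1 / x 0, x 2 / x 0, x 3 / x 0] i = (x 0)⁻¹ * x i := by
  fin_cases i <;> simp [ringProj, h, div_eq_inv_mul]

theorem moduliHeight_point {x : Fin 4 → ℚ} (h : x 0 ≠ 0) :
    moduliHeight (point x) = Height.mulHeight x := by
  rw [← Height.mulHeight_smul_eq_mulHeight x (inv_ne_zero h)]
  change Height.mulHeight (projCoords _) = _
  congr 1
  funext i
  exact ringProj_dehomogenize h i

theorem point_smul {c : ℚ} (hc : c ≠ 0) (x : Fin 4 → ℚ) : point (c • x) = point x := by
  unfold point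
  congr 2
  simp only [Pi.smul_apply, smul_eq_mul, mul_div_mul_left _ _ hc]

theorem exists_pow_two_eq (a : QBar) (ha : a ≠ 0) : ∃ r : QBarˣ, (r : QBar) ^ 2 = a := by
  obtain ⟨r, hr⟩ := IsAlgClosed.exists_pow_nat_eq a (n := 2) (by norm_num)
  exact ⟨Units.mk0 r (by rintro rfl; exact ha (by simpa using hr.symm)), hr⟩

/-- Scaling by a square root of `y 0` brings the first coordinate to 1. Thus, off `J₂ = 0`, the
projective coordinates determine the weighted point. -/
theorem weightedEquiv_dehomogenize {y : Fin 4 → QBar} (h : y 0 ≠ 0) :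
    WeightedEquiv y ![1, ringProj y 1 / ringProj y 0, ringProj y 2 / ringProj y 0,
      ringProj y 3 / ringProj y 0] := by
  obtain ⟨r, hr⟩ := exists_pow_two_eq (y 0) h
  refine ⟨r, fun i => ?_⟩
  have h4 : (r : QBar) ^ 4 = y 0 ^ 2 := by rw [← hr]; ring
  have h6 : (r : QBar) ^ 6 = y 0 ^ 3 := by rw [← hr]; ring
  have h10 : (r : QBar) ^ 10 = y 0 ^ 5 := by rw [← hr]; ring
  fin_cases i <;> simp [weight, ringProj, hr, h4, h6, h10] <;> field_simp

theorem mk_eq_point (q : {q : Fin 4 → ℚ // q ≠ 0}) (h : q.1 0 ≠ 0) :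
    (Quotient.mk _ q : WPQ) = point (projCoords q.1) := by
  apply Quotient.sound
  have h0 : toQBar q.1 0 ≠ 0 := by simpa [toQBar] using h
  change WeightedEquiv (toQBar q.1) (toQBar _)
  convert weightedEquiv_dehomogenize h0 using 1
  funext i
  fin_cases i <;> simp [toQBar, ringProj, projCoords]

/-- Both representatives have `J₂ = 1`, so the scalar satisfies `r² = 1`; as all weights are even,
it acts trivially. -/
theorem point_injective {x y : Fin 4 → ℚ} (hx : x 0 ≠ 0) (h0 : x 0 = y 0)
    (h : point x = point y) : x = y := by
  obtain ⟨r, hr⟩ := Quotient.exact h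
  have e0 := hr 0
  have e1 := hr 1
  have e2 := hr 2
  have e3 := hr 3
  simp only [toQBar, weight, Matrix.cons_val, map_one, mul_one] at e0 e1 e2 e3
  have h4 : (r : QBar) ^ 4 = 1 := by rw [show 4 = 2 * 2 from rfl, pow_mul, ← e0, one_pow]
  have h6 : (r : QBar) ^ 6 = 1 := by rw [show 6 = 2 * 3 from rfl, pow_mul, ← e0, one_pow]
  have h10 : (r : QBar) ^ 10 = 1 := by rw [show 10 = 2 * 5 from rfl, pow_mul, ← e0, one_pow]
  rw [h4, one_mul] at e1
  rw [h6, one_mul] at e2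
  rw [h10, one_mul] at e3
  have c (a b : ℚ) (hab : algebraMap ℚ QBar (a / x 0) = algebraMap ℚ QBar (b / y 0)) : a = b := by
    have := (algebraMap ℚ QBar).injective hab
    rwa [← h0, div_left_inj' hx] at this
  funext i
  fin_cases i
  · exact h0
  · exact c _ _ e1
  · exact c _ _ e2
  · exact c _ _ e3

theorem J2NeZero_point (x : Fin 4 → ℚ) : J2NeZero (point x) :=
  ⟨_, rfl, by simp⟩

/-- If `J₂ = 0`, only the last projective coordinate can be nonzero, so the height is 1. -/
theorem J2NeZero_of_one_lt_moduliHeight {p : WPQ} (h : 1 < moduliHeight p) : J2NeZero p := by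
  induction p using Quotient.inductionOn with
  | h q =>
    refine ⟨q, rfl, fun h0 => h.ne' ?_⟩
    change Height.mulHeight (projCoords q.1) = 1
    simp [projCoords, h0, Height.mulHeight_cons_zero, Height.mulHeight_eq_one_of_subsingleton]

theorem exists_primitive {x : Fin 4 → ℚ} (hx : x ≠ 0) :
    ∃ n : Fin 4 → ℤ, Finset.univ.gcd n = 1 ∧ ∃ c : ℚ, c ≠ 0 ∧ (fun i => (n i : ℚ)) = c • x := by
  let d : ℤ := ∏ i, ((x i).den : ℤ)
  have hd : d ≠ 0 := Finset.prod_ne_zero_iff.mpr fun i _ => by simp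
  have hy : ∀ i, ∃ y : ℤ, (y : ℚ) = d * x i := by
    intro i
    obtain ⟨e, he⟩ := Finset.dvd_prod_of_mem (fun i => ((x i).den : ℤ)) (Finset.mem_univ i)
    refine ⟨e * (x i).num, ?_⟩
    have : (d : ℚ) = (x i).den * e := by exact_mod_cast he
    rw [this]
    push_cast
    nth_rewrite 3 [← Rat.num_div_den (x i)]
    field_simp
  choose y hy using hy
  obtain ⟨n, hn, hn1⟩ := Finset.extract_gcd y (Finset.univ_nonempty (α := Fin 4))
  have hg : ((Finset.univ.gcd y : ℤ) : ℚ) ≠ 0 := by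
    intro h0
    apply hx
    funext i
    have := hy i
    rw [hn i (Finset.mem_univ i), Int.cast_mul, h0, zero_mul] at this
    simpa [hd] using this.symm
  refine ⟨n, hn1, (d : ℚ) / (Finset.univ.gcd y : ℤ), by simp [hd, hg], ?_⟩
  funext i
  rw [Pi.smul_apply, smul_eq_mul, div_mul_eq_mul_div, ← hy, hn i (Finset.mem_univ i), Int.cast_mul]
  field_simp

theorem J2NeZero.exists_primitive {p : WPQ} (h : J2NeZero p) :
    ∃ n : Fin 4 → ℤ, Finset.univ.gcd n = 1 ∧ n 0 ≠ 0 ∧ p = point fun i => (n i : ℚ) := by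
  obtain ⟨q, rfl, h0⟩ := h
  have hp0 : projCoords q.1 0 ≠ 0 := by simpa [projCoords] using h0
  obtain ⟨n, hn, c, hc, hnc⟩ := GenusTwo.exists_primitive (x := projCoords q.1) (by
    intro h
    exact hp0 (congrFun h 0))
  refine ⟨n, hn, ?_, ?_⟩
  · have := congrFun hnc 0
    intro hz
    rw [hz, Pi.smul_apply, smul_eq_mul, Int.cast_zero] at this
    exact mul_ne_zero hc hp0 this.symm
  · rw [hnc, point_smul hc, mk_eq_point q h0]

theorem moduliHeight_point_primitive {n : Fin 4 → ℤ} (hn : Finset.univ.gcd n = 1)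
    (h0 : n 0 ≠ 0) : moduliHeight (point fun i => (n i : ℚ)) = ((⨆ i, |n i| : ℤ) : ℝ) := by
  rw [moduliHeight_point (by exact_mod_cast h0)]
  exact mod_cast Rat.mulHeight_eq_max_abs_of_gcd_eq_one hn

theorem exists_eq_ringProj {C : Curve QBar} {x : Fin 4 → ℚ} (hx : x 0 ≠ 0)
    (h : C.HasModuliPoint (point x)) :
    ∃ s : QBar, ∀ i, algebraMap ℚ QBar (x i) = s * ringProj C.invariants i := by
  obtain ⟨q, hq, hw⟩ := h
  have hq' : WeightedEquiv (toQBar q.1) (toQBar ![1, x 1 / x 0, x 2 / x 0, x 3 / x 0]) :=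
    Quotient.exact hq
  obtain ⟨r, hr⟩ := (hw.trans hq').symm.exists_ringProj
  refine ⟨algebraMap ℚ QBar (x 0) * r, fun i => ?_⟩
  have h0 : algebraMap ℚ QBar (x 0) ≠ 0 := by simpa using hx
  have h1 := hr i
  have h2 := ringProj_map (algebraMap ℚ QBar) ![1, x 1 / x 0, x 2 / x 0, x 3 / x 0] i
  rw [mul_assoc, ← h1]
  change _ = _ * ringProj (fun j => algebraMap ℚ QBar _) i
  rw [h2, ringProj_dehomogenize hx, map_mul, map_inv₀, mul_inv_cancel_left₀ h0]

/-- The curve is only defined over the algebraic numbers; rationality of its projective coordinates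
suffices for its moduli point to be rational. -/
theorem hasModuliPoint_of_ringProj {C : Curve QBar} {x : Fin 4 → ℚ} (hx : x 0 ≠ 0)
    (h : ∀ i, algebraMap ℚ QBar (x i) = ringProj C.invariants i) :
    C.HasModuliPoint (point x) := by
  refine ⟨_, rfl, ?_⟩
  have h0 : C.invariants 0 ≠ 0 := by
    intro h0
    apply hx
    have := h 0
    simpa [ringProj, h0] using this
  convert weightedEquiv_dehomogenize h0 using 1
  funext i
  fin_cases i <;> simp [toQBar, ← h]

end Points

end GenusTwo

end

/-! ### Counting integer points of a hypersurface on the faces of a cube -/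

noncomputable section

namespace GenusTwo

section Count

theorem card_filter_eval_eq_zero_le {n : ℕ} {p : MvPolynomial (Fin (n + 1)) ℚ} (hp : p ≠ 0)
    (S : Finset ℤ) :
    ((Fintype.piFinset fun _ : Fin (n + 1) => S).filter
      fun y => MvPolynomial.eval (fun i => (y i : ℚ)) p = 0).card ≤
      p.totalDegree * S.card ^ n := by
  classical
  have h := MvPolynomial.schwartz_zippel_totalDegree hp (S.image ((↑) : ℤ → ℚ))
  rw [Finset.card_image_of_injective _ Int.cast_injective] at h
  have hle : ((Fintype.piFinset fun _ : Fin (n + 1) => S).filter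
      fun y => MvPolynomial.eval (fun i => (y i : ℚ)) p = 0).card ≤
      ((Fintype.piFinset fun _ : Fin (n + 1) => S.image ((↑) : ℤ → ℚ)).filter
      fun y => MvPolynomial.eval y p = 0).card := by
    apply Finset.card_le_card_of_injOn (fun y i => (y i : ℚ))
    · intro y hy
      simp only [Finset.coe_filter, Fintype.mem_piFinset, Set.mem_ofPred_eq] at hy ⊢
      exact ⟨fun i => Finset.mem_image_of_mem _ (hy.1 i), hy.2⟩
    · intro y _ z _ hyz
      funext i
      exact Int.cast_injective (congrFun hyz i)
  refine hle.trans ?_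
  rcases S.eq_empty_or_nonempty with rfl | hS
  · simp
  have hpos : (0 : ℚ≥0) < S.card := by exact_mod_cast hS.card_pos
  rw [div_le_div_iff₀ (pow_pos hpos _) hpos, pow_succ, ← mul_assoc] at h
  exact_mod_cast le_of_mul_le_mul_right h hpos

/-- Regard `G` as a polynomial in its first variable. It has finitely many roots among the
constants, so all but finitely many slices are nonzero, with total degree bounded independently of
the slice; Schwartz–Zippel then applies. -/
theorem exists_slice_bound {n : ℕ} {G : MvPolynomial (Fin (n + 2)) ℚ} (hG : G ≠ 0) :
    ∃ (d : ℕ) (T : Finset ℤ), ∀ t ∉ T, ∀ S : Finset ℤ,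
      ((Fintype.piFinset fun _ : Fin (n + 1) => S).filter
        fun y => MvPolynomial.eval (fun i => ((Fin.cons t y : Fin (n + 2) → ℤ) i : ℚ)) G = 0).card
        ≤ d * S.card ^ n := by
  let F := MvPolynomial.finSuccEquiv ℚ (n + 1) G
  have hF : F ≠ 0 := by simpa [F] using hG
  have hfin : {t : ℤ | F.eval (MvPolynomial.C (t : ℚ)) = 0}.Finite := by
    apply Set.Finite.of_finite_image (f := fun t : ℤ => (MvPolynomial.C (t : ℚ) :
      MvPolynomial (Fin (n + 1)) ℚ)) (F.roots.toFinset.finite_toSet.subset ?_)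
    · intro a _ b _ hab
      exact Int.cast_injective (MvPolynomial.C_injective _ _ hab)
    · rintro _ ⟨t, ht, rfl⟩
      simpa [hF] using ht
  refine ⟨F.support.sup fun i => (F.coeff i).totalDegree, hfin.toFinset, fun t ht S => ?_⟩
  have hp : F.eval (MvPolynomial.C (t : ℚ)) ≠ 0 := by simpa using ht
  have hdeg : (F.eval (MvPolynomial.C (t : ℚ))).totalDegree ≤
      F.support.sup fun i => (F.coeff i).totalDegree := by
    rw [eval_eq_sum, Polynomial.sum]
    refine (MvPolynomial.totalDegree_finsetSum _ _).trans (Finset.sup_mono_fun fun i _ => ?_)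
    rw [← map_pow]
    refine (MvPolynomial.totalDegree_mul _ _).trans ?_
    rw [MvPolynomial.totalDegree_C, add_zero]
  refine le_trans (Finset.card_le_card fun y hy => ?_)
    ((card_filter_eval_eq_zero_le hp S).trans (Nat.mul_le_mul_right _ hdeg))
  rw [Finset.mem_filter] at hy ⊢
  refine ⟨hy.1, ?_⟩
  rw [← hy.2]
  have hcons : (fun i => ((Fin.cons t y : Fin (n + 2) → ℤ) i : ℚ)) =
      Fin.cons (t : ℚ) fun i => (y i : ℚ) := by
    funext i
    refine Fin.cases ?_ (fun i => ?_) i <;> simp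
  rw [hcons, MvPolynomial.eval_eq_eval_mv_eval', eval_map, ← eval₂_at_apply, MvPolynomial.eval_C]

/-- The integral vectors of maximum norm `h` on a hypersurface. -/
def faceZeros {n : ℕ} (G : MvPolynomial (Fin n) ℚ) (h : ℕ) : Set (Fin n → ℤ) :=
  {x | (∀ i, |x i| ≤ h) ∧ (∃ i, |x i| = h) ∧ MvPolynomial.eval (fun i => (x i : ℚ)) G = 0}

theorem finite_box (n : ℕ) (h : ℕ) : {x : Fin n → ℤ | ∀ i, |x i| ≤ h}.Finite := by
  refine (Fintype.piFinset fun _ : Fin n => Finset.Icc (-(h : ℤ)) h).finite_toSet.subset ?_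
  intro x hx
  simp only [Finset.mem_coe, Fintype.mem_piFinset, Finset.mem_Icc, ← abs_le]
  exact hx

theorem exists_face_bound {n : ℕ} {G : MvPolynomial (Fin (n + 2)) ℚ} (hG : G ≠ 0)
    (i : Fin (n + 2)) :
    ∃ (d : ℕ) (T : Finset ℤ), ∀ t ∉ T, ∀ h : ℕ,
      {x : Fin (n + 2) → ℤ | (∀ i, |x i| ≤ h) ∧ x i = t ∧
        MvPolynomial.eval (fun i => (x i : ℚ)) G = 0}.ncard ≤ d * (2 * h + 1) ^ n := by
  let e := Equiv.swap 0 i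
  have hG' : MvPolynomial.rename e G ≠ 0 := by
    rwa [Ne, map_eq_zero_iff _ (MvPolynomial.rename_injective _ e.injective)]
  obtain ⟨d, T, H⟩ := exists_slice_bound hG'
  refine ⟨d, T, fun t ht h => ?_⟩
  have hc : (Finset.Icc (-(h : ℤ)) h).card = 2 * h + 1 := by
    rw [Int.card_Icc]
    omega
  rw [← hc]
  refine le_trans ?_ (H t ht _)
  rw [← Set.ncard_coe_finset]
  apply Set.ncard_le_ncard_of_injOn (fun x => Fin.tail (x ∘ e))
  · rintro x ⟨hx, hxi, hx0⟩
    have hcons : (Fin.cons t (Fin.tail (x ∘ e)) : Fin (n + 2) → ℤ) = x ∘ e := by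
      have : (x ∘ e) 0 = t := by simp [e, hxi]
      rw [← this, Fin.cons_self_tail]
    rw [Finset.mem_coe, Finset.mem_filter, hcons, MvPolynomial.eval_rename]
    refine ⟨?_, ?_⟩
    · simp only [Fintype.mem_piFinset, Finset.mem_Icc, ← abs_le]
      exact fun j => hx _
    · rw [← hx0]
      congr 2
      funext j
      simp [e]
  · rintro x ⟨-, hxi, -⟩ y ⟨-, hyi, -⟩ hxy
    have : x ∘ e = y ∘ e := by
      rw [← Fin.cons_self_tail (x ∘ e), ← Fin.cons_self_tail (y ∘ e)]
      congr 1
      simp [e, hxi, hyi]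
    exact e.surjective.injective_comp_right this

/-- The vectors of norm `h` lie on the faces `xᵢ = ±h`. For large `h` none of these is an
exceptional slice, so `G` does not vanish identically on any face. -/
theorem exists_faceZeros_bound {n : ℕ} {G : MvPolynomial (Fin (n + 2)) ℚ} (hG : G ≠ 0) :
    ∃ d : ℕ, ∀ᶠ h : ℕ in atTop, (faceZeros G h).ncard ≤ d * (2 * h + 1) ^ n := by
  choose d T H using exists_face_bound hG
  refine ⟨∑ i, 2 * d i, ?_⟩
  have hT : ∀ᶠ h : ℕ in atTop, ∀ i, (h : ℤ) ∉ T i ∧ -(h : ℤ) ∉ T i := by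
    rw [eventually_all]
    intro i
    have h1 : Tendsto (fun h : ℕ => (h : ℤ)) atTop cofinite :=
      Nat.cofinite_eq_atTop ▸ Function.Injective.tendsto_cofinite Nat.cast_injective
    have h2 : Tendsto (fun h : ℕ => -(h : ℤ)) atTop cofinite :=
      Nat.cofinite_eq_atTop ▸ Function.Injective.tendsto_cofinite
        (neg_injective.comp Nat.cast_injective)
    exact (h1.eventually (T i).finite_toSet.compl_mem_cofinite).and
      (h2.eventually (T i).finite_toSet.compl_mem_cofinite)
  filter_upwards [hT] with h hh
  let B (i : Fin (n + 2)) (t : ℤ) : Set (Fin (n + 2) → ℤ) :=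
    {x | (∀ i, |x i| ≤ h) ∧ x i = t ∧ MvPolynomial.eval (fun i => (x i : ℚ)) G = 0}
  have hsub : faceZeros G h ⊆ ⋃ i ∈ Finset.univ, B i h ∪ B i (-h) := by
    rintro x ⟨hx, ⟨i, hi⟩, h0⟩
    simp only [Set.mem_iUnion]
    refine ⟨i, Finset.mem_univ i, ?_⟩
    rcases eq_or_eq_neg_of_abs_eq hi with hi | hi
    · exact Or.inl ⟨hx, hi, h0⟩
    · exact Or.inr ⟨hx, hi, h0⟩
  have hfin : (⋃ i ∈ Finset.univ, B i h ∪ B i (-h)).Finite := by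
    refine (finite_box (n + 2) h).subset ?_
    intro x hx
    simp only [Set.mem_iUnion] at hx
    obtain ⟨i, -, hx | hx⟩ := hx <;> exact hx.1
  refine (Set.ncard_le_ncard hsub hfin).trans ((Finset.set_ncard_biUnion_le _ _).trans ?_)
  rw [Finset.sum_mul]
  refine Finset.sum_le_sum fun i _ => (Set.ncard_union_le _ _).trans ?_
  rw [mul_assoc, two_mul]
  exact add_le_add (H i _ (hh i).1 h) (H i _ (hh i).2 h)

end Count

/-! ### Growth of the totient -/

section Totient

/-- A prime power `q` dividing `n` satisfies `q ≤ 2 φ(q) ≤ 2 φ(n)`, so it divides the factorial.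
Consequently a bound on `φ(n)` bounds `n`. -/
theorem dvd_factorial_two_mul_totient {n : ℕ} (hn : 0 < n) : n ∣ (2 * n.totient).factorial := by
  rw [Nat.dvd_iff_prime_pow_dvd_dvd]
  intro p k hp hk
  rcases k with _ | k
  · simp
  refine Nat.dvd_factorial (pow_pos hp.pos _) ?_
  have h1 := Nat.le_of_dvd (Nat.totient_pos.mpr hn) (Nat.totient_dvd_of_dvd hk)
  rw [Nat.totient_prime_pow_succ hp] at h1
  have h2 : p ≤ 2 * (p - 1) := by have := hp.two_le; omega
  calc p ^ (k + 1) = p ^ k * p := pow_succ p k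
    _ ≤ p ^ k * (2 * (p - 1)) := Nat.mul_le_mul_left _ h2
    _ = 2 * (p ^ k * (p - 1)) := by ring
    _ ≤ 2 * n.totient := Nat.mul_le_mul_left _ h1

theorem tendsto_totient_atTop : Tendsto Nat.totient atTop atTop := by
  rw [tendsto_atTop]
  intro N
  filter_upwards [eventually_gt_atTop (2 * N).factorial] with n hn
  by_contra! h
  have h1 := Nat.le_of_dvd (Nat.factorial_pos _) (dvd_factorial_two_mul_totient (n := n) (by omega))
  have h2 : (2 * n.totient).factorial ≤ (2 * N).factorial := Nat.factorial_le (by omega)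
  omega

end Totient

end GenusTwo

end

/-! ### Upper and lower bounds for the number of points of height `h` -/

noncomputable section

namespace GenusTwo

section Asymptotics

theorem iSup_abs_eq {n : ℕ} (x : Fin (n + 1) → ℤ) (h : ℤ) :
    (⨆ i, |x i|) = h ↔ (∀ i, |x i| ≤ h) ∧ ∃ i, |x i| = h := by
  constructor
  · rintro rfl
    exact ⟨fun i => le_ciSup (Set.finite_range fun i => |x i|).bddAbove i,
      exists_eq_ciSup_of_finite⟩
  · rintro ⟨h1, i, hi⟩
    exact le_antisymm (ciSup_le h1) (hi ▸ le_ciSup (Set.finite_range fun i => |x i|).bddAbove i)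

theorem J2NeZero.exists_face {p : WPQ} (hp : J2NeZero p) :
    ∃ n : Fin 4 → ℤ, Finset.univ.gcd n = 1 ∧ n 0 ≠ 0 ∧ p = point (fun i => (n i : ℚ)) ∧
      ∃ k : ℕ, moduliHeight p = k ∧ (∀ i, |n i| ≤ k) ∧ ∃ i, |n i| = k := by
  obtain ⟨n, hn, h0, rfl⟩ := hp.exists_primitive
  refine ⟨n, hn, h0, rfl, (⨆ i, |n i|).toNat, ?_⟩
  have hk : (((⨆ i, |n i|).toNat : ℕ) : ℤ) = ⨆ i, |n i| :=
    Int.toNat_of_nonneg ((abs_nonneg _).trans (((iSup_abs_eq n _).mp rfl).1 0))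
  refine ⟨?_, (iSup_abs_eq n _).mp hk.symm⟩
  rw [moduliHeight_point_primitive hn h0]
  exact_mod_cast hk.symm

theorem finite_moduliHeight_le (h : ℕ) : {p : WPQ | J2NeZero p ∧ moduliHeight p ≤ h}.Finite := by
  refine ((finite_box 4 h).image fun n => point fun i => (n i : ℚ)).subset ?_
  rintro p ⟨hp, hh⟩
  obtain ⟨n, -, -, hpn, k, hk, hle, -⟩ := hp.exists_face
  refine ⟨n, fun i => (hle i).trans ?_, hpn.symm⟩
  rw [hk] at hh
  exact_mod_cast hh

theorem finite_moduliHeight_eq (S : Set WPQ) (h : ℕ) :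
    {p ∈ S | J2NeZero p ∧ moduliHeight p = h}.Finite :=
  (finite_moduliHeight_le h).subset fun _ hp => ⟨hp.2.1, hp.2.2.le⟩

theorem setOf_moduliHeight_eq (S : Set WPQ) {h : ℕ} (hh : 2 ≤ h) :
    {p ∈ S | moduliHeight p = h} = {p ∈ S | J2NeZero p ∧ moduliHeight p = h} := by
  ext p
  refine ⟨fun hp => ⟨hp.1, J2NeZero_of_one_lt_moduliHeight ?_, hp.2⟩, fun hp => ⟨hp.1, hp.2.2⟩⟩
  rw [hp.2]
  exact_mod_cast hh

/-- Off `J₂ = 0` every moduli height is a natural number, so the set of height at most `h` is a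
disjoint union of finite level sets. -/
theorem ncard_moduliHeight_le (S : Set WPQ) (h : ℕ) :
    {p ∈ S | J2NeZero p ∧ moduliHeight p ≤ h}.ncard =
      ∑ k ∈ Finset.range (h + 1), {p ∈ S | J2NeZero p ∧ moduliHeight p = k}.ncard := by
  have key (h : ℕ) : {p ∈ S | J2NeZero p ∧ moduliHeight p ≤ h} =
      ⋃ k ∈ Finset.range (h + 1), {p ∈ S | J2NeZero p ∧ moduliHeight p = k} := by
    ext p
    simp only [Set.mem_iUnion, Finset.mem_range, exists_prop]
    constructor
    · rintro ⟨hS, hp, hh⟩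
      obtain ⟨-, -, -, -, k, hk, -⟩ := hp.exists_face
      refine ⟨k, ?_, hS, hp, hk⟩
      rw [hk] at hh
      exact Nat.lt_succ_of_le (by exact_mod_cast hh)
    · rintro ⟨k, hk, hS, hp, hh⟩
      refine ⟨hS, hp, ?_⟩
      rw [hh]
      exact_mod_cast Nat.le_of_lt_succ hk
  induction h with
  | zero =>
    rw [key]
    simp
  | succ h ih =>
    rw [Finset.sum_range_succ, ← ih, ← Set.ncard_union_eq ?_
      ((finite_moduliHeight_le h).subset fun _ hp => hp.2) (finite_moduliHeight_eq S _)]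
    · congr 1
      rw [key, key, Finset.range_add_one, Finset.set_biUnion_insert, Set.union_comm]
    · rw [Set.disjoint_left]
      rintro p ⟨-, -, h1⟩ ⟨-, -, h2⟩
      rw [h2] at h1
      have : h + 1 ≤ h := by exact_mod_cast h1
      omega

theorem exists_extra_bound : ∃ K : ℕ, ∀ᶠ h : ℕ in atTop,
    {p ∈ M2QExtra | J2NeZero p ∧ moduliHeight p = h}.ncard ≤ K * h ^ 2 := by
  obtain ⟨G, hG, H⟩ := exists_relation_of_hasExtraAutomorphism
  obtain ⟨d, hd⟩ := exists_faceZeros_bound (n := 2) hG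
  refine ⟨d * 9, ?_⟩
  filter_upwards [hd, eventually_ge_atTop 1] with h hh h1
  have hfin : (faceZeros G h).Finite := (finite_box 4 h).subset fun x hx => hx.1
  have hsub : {p ∈ M2QExtra | J2NeZero p ∧ moduliHeight p = h} ⊆
      (fun n : Fin 4 → ℤ => point fun i => (n i : ℚ)) '' faceZeros G h := by
    rintro p ⟨⟨C, hC, hCe⟩, hp, hph⟩
    obtain ⟨n, -, h0, rfl, k, hk, hle, hi⟩ := hp.exists_face
    have hkh : k = h := by
      rw [hk] at hph
      exact_mod_cast hph
    subst hkh
    obtain ⟨s, hs⟩ := exists_eq_ringProj (by exact_mod_cast h0) hC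
    exact ⟨n, ⟨hle, hi, H C hCe s _ hs⟩, rfl⟩
  calc _ ≤ _ := Set.ncard_le_ncard hsub (hfin.image _)
    _ ≤ (faceZeros G h).ncard := Set.ncard_image_le hfin
    _ ≤ d * (2 * h + 1) ^ 2 := hh
    _ ≤ d * (3 * h) ^ 2 := Nat.mul_le_mul_left d (Nat.pow_le_pow_left (by omega) 2)
    _ = d * 9 * h ^ 2 := by ring

/-- The points counted are the vectors `(h, y₀, y₁, y₂)` with entries `yᵢ` in `[1, h]` and `y₀`
coprime to `h`: they are primitive of norm `h` and pairwise inequivalent. Those on the exceptional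
hypersurface of the dominant map number at most `d h²`. -/
theorem exists_lower_bound : ∃ d : ℕ, ∀ᶠ h : ℕ in atTop,
    h.totient * h ^ 2 ≤ {p ∈ M2Q | J2NeZero p ∧ moduliHeight p = h}.ncard + d * h ^ 2 := by
  classical
  obtain ⟨G, hG, H⟩ := exists_curve_of_eval_ne_zero
  obtain ⟨d, T, hT⟩ := exists_slice_bound (n := 2) hG
  refine ⟨d, ?_⟩
  have hev : ∀ᶠ h : ℕ in atTop, (h : ℤ) ∉ T :=
    (Nat.cofinite_eq_atTop ▸ Function.Injective.tendsto_cofinite Nat.cast_injective :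
      Tendsto (fun h : ℕ => (h : ℤ)) atTop cofinite).eventually T.finite_toSet.compl_mem_cofinite
  filter_upwards [hev, eventually_ge_atTop 2] with h hh h2
  let S : Finset ℤ := Finset.Icc 1 h
  have hS : S.card = h := by simp [S]
  let S₀ : Finset ℤ := ((Finset.range h).filter h.Coprime).image (↑)
  have hS₀ : S₀.card = h.totient := Finset.card_image_of_injective _ Nat.cast_injective
  have hS₀S : ∀ a ∈ S₀, a ∈ S ∧ IsCoprime (h : ℤ) a := by
    intro a ha
    obtain ⟨b, hb, rfl⟩ := Finset.mem_image.mp ha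
    obtain ⟨hb1, hb2⟩ := Finset.mem_filter.mp hb
    refine ⟨?_, Nat.isCoprime_iff_coprime.mpr hb2⟩
    -- Zero is coprime only to 1, so `h ≥ 2` places the residues counted by the totient in `[1, h)`.
    have : b ≠ 0 := by
      rintro rfl
      rw [Nat.coprime_zero_right] at hb2
      omega
    have := Finset.mem_range.mp hb1
    simp only [S, Finset.mem_Icc]
    omega
  let Y : Finset (Fin 3 → ℤ) := Fintype.piFinset ![S₀, S, S]
  have hYS : ∀ y ∈ Y, (∀ i, y i ∈ S) ∧ IsCoprime (h : ℤ) (y 0) := by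
    intro y hy
    have := Fintype.mem_piFinset.mp hy
    refine ⟨fun i => ?_, (hS₀S _ (this 0)).2⟩
    fin_cases i
    · exact (hS₀S _ (this 0)).1
    · exact this 1
    · exact this 2
  have hY : Y.card = h.totient * h ^ 2 := by
    simp only [Y, Fintype.card_piFinset, Fin.prod_univ_three, Matrix.cons_val, hS, hS₀]
    ring
  let bad := (Fintype.piFinset fun _ : Fin 3 => S).filter
    fun y => MvPolynomial.eval (fun i => ((Fin.cons (h : ℤ) y : Fin 4 → ℤ) i : ℚ)) G = 0
  have hbad : bad.card ≤ d * h ^ 2 := by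
    have := hT h hh S
    rwa [hS] at this
  have hgood : (Y \ bad).card ≤ {p ∈ M2Q | J2NeZero p ∧ moduliHeight p = h}.ncard := by
    rw [← Set.ncard_coe_finset]
    refine Set.ncard_le_ncard_of_injOn
      (fun y => point fun i => ((Fin.cons (h : ℤ) y : Fin 4 → ℤ) i : ℚ)) ?_ ?_
      (finite_moduliHeight_eq _ _)
    · intro y hy
      obtain ⟨hyY, hyb⟩ := Finset.mem_sdiff.mp hy
      obtain ⟨hyS, hyc⟩ := hYS y hyY
      have hne : MvPolynomial.eval (fun i => ((Fin.cons (h : ℤ) y : Fin 4 → ℤ) i : ℚ)) G ≠ 0 :=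
        fun h0 => hyb (Finset.mem_filter.mpr ⟨Fintype.mem_piFinset.mpr hyS, h0⟩)
      have h0 : (Fin.cons (h : ℤ) y : Fin 4 → ℤ) 0 ≠ 0 := by
        rw [Fin.cons_zero]
        omega
      obtain ⟨C, hC⟩ := H _ hne
      refine ⟨⟨C, hasModuliPoint_of_ringProj (by exact_mod_cast h0) hC⟩, J2NeZero_point _, ?_⟩
      rw [moduliHeight_point_primitive _ h0, (iSup_abs_eq _ (h : ℤ)).mpr]
      · simp
      · refine ⟨fun i => ?_, 0, by simp⟩
        refine Fin.cases (by simp) (fun i => ?_) i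
        have := hyS i
        simp only [S, Finset.mem_Icc] at this
        rw [Fin.cons_succ, abs_le]
        omega
      · have h1 : Finset.univ.gcd (Fin.cons (h : ℤ) y : Fin 4 → ℤ) ∣ h :=
          Finset.gcd_dvd (f := (Fin.cons (h : ℤ) y : Fin 4 → ℤ)) (Finset.mem_univ 0)
        have h2 : Finset.univ.gcd (Fin.cons (h : ℤ) y : Fin 4 → ℤ) ∣ y 0 :=
          Finset.gcd_dvd (f := (Fin.cons (h : ℤ) y : Fin 4 → ℤ)) (Finset.mem_univ 1)
        rw [← Finset.normalize_gcd, normalize_eq_one]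
        exact hyc.isUnit_of_dvd' h1 h2
    · intro y hy z hz hyz
      have h0 : ((h : ℤ) : ℚ) ≠ 0 := by
        have : h ≠ 0 := by omega
        exact_mod_cast this
      -- The common first coordinate `h` fixes the scaling, including the sign.
      have := point_injective (by simpa using h0) (by simp) hyz
      funext i
      have := congrFun this i.succ
      simpa using this
  rw [← hY]
  have := Finset.card_le_card_sdiff_add_card (s := Y) (t := bad)
  omega

end Asymptotics

end GenusTwo

end

/-! ### Comparison of the counts -/

noncomputable section

namespace GenusTwo

section Density

theorem eventually_mul_sq_le (N : ℕ) : ∀ᶠ h : ℕ in atTop,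
    N * h ^ 2 ≤ {p ∈ M2Q | J2NeZero p ∧ moduliHeight p = h}.ncard := by
  obtain ⟨d, hd⟩ := exists_lower_bound
  filter_upwards [hd, tendsto_totient_atTop.eventually_ge_atTop (N + d)] with h h1 h2
  have := Nat.mul_le_mul_right (h ^ 2) h2
  rw [add_mul] at this
  omega

/-- The numerator is at most `K h²`, while the denominator exceeds any multiple of `h²`, because the
totient is unbounded along every sequence. -/
theorem extra_isLittleO :
    (fun h : ℕ => ({p ∈ M2QExtra | J2NeZero p ∧ moduliHeight p = h}.ncard : ℝ)) =o[atTop]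
      fun h : ℕ => ({p ∈ M2Q | J2NeZero p ∧ moduliHeight p = h}.ncard : ℝ) := by
  rw [Asymptotics.isLittleO_iff_nat_mul_le]
  intro n
  obtain ⟨K, hK⟩ := exists_extra_bound
  filter_upwards [hK, eventually_mul_sq_le (n * K)] with h h1 h2
  rw [Real.norm_natCast, Real.norm_natCast]
  have : n * {p ∈ M2QExtra | J2NeZero p ∧ moduliHeight p = h}.ncard ≤
      {p ∈ M2Q | J2NeZero p ∧ moduliHeight p = h}.ncard :=
    (Nat.mul_le_mul_left n h1).trans (by rwa [← mul_assoc])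
  exact_mod_cast this

theorem eventually_one_le_ncard : ∀ᶠ h : ℕ in atTop,
    1 ≤ {p ∈ M2Q | J2NeZero p ∧ moduliHeight p = h}.ncard := by
  filter_upwards [eventually_mul_sq_le 1, eventually_ge_atTop 1] with h h1 h2
  exact le_trans (by rw [one_mul]; exact Nat.one_le_pow _ _ h2) h1

/-- The terms are eventually at least 1, so the series diverges. Divergence is what lets the
little-o relation pass to partial sums. -/
theorem tendsto_sum_ncard_atTop :
    Tendsto (fun n : ℕ => ∑ k ∈ Finset.range n,
      ({p ∈ M2Q | J2NeZero p ∧ moduliHeight p = k}.ncard : ℝ)) atTop atTop := by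
  rw [← not_summable_iff_tendsto_nat_atTop_of_nonneg fun _ => Nat.cast_nonneg _]
  intro hs
  obtain ⟨h, h1, h2⟩ := ((hs.tendsto_atTop_zero.eventually_lt_const one_pos).and
    eventually_one_le_ncard).exists
  have : {p ∈ M2Q | J2NeZero p ∧ moduliHeight p = h}.ncard < 1 := by exact_mod_cast h1
  omega

end Density

end GenusTwo

end

theorem mainTheorem5 :
    -- points of moduli height exactly `h`
    ((∀ᶠ h : ℕ in atTop,
        {p ∈ GenusTwo.M2Q | GenusTwo.moduliHeight p = h}.Finite ∧
        {p ∈ GenusTwo.M2Q | GenusTwo.moduliHeight p = h}.Nonempty) ∧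
      Tendsto (fun h : ℕ =>
          ({p ∈ GenusTwo.M2QExtra | GenusTwo.moduliHeight p = h}.ncard : ℝ) /
            ({p ∈ GenusTwo.M2Q | GenusTwo.moduliHeight p = h}.ncard : ℝ))
        atTop (𝓝 0)) ∧
    -- points of moduli height at most `h`, outside the locus `J₂ = 0`
    ((∀ᶠ h : ℕ in atTop,
        {p ∈ GenusTwo.M2Q | GenusTwo.J2NeZero p ∧ GenusTwo.moduliHeight p ≤ h}.Finite ∧
        {p ∈ GenusTwo.M2Q | GenusTwo.J2NeZero p ∧ GenusTwo.moduliHeight p ≤ h}.Nonempty) ∧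
      Tendsto (fun h : ℕ =>
          ({p ∈ GenusTwo.M2QExtra |
              GenusTwo.J2NeZero p ∧ GenusTwo.moduliHeight p ≤ h}.ncard : ℝ) /
            ({p ∈ GenusTwo.M2Q |
              GenusTwo.J2NeZero p ∧ GenusTwo.moduliHeight p ≤ h}.ncard : ℝ))
        atTop (𝓝 0)) := by
  open GenusTwo in
  refine ⟨⟨?_, ?_⟩, ?_, ?_⟩
  · filter_upwards [eventually_one_le_ncard, eventually_ge_atTop 2] with h h1 h2
    rw [setOf_moduliHeight_eq _ h2]
    exact ⟨finite_moduliHeight_eq _ _, Set.nonempty_of_ncard_ne_zero (by omega)⟩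
  · refine extra_isLittleO.tendsto_div_nhds_zero.congr' ?_
    filter_upwards [eventually_ge_atTop 2] with h h2
    -- For `h ≥ 2` the condition `J₂ ≠ 0` is automatic, so the counts are those compared above.
    rw [setOf_moduliHeight_eq _ h2, setOf_moduliHeight_eq _ h2]
  · filter_upwards [eventually_one_le_ncard] with h h1
    refine ⟨(finite_moduliHeight_le h).subset fun _ hp => hp.2, ?_⟩
    obtain ⟨p, hp⟩ := Set.nonempty_of_ncard_ne_zero (by omega :
      {p ∈ M2Q | J2NeZero p ∧ moduliHeight p = h}.ncard ≠ 0)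
    exact ⟨p, hp.1, hp.2.1, hp.2.2.le⟩
  -- Partial sums run over `k < n`, so the shift by one gives the count of heights up to and
  -- including `h`.
  · have h := (extra_isLittleO.sum_range (fun _ => Nat.cast_nonneg _)
      tendsto_sum_ncard_atTop).tendsto_div_nhds_zero.comp (tendsto_add_atTop_nat 1)
    refine h.congr fun n => ?_
    rw [ncard_moduliHeight_le, ncard_moduliHeight_le]
    push_cast
    rfl
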